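/- **Corollary.** Let $G$ be a compact connected semisimple Lie group and let $L\subsetneq K\subsetneq G$ be connected closed non-trivial subgroups, with Lie algebras $\mathfrak l\subset\mathfrak k\subset\mathfrak g$. Let $\Phi$ be the Killing form of $\mathfrak g$ and $B=-\Phi$, let $\mathfrak g=\mathfrak k\oplus\mathfrak n$ and $\mathfrak k=\mathfrak l\oplus\mathfrak p$ be $B$-orthogonal decompositions, and consider the fibration $$M=G/L\longrightarrow N=G/K\quad\text{with fiber } F=K/L .$$ Suppose that: * $N$ is isotropy irreducible, i.e. $\mathfrak n$ is an irreducible $\mathrm{Ad}\,K$-module; * $F$ is a simply connected symmetric space, with symmetric decomposition $\mathfrak k=\mathfrak l\oplus\mathfrak p$, i.e. $[\mathfrak p,\mathfrak p]\subset\mathfrak l$; * $\mathfrak p=\mathfrak p_1\oplus\dots\oplus\mathfrak p_s$ is a $B$-orthogonal decomposition into irreducible $\mathrm{Ad}\,L$-submodules (the tangent spaces of the irreducible factors of $F$), the $\mathfrak p_a$ are pairwise inequivalent $\mathrm{Ad}\,L$-modules, and no non-zero $\mathrm{Ad}\,L$-submodule of $\mathfrak p$ is equivalent to an $\mathrm{Ad}\,L$-submodule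 of $\mathfrak n$. Let $C_{\mathfrak k}=-\sum_i(\mathrm{ad}_{u_i})^2$, for a $B$-orthonormal basis $(u_i)$ of $\mathfrak k$, be the Casimir operator of $\mathfrak k$ with respect to $\Phi$, and let $\gamma_a$ be its eigenvalue on $\mathfrak p_a$, i.e. $C_{\mathfrak k}|_{\mathfrak p_a}=\gamma_a\,\mathrm{Id}$. Let $g_M$ be a $G$-invariant adapted metric on $M$, i.e. a $G$-invariant Riemannian metric such that $M\to N$ is a Riemannian submersion (for some Riemannian metric on $N$) with totally geodesic fibers, and let $g_F$ be its restriction to the fiber $F$. If $g_M$ and $g_F$ are both Einstein, then $$\gamma_a=\gamma_b\quad\text{or}\quad\gamma_a=1-\gamma_b\qquad\text{for all }a,b=1,\dots,s .$$ -/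

import Mathlib

open scoped Manifold ContDiff
open Bundle

noncomputable section

namespace HomogeneousFibration

/-! ### Riemannian geometry: Levi-Civita connection, curvature, Einstein metrics -/

section Riemannian

variable {E : Type*} [NormedAddCommGroup E] [NormedSpace ℝ E]
  {M : Type*} [TopologicalSpace M] [ChartedSpace E M] [IsManifold 𝓘(ℝ, E) ∞ M]

variable (E M) in
/-- Smooth Riemannian metrics on a manifold `M` modelled on `E`. -/
abbrev RiemannianMetric : Type _ :=
  ContMDiffRiemannianMetric 𝓘(ℝ, E) ∞ E (fun x : M => TangentSpace 𝓘(ℝ, E) x)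

variable (E M) in
/-- Affine connections on the tangent bundle of `M`; `cov Y x v` is `∇_v Y` at `x`. -/
abbrev Connection : Type _ :=
  CovariantDerivative 𝓘(ℝ, E) E (fun x : M => TangentSpace 𝓘(ℝ, E) x)

variable (E) in
/-- The vector field `X` on `M` is smooth. -/
def IsSmoothField (X : ∀ x : M, TangentSpace 𝓘(ℝ, E) x) : Prop :=
  ContMDiff 𝓘(ℝ, E) 𝓘(ℝ, E).tangent ∞ (fun x => (TotalSpace.mk' E x (X x) : TangentBundle 𝓘(ℝ, E) M))

variable (E) in
/-- The vector field `X` on `M` is differentiable at `x`. -/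
def IsDiffFieldAt (X : ∀ x : M, TangentSpace 𝓘(ℝ, E) x) (x : M) : Prop :=
  MDifferentiableAt 𝓘(ℝ, E) 𝓘(ℝ, E).tangent
    (fun y => (TotalSpace.mk' E y (X y) : TangentBundle 𝓘(ℝ, E) M)) x

/-- `cov` is the Levi-Civita connection of `g`: it is torsion-free and compatible with `g`. -/
structure IsLeviCivita (g : RiemannianMetric E M) (cov : Connection E M) : Prop where
  torsion_free : ∀ (X Y : ∀ x : M, TangentSpace 𝓘(ℝ, E) x) (x : M),
    IsDiffFieldAt E X x → IsDiffFieldAt E Y x →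
      cov Y x (X x) - cov X x (Y x) = VectorField.mlieBracket 𝓘(ℝ, E) X Y x
  metric : ∀ (Y Z : ∀ x : M, TangentSpace 𝓘(ℝ, E) x) (x : M),
    IsDiffFieldAt E Y x → IsDiffFieldAt E Z x → ∀ v : TangentSpace 𝓘(ℝ, E) x,
      mfderiv 𝓘(ℝ, E) 𝓘(ℝ, ℝ) (fun y => g.inner y (Y y) (Z y)) x v =
        g.inner x (cov Y x v) (Z x) + g.inner x (Y x) (cov Z x v)

/-- `R` is the curvature tensor of `cov`:
`R(X, Y) Z = ∇_X ∇_Y Z - ∇_Y ∇_X Z - ∇_[X, Y] Z` for all smooth vector fields. -/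
def IsCurvatureTensor (cov : Connection E M)
    (R : ∀ x : M, TangentSpace 𝓘(ℝ, E) x →ₗ[ℝ] TangentSpace 𝓘(ℝ, E) x →ₗ[ℝ]
      TangentSpace 𝓘(ℝ, E) x →ₗ[ℝ] TangentSpace 𝓘(ℝ, E) x) : Prop :=
  ∀ X Y Z : ∀ x : M, TangentSpace 𝓘(ℝ, E) x,
    IsSmoothField E X → IsSmoothField E Y → IsSmoothField E Z → ∀ x : M,
      R x (X x) (Y x) (Z x) =
        cov (fun y => cov Z y (Y y)) x (X x) - cov (fun y => cov Z y (X y)) x (Y x)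
          - cov Z x (VectorField.mlieBracket 𝓘(ℝ, E) X Y x)

/-- The Ricci curvature of a curvature tensor: `Ric(v, w)` is the trace of `u ↦ R(u, v) w`. -/
def ricci (R : ∀ x : M, TangentSpace 𝓘(ℝ, E) x →ₗ[ℝ] TangentSpace 𝓘(ℝ, E) x →ₗ[ℝ]
      TangentSpace 𝓘(ℝ, E) x →ₗ[ℝ] TangentSpace 𝓘(ℝ, E) x)
    (x : M) (v w : TangentSpace 𝓘(ℝ, E) x) : ℝ :=
  LinearMap.trace ℝ (TangentSpace 𝓘(ℝ, E) x) (((R x).flip v).flip w)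

/-- `g` is an Einstein metric: the Ricci curvature of its Levi-Civita connection satisfies
`Ric = c g` for a constant `c`. -/
def IsEinstein (g : RiemannianMetric E M) : Prop :=
  ∃ cov : Connection E M, IsLeviCivita g cov ∧
    ∃ R, IsCurvatureTensor cov R ∧
      ∃ c : ℝ, ∀ (x : M) (v w : TangentSpace 𝓘(ℝ, E) x), ricci R x v w = c * g.inner x v w

variable {E' : Type*} [NormedAddCommGroup E'] [NormedSpace ℝ E']
  {N : Type*} [TopologicalSpace N] [ChartedSpace E' N] [IsManifold 𝓘(ℝ, E') ∞ N]

/-- `f : (M, g) → (N, g')` is a Riemannian submersion: a smooth submersion whose differential is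
isometric on the orthogonal complement of its kernel. -/
def IsRiemannianSubmersion (g : RiemannianMetric E M) (g' : RiemannianMetric E' N)
    (f : M → N) : Prop :=
  Manifold.IsSubmersion 𝓘(ℝ, E) 𝓘(ℝ, E') ∞ f ∧
    ∀ (x : M) (v w : TangentSpace 𝓘(ℝ, E) x),
      (∀ u : TangentSpace 𝓘(ℝ, E) x, mfderiv 𝓘(ℝ, E) 𝓘(ℝ, E') f x u = 0 → g.inner x v u = 0) →
      (∀ u : TangentSpace 𝓘(ℝ, E) x, mfderiv 𝓘(ℝ, E) 𝓘(ℝ, E') f x u = 0 → g.inner x w u = 0) →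
      g'.inner (f x) (mfderiv 𝓘(ℝ, E) 𝓘(ℝ, E') f x v) (mfderiv 𝓘(ℝ, E) 𝓘(ℝ, E') f x w) =
        g.inner x v w

/-- The fibres of the submersion `f : M → N` are totally geodesic for `g`: their second fundamental
form vanishes, i.e. `∇_X Y` is vertical for all vertical vector fields `X`, `Y`. -/
def HasTotallyGeodesicFibers (g : RiemannianMetric E M) (f : M → N) : Prop :=
  ∀ cov : Connection E M, IsLeviCivita g cov →
    ∀ X Y : ∀ x : M, TangentSpace 𝓘(ℝ, E) x, IsSmoothField E X → IsSmoothField E Y →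
      (∀ x, mfderiv 𝓘(ℝ, E) 𝓘(ℝ, E') f x (X x) = 0) →
      (∀ x, mfderiv 𝓘(ℝ, E) 𝓘(ℝ, E') f x (Y x) = 0) →
      ∀ x, mfderiv 𝓘(ℝ, E) 𝓘(ℝ, E') f x (cov Y x (X x)) = 0

/-- `g` is the pullback of `g'` along `f`. -/
def IsPullbackMetric (f : M → N) (g : RiemannianMetric E M) (g' : RiemannianMetric E' N) : Prop :=
  ∀ (x : M) (v w : TangentSpace 𝓘(ℝ, E) x), g.inner x v w =
    g'.inner (f x) (mfderiv 𝓘(ℝ, E) 𝓘(ℝ, E') f x v) (mfderiv 𝓘(ℝ, E) 𝓘(ℝ, E') f x w)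

end Riemannian

/-! ### Lie groups, their Lie algebras and the adjoint representation -/

instance leInfty_minSmoothness_three : ENat.LEInfty (minSmoothness ℝ 3) :=
  ⟨by
    rw [minSmoothness_of_isRCLikeNormedField]
    exact ENat.LEInfty.out⟩

section LieGroup

variable (E : Type*) [NormedAddCommGroup E] [NormedSpace ℝ E] [FiniteDimensional ℝ E]
  (G : Type*) [TopologicalSpace G] [ChartedSpace E G] [Group G] [LieGroup 𝓘(ℝ, E) ∞ G]

instance completeSpace_of_finiteDimensional : CompleteSpace E := FiniteDimensional.complete ℝ E

/-- The Lie algebra `𝔤 = T₁G` of the Lie group `G`. -/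
abbrev LieAlg : Type _ := GroupLieAlgebra 𝓘(ℝ, E) G

/-- The Killing form `Φ` of `G`. -/
abbrev killing : LinearMap.BilinForm ℝ (LieAlg E G) := killingForm ℝ (LieAlg E G)

variable {G}

/-- The adjoint representation: `Ad a` is the differential at `1` of `x ↦ a x a⁻¹`. -/
def Ad (a : G) : LieAlg E G →L[ℝ] LieAlg E G :=
  mfderiv 𝓘(ℝ, E) 𝓘(ℝ, E) (fun x : G => a * x * a⁻¹) (1 : G)

/-- The Lie algebra of a Lie subgroup `K ≤ G`, as a subspace of `𝔤`: the image of `T₁K` under the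
differential of the inclusion. -/
def subgroupLieAlg (EK : Type*) [NormedAddCommGroup EK] [NormedSpace ℝ EK]
    (K : Subgroup G) [ChartedSpace EK K] : Submodule ℝ (LieAlg E G) :=
  LinearMap.range
    ((mfderiv 𝓘(ℝ, EK) 𝓘(ℝ, E) (fun k : K => (k : G)) (1 : K) :
      TangentSpace 𝓘(ℝ, EK) (1 : K) →L[ℝ] LieAlg E G) :
      TangentSpace 𝓘(ℝ, EK) (1 : K) →ₗ[ℝ] LieAlg E G)

/-- The `Φ`-orthogonal complement of `U` in `V`, for `Φ` the Killing form of `G`. -/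
def orthIn (U V : Submodule ℝ (LieAlg E G)) : Submodule ℝ (LieAlg E G) :=
  V ⊓ (killing E G).orthogonal U

/-- `V ⊆ 𝔤` is an `Ad H`-submodule. -/
def IsAdSubmodule (H : Subgroup G) (V : Submodule ℝ (LieAlg E G)) : Prop :=
  ∀ h ∈ H, ∀ v ∈ V, Ad E h v ∈ V

/-- `V ⊆ 𝔤` is an irreducible `Ad H`-submodule. -/
def IsAdIrreducible (H : Subgroup G) (V : Submodule ℝ (LieAlg E G)) : Prop :=
  V ≠ ⊥ ∧ IsAdSubmodule E H V ∧
    ∀ W : Submodule ℝ (LieAlg E G), W ≤ V → IsAdSubmodule E H W → W = ⊥ ∨ W = V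

/-- `V, W ⊆ 𝔤` are equivalent `Ad H`-modules. -/
def AdEquivalent (H : Subgroup G) (V W : Submodule ℝ (LieAlg E G)) : Prop :=
  ∃ f : V ≃ₗ[ℝ] W, ∀ h ∈ H, ∀ v v' : V, (v' : LieAlg E G) = Ad E h v →
    (f v' : LieAlg E G) = Ad E h (f v)

/-- `C` is the Casimir operator of the subspace `U ⊆ 𝔤` with respect to the Killing form `Φ`.
As `Φ` is negative definite for compact semisimple `G`, an orthonormal basis of `U` with
respect to `Φ` is, in real terms, a basis `u` with `Φ(uᵢ, uⱼ) = -δᵢⱼ`, whose `Φ`-dual basis is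
`-u`; thus `C = ∑ ad(uᵢ) ad(-uᵢ) = -∑ ad(uᵢ)²`, and `Φ(C X, X)` is the trace of
`ad(X)²` restricted to `U` when `[X, U] ⊆ U`. -/
def IsCasimir (U : Submodule ℝ (LieAlg E G)) (C : LieAlg E G →ₗ[ℝ] LieAlg E G) : Prop :=
  ∃ (n : ℕ) (u : Module.Basis (Fin n) ℝ U),
    (∀ i j, killing E G (u i) (u j) = if i = j then -1 else 0) ∧
      ∀ x : LieAlg E G, C x = -∑ i, ⁅(u i : LieAlg E G), ⁅(u i : LieAlg E G), x⁆⁆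

end LieGroup

/-! ### Coset spaces -/

section Cosets

variable {G : Type*} [Group G]

/-- The inclusion `K/L → G/L`, `kL ↦ kL`, of the fibre over the base point of `G/L → G/K`. -/
def fiberInclusion (K L : Subgroup G) : K ⧸ L.subgroupOf K → G ⧸ L :=
  Quotient.map' (fun k : K => (k : G)) (fun a b h => by
    rw [QuotientGroup.leftRel_apply] at h ⊢
    exact h)

variable {E : Type*} [NormedAddCommGroup E] [NormedSpace ℝ E]
  {M : Type*} [TopologicalSpace M] [ChartedSpace E M] [IsManifold 𝓘(ℝ, E) ∞ M]

variable (G) in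
/-- The metric `g` on `M` is invariant under the action of `G`. -/
def IsInvariantMetric [MulAction G M] (g : RiemannianMetric E M) : Prop :=
  ∀ (a : G) (x : M) (v w : TangentSpace 𝓘(ℝ, E) x),
    g.inner (a • x) (mfderiv 𝓘(ℝ, E) 𝓘(ℝ, E) (fun y : M => a • y) x v)
      (mfderiv 𝓘(ℝ, E) 𝓘(ℝ, E) (fun y : M => a • y) x w) = g.inner x v w

/-- A `G`-invariant adapted metric on `M = G/L`: the projection `G/L → G/K` is a Riemannian
submersion, for some Riemannian metric on `G/K`, with totally geodesic fibres. -/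
def IsAdapted [TopologicalSpace G] {K L : Subgroup G} (hLK : L ≤ K)
    {EM : Type*} [NormedAddCommGroup EM] [NormedSpace ℝ EM]
    [ChartedSpace EM (G ⧸ L)] [IsManifold 𝓘(ℝ, EM) ∞ (G ⧸ L)]
    (EN : Type*) [NormedAddCommGroup EN] [NormedSpace ℝ EN]
    [ChartedSpace EN (G ⧸ K)] [IsManifold 𝓘(ℝ, EN) ∞ (G ⧸ K)]
    (gM : RiemannianMetric EM (G ⧸ L)) : Prop :=
  IsInvariantMetric G gM ∧
  (∃ gN : RiemannianMetric EN (G ⧸ K),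
    IsRiemannianSubmersion gM gN (Subgroup.quotientMapOfLE hLK)) ∧
  HasTotallyGeodesicFibers (E' := EN) gM (Subgroup.quotientMapOfLE hLK)

end Cosets

end HomogeneousFibration

end

noncomputable section

namespace HomogeneousFibration

open VectorField Filter
open scoped Topology

/-! ### Related vector fields and their Lie brackets -/

section Related

/-! At the base coset an invariant metric on `G/L` is a symmetric form q on 𝔤 (`fundForm`), null on
𝔩 and `Ad L`-invariant. Schur's lemma and the inequivalence hypotheses make q simple: the 𝔭ₐ and 𝔫
are mutually q-orthogonal, q = -λₐΦ on 𝔭ₐ with λₐ > 0, and, since the Riemannian submersion makes q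
on 𝔫 invariant under `Ad K`, also Φ = -βq on 𝔫 with β ≠ 0.

Ricci curvature is needed only in directions X ∈ 𝔭ₐ. There q(X, ·) = -λₐΦ(X, ·) on all of 𝔤, so q(X,
[X, Z]) = 0: X is a geodesic vector, and Koszul's formula for fundamental fields (`koszul_fund`)
yields g(R(e, X)X, e) in terms of brackets (`inner_curvature_fund`). For e ∈ 𝔭 the symmetric fibre
gives -q([X, [X, e]], e); for e ∈ 𝔫 the same expression appears with the factor (λₐβ)²/4. Hence
Ricci reduces to the traces of (ad X)² over 𝔭 and 𝔫 (`ricci_total`, `ricci_fiber`).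

The trace over 𝔨 is γₐΦ(X, X), by invariance of Φ and the Casimir eigenvalue. Since ad X exchanges 𝔩
and 𝔭, half of it is carried by 𝔭; what is left of Φ(X, X) = tr (ad X)², namely (1 - γₐ)Φ(X, X), is
carried by 𝔫 (`IsFibrationForm.partial_traces`). The Einstein equations become c_F λₐ = γₐ/2 and c_M
λₐ = γₐ/2 + (λₐβ)²/4 · (1 - γₐ).

If c_F = 0, every γₐ is 0. Otherwise, subtracting and dividing by λₐ shows that λₐ(1 - γₐ), hence
γₐ(1 - γₐ), does not depend on a; two numbers with the same value of t(1 - t) are equal or add up to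
1.

The passage from manifolds to this algebra rests on one principle: related vector fields have
related brackets (`mlieBracket_related`). It gives [X*, Y*] = -[X, Y]* for fundamental fields and
the derivative of Ad, hence the Killing equation `derivAlong_fundForm`. -/

lemma lieBracket_related {E E' : Type*} [NormedAddCommGroup E] [NormedSpace ℝ E]
    [NormedAddCommGroup E'] [NormedSpace ℝ E'] {f : E → E'} {V W : E → E} {V' W' : E' → E'} {x : E}
    (hf : ContDiffAt ℝ 2 f x) (hV : DifferentiableAt ℝ V x) (hW : DifferentiableAt ℝ W x)
    (hV' : DifferentiableAt ℝ V' (f x)) (hW' : DifferentiableAt ℝ W' (f x))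
    (hVV' : ∀ᶠ y in 𝓝 x, fderiv ℝ f y (V y) = V' (f y))
    (hWW' : ∀ᶠ y in 𝓝 x, fderiv ℝ f y (W y) = W' (f y)) :
    fderiv ℝ f x (lieBracket ℝ V W x) = lieBracket ℝ V' W' (f x) := by
  have hfd : DifferentiableAt ℝ f x := hf.differentiableAt (by norm_num)
  have hf2 : DifferentiableAt ℝ (fderiv ℝ f) x :=
    (hf.fderiv_right (m := 1) (by norm_num)).differentiableAt (by norm_num)
  have key : ∀ (U : E → E) (U' : E' → E'), DifferentiableAt ℝ U x → DifferentiableAt ℝ U' (f x) →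
      (∀ᶠ y in 𝓝 x, fderiv ℝ f y (U y) = U' (f y)) → ∀ w,
      fderiv ℝ (fderiv ℝ f) x w (U x) + fderiv ℝ f x (fderiv ℝ U x w) =
        fderiv ℝ U' (f x) (fderiv ℝ f x w) := by
    intro U U' hU hU' h w
    have h1 := (hf2.hasFDerivAt.clm_apply hU.hasFDerivAt)
    have h2 := hU'.hasFDerivAt.comp x hfd.hasFDerivAt
    have h3 := h1.unique (h2.congr_of_eventuallyEq h)
    have := congrArg (fun L => L w) h3
    simp at this
    rw [← this, add_comm]
  have hs := (hf.isSymmSndFDerivAt (by simp)) (V x) (W x)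
  simp only [lieBracket, map_sub]
  rw [← hVV'.self_of_nhds, ← hWW'.self_of_nhds, ← key V V' hV hV' hVV', ← key W W' hW hW' hWW', hs]
  abel

variable {E : Type*} [NormedAddCommGroup E] [NormedSpace ℝ E] [CompleteSpace E]
  {H : Type*} [TopologicalSpace H] {I : ModelWithCorners ℝ E H} [I.Boundaryless]
  {M : Type*} [TopologicalSpace M] [ChartedSpace H M] [IsManifold I ∞ M]
  {E' : Type*} [NormedAddCommGroup E'] [NormedSpace ℝ E'] [CompleteSpace E']
  {H' : Type*} [TopologicalSpace H'] {I' : ModelWithCorners ℝ E' H'} [I'.Boundaryless]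
  {M' : Type*} [TopologicalSpace M'] [ChartedSpace H' M'] [IsManifold I' ∞ M']

omit [CompleteSpace E] [I.Boundaryless] in
-- The differentials of a chart and of its inverse are mutually inverse, so pulling back along
-- `symm` is pushing forward along the chart.
lemma mpullbackWithin_extChartAt_symm (x : M) (U : ∀ x : M, TangentSpace I x) {z : M}
    (hz : z ∈ (extChartAt I x).source) :
    mpullbackWithin 𝓘(ℝ, E) I (extChartAt I x).symm U (Set.range I) (extChartAt I x z) =
      mfderiv I 𝓘(ℝ, E) (extChartAt I x) z (U z) := by
  have hz' := (extChartAt I x).map_source hz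
  rw [mpullbackWithin_apply, ContinuousLinearMap.inverse_eq
    (mfderivWithin_extChartAt_symm_comp_mfderiv_extChartAt hz')
    (mfderiv_extChartAt_comp_mfderivWithin_extChartAt_symm hz'), (extChartAt I x).left_inv hz]

omit [CompleteSpace E] in
-- The preferred chart at x has identity differential at x, so the bracket computed in that chart
-- needs no correction.
lemma mlieBracket_eq_lieBracket (V W : ∀ x : M, TangentSpace I x) (x : M) :
    (mlieBracket I V W x : E) = lieBracket ℝ
      (mpullbackWithin 𝓘(ℝ, E) I (extChartAt I x).symm V (Set.range I) : E → E)
      (mpullbackWithin 𝓘(ℝ, E) I (extChartAt I x).symm W (Set.range I) : E → E)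
      (extChartAt I x x) := by
  have h : ((extChartAt I x).symm ⁻¹' Set.univ ∩ Set.range I) = Set.univ := by
    rw [Set.preimage_univ, Set.univ_inter, I.range_eq_univ]
  rw [mlieBracket, mlieBracketWithin_apply, mfderiv_extChartAt_self, h]
  exact (DFunLike.congr_fun (ContinuousLinearMap.inverse_id (R := ℝ) (M := E)) _).trans
    (congrFun lieBracketWithin_univ _)

lemma differentiableAt_mpullbackWithin_extChartAt_symm {x : M} {U : ∀ x : M, TangentSpace I x}
    (hU : MDifferentiableAt I I.tangent
      (fun y => (TotalSpace.mk' E y (U y) : TangentBundle I M)) x) :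
    DifferentiableAt ℝ
      (mpullbackWithin 𝓘(ℝ, E) I (extChartAt I x).symm U (Set.range I) : E → E)
      (extChartAt I x x) := by
  have h : ((extChartAt I x).symm ⁻¹' Set.univ ∩ Set.range I) = Set.univ := by
    rw [Set.preimage_univ, Set.univ_inter, I.range_eq_univ]
  have := MDifferentiableWithinAt.differentiableWithinAt_mpullbackWithin_vectorField
      (s := Set.univ) hU.mdifferentiableWithinAt
  rw [h] at this
  exact differentiableWithinAt_univ.1 this

/-- Vector fields related by a smooth map have related Lie brackets. -/
lemma mlieBracket_related {f : M → M'} {V W : ∀ x : M, TangentSpace I x}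
    {V' W' : ∀ x : M', TangentSpace I' x} {x : M}
    (hf : ContMDiff I I' ∞ f)
    (hV : MDifferentiableAt I I.tangent (fun y => (TotalSpace.mk' E y (V y) : TangentBundle I M)) x)
    (hW : MDifferentiableAt I I.tangent (fun y => (TotalSpace.mk' E y (W y) : TangentBundle I M)) x)
    (hV' : MDifferentiableAt I' I'.tangent
      (fun y => (TotalSpace.mk' E' y (V' y) : TangentBundle I' M')) (f x))
    (hW' : MDifferentiableAt I' I'.tangent
      (fun y => (TotalSpace.mk' E' y (W' y) : TangentBundle I' M')) (f x))
    (hVV' : ∀ y, mfderiv I I' f y (V y) = V' (f y))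
    (hWW' : ∀ y, mfderiv I I' f y (W y) = W' (f y)) :
    mfderiv I I' f x (mlieBracket I V W x) = mlieBracket I' V' W' (f x) := by
  set φ := extChartAt I x with hφ
  set ψ := extChartAt I' (f x) with hψ
  set F : E → E' := ψ ∘ f ∘ φ.symm with hF
  have hfd : ∀ y, MDifferentiableAt I I' f y := fun y => hf.mdifferentiable (by simp) y
  have hFx : F (φ x) = ψ (f x) := by simp [hF, hφ]
  have hφx : φ.symm (φ x) = x := by simp [hφ]
  have hF2 : ContDiffAt ℝ 2 F (φ x) := by
    have := (contMDiffAt_iff.1 (hf x)).2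
    rw [I.range_eq_univ, contDiffWithinAt_univ] at this
    exact this.of_le (by exact WithTop.coe_le_coe.2 le_top)
  -- pulled back fields
  have key : ∀ (U : ∀ x : M, TangentSpace I x) (U' : ∀ x : M', TangentSpace I' x),
      (∀ y, mfderiv I I' f y (U y) = U' (f y)) → ∀ᶠ u in 𝓝 (φ x),
      fderiv ℝ F u (mpullbackWithin 𝓘(ℝ, E) I φ.symm U (Set.range I) u) =
        mpullbackWithin 𝓘(ℝ, E') I' ψ.symm U' (Set.range I') (F u) := by
    intro U U' h
    have h1 : ∀ᶠ u in 𝓝 (φ x), u ∈ φ.target :=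
      (isOpen_extChartAt_target x).mem_nhds (mem_extChartAt_target x)
    have hc : ContinuousAt (f ∘ φ.symm) (φ x) := by
      refine ContinuousAt.comp ?_ (continuousAt_extChartAt_symm x)
      rw [hφx]; exact hf.continuous.continuousAt
    have h2 : ∀ᶠ u in 𝓝 (φ x), f (φ.symm u) ∈ ψ.source := by
      apply hc.eventually
      simp only [Function.comp, hφx]
      exact extChartAt_source_mem_nhds (I := I') (f x)
    filter_upwards [h1, h2] with u hu hu2
    set y := φ.symm u with hy
    have hys : y ∈ φ.source := φ.map_target hu
    have huy : u = φ y := (φ.right_inv hu).symm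
    have hFu : F u = ψ (f y) := rfl
    rw [hFu, mpullbackWithin_extChartAt_symm _ _ hu2, huy, mpullbackWithin_extChartAt_symm _ _ hys,
      ← h y]
    have d1 : MDifferentiableAt 𝓘(ℝ, E) I φ.symm (φ y) := by
      have := mdifferentiableWithinAt_extChartAt_symm (I := I) (x := x) (φ.map_source hys)
      rwa [I.range_eq_univ, mdifferentiableWithinAt_univ] at this
    have hφy : φ.symm (φ y) = y := φ.left_inv hys
    have d2 : MDifferentiableAt I' 𝓘(ℝ, E') ψ (f y) :=
      mdifferentiableAt_extChartAt (by simpa [hψ] using hu2)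
    have d3 : MDifferentiableAt I I' f y := hfd y
    have e1 : HasMFDerivAt I 𝓘(ℝ, E) φ y (mfderiv I 𝓘(ℝ, E) φ y) :=
      (mdifferentiableAt_extChartAt (by simpa [hφ] using hys)).hasMFDerivAt
    have e2 : MDifferentiableAt 𝓘(ℝ, E) 𝓘(ℝ, E') F (φ y) := by
      refine MDifferentiableAt.comp (I' := I') (φ y) ?_ ?_
      · simpa [Function.comp, hφy] using d2
      · refine MDifferentiableAt.comp (I' := I) (φ y) ?_ d1
        rw [hφy]; exact d3
    have e3 : HasMFDerivAt I 𝓘(ℝ, E') (F ∘ φ) y ((mfderiv 𝓘(ℝ, E) 𝓘(ℝ, E') F (φ y)).comp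
        (mfderiv I 𝓘(ℝ, E) φ y)) := e2.hasMFDerivAt.comp y e1
    have e4 : HasMFDerivAt I 𝓘(ℝ, E') (ψ ∘ f) y ((mfderiv I' 𝓘(ℝ, E') ψ (f y)).comp
        (mfderiv I I' f y)) := d2.hasMFDerivAt.comp y d3.hasMFDerivAt
    -- The coordinate expression `F` satisfies F ∘ φ = ψ ∘ f near y; comparing differentials carries
    -- relatedness to the charts.
    have e5 : (F ∘ φ) =ᶠ[𝓝 y] (ψ ∘ f) := by
      filter_upwards [(isOpen_extChartAt_source (I := I) x).mem_nhds hys] with z hz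
      simp [hF, φ.left_inv hz]
    have e6 := hasMFDerivAt_unique e3 (e4.congr_of_eventuallyEq e5)
    have e7 := DFunLike.congr_fun e6 (U y)
    rw [mfderiv_eq_fderiv] at e7
    exact e7
  have hxs := mem_extChartAt_source (I := I) x
  have e6 : fderiv ℝ F (φ x) = (mfderiv I I' f x : E →L[ℝ] E') := by
    have := (hfd x).mfderiv
    rw [this, I.range_eq_univ, fderivWithin_univ]
    rfl
  have := lieBracket_related hF2 (differentiableAt_mpullbackWithin_extChartAt_symm hV)
    (differentiableAt_mpullbackWithin_extChartAt_symm hW)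
    (by rw [hFx]; exact differentiableAt_mpullbackWithin_extChartAt_symm hV')
    (by rw [hFx]; exact differentiableAt_mpullbackWithin_extChartAt_symm hW')
    (key V V' hVV') (key W W' hWW')
  rw [e6, hFx] at this
  have h1 := mlieBracket_eq_lieBracket V W x
  have h2 := mlieBracket_eq_lieBracket V' W' (f x)
  exact ((congrArg (mfderiv I I' f x : E →L[ℝ] E') h1).trans this).trans h2.symm

end Related

/-! ### Submersions: local sections, descent of smoothness, tangent spaces of fibres -/

section Submersion

variable {E : Type*} [NormedAddCommGroup E] [NormedSpace ℝ E]
  {H : Type*} [TopologicalSpace H] {I : ModelWithCorners ℝ E H} [I.Boundaryless]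
  {M : Type*} [TopologicalSpace M] [ChartedSpace H M]
  {E' : Type*} [NormedAddCommGroup E'] [NormedSpace ℝ E']
  {H' : Type*} [TopologicalSpace H'] {I' : ModelWithCorners ℝ E' H'} [I'.Boundaryless]
  {N : Type*} [TopologicalSpace N] [ChartedSpace H' N]
  {E'' : Type*} [NormedAddCommGroup E''] [NormedSpace ℝ E'']
  {H'' : Type*} [TopologicalSpace H''] {I'' : ModelWithCorners ℝ E'' H''}
  {P : Type*} [TopologicalSpace P] [ChartedSpace H'' P]

omit [I'.Boundaryless] in
/-- A submersion has a smooth local section through every point of its source. -/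
lemma exists_local_section {pr : M → N} (hpr : Manifold.IsSubmersion I I' ∞ pr) (x : M) :
    ∃ σ : N → M, ContMDiffAt I' I ∞ σ (pr x) ∧ σ (pr x) = x ∧ ∀ᶠ y in 𝓝 (pr x), pr (σ y) = y := by
  have h := hpr.isSubmersionAt x
  set φ := h.domChart.extend I with hφ
  set ψ := h.codChart.extend I' with hψ
  have hxφ : x ∈ φ.source := by
    rw [hφ, OpenPartialHomeomorph.extend_source]; exact h.mem_domChart_source
  have hxψ : pr x ∈ ψ.source := by
    rw [hψ, OpenPartialHomeomorph.extend_source]; exact h.mem_codChart_source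
  have hw := h.writtenInCharts
  -- In adapted charts the submersion is the projection to the first factor; the section keeps the
  -- complementary coordinate frozen at its value at x.
  let u : N → E := fun y => h.equiv.symm (ψ y, (h.equiv (φ x)).2)
  have hux : u (pr x) = φ x := by
    have := hw (φ.map_source hxφ)
    simp only [Function.comp] at this
    rw [← hφ, ← hψ, φ.left_inv hxφ] at this
    simp only [u, this]
    exact h.equiv.symm_apply_apply _
  have hu : ContMDiffAt I' 𝓘(ℝ, E) ∞ u (pr x) := by
    have h1 : ContMDiffAt I' 𝓘(ℝ, E') ∞ ψ (pr x) :=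
      h.codChart.contMDiffAt_extend h.codChart_mem_maximalAtlas h.mem_codChart_source
    have h2 : ContDiff ℝ ∞ (fun v : E' => h.equiv.symm (v, (h.equiv (φ x)).2)) := by fun_prop
    exact h2.contMDiff.contMDiffAt.comp (pr x) h1
  have hto : IsOpen φ.target := h.domChart.isOpen_extend_target
  have hut : ∀ᶠ y in 𝓝 (pr x), u y ∈ φ.target :=
    hu.continuousAt.eventually (by rw [hux]; exact hto.mem_nhds (φ.map_source hxφ))
  refine ⟨φ.symm ∘ u, ?_, by simp [hux, φ.left_inv hxφ], ?_⟩
  · refine ContMDiffAt.comp (pr x) ?_ hu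
    rw [hux]
    exact (contMDiffOn_extend_symm h.domChart_mem_maximalAtlas).contMDiffAt
      (by
        have := hto.mem_nhds (φ.map_source hxφ)
        rw [hφ, OpenPartialHomeomorph.extend_target'] at this
        exact this)
  · have hys : ∀ᶠ y in 𝓝 (pr x), y ∈ ψ.source := by
      rw [hψ, OpenPartialHomeomorph.extend_source]
      exact h.codChart.open_source.mem_nhds h.mem_codChart_source
    filter_upwards [hut, hys] with y hy hys
    have := hw hy
    simp only [Function.comp] at this ⊢
    rw [← hφ, ← hψ] at this
    refine ψ.injOn ?_ hys ?_
    · have h3 := φ.map_target hy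
      rw [hφ, OpenPartialHomeomorph.extend_source] at h3
      have := h.source_subset_preimage_source h3
      rw [hψ, OpenPartialHomeomorph.extend_source]
      exact this
    · rw [this]; simp [u]

omit [I'.Boundaryless] in
/-- A map out of the target of a surjective submersion is smooth when its composition with the
submersion is. -/
lemma contMDiff_of_comp_submersion {pr : M → N} (hpr : Manifold.IsSubmersion I I' ∞ pr)
    (hsurj : Function.Surjective pr) {f : N → P} (hf : ContMDiff I I'' ∞ (f ∘ pr)) :
    ContMDiff I' I'' ∞ f := by
  intro y
  obtain ⟨x, rfl⟩ := hsurj y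
  obtain ⟨σ, hσ, hσx, h⟩ := exists_local_section hpr x
  have h1 : ContMDiffAt I' I'' ∞ ((f ∘ pr) ∘ σ) (pr x) :=
    ContMDiffAt.comp (pr x) (hf _) hσ
  refine h1.congr_of_eventuallyEq ?_
  filter_upwards [h] with y hy
  simp [hy]

omit [I'.Boundaryless] in
-- The differential of a local section through x is a right inverse.
lemma mfderiv_surjective_of_submersion {pr : M → N} (hpr : Manifold.IsSubmersion I I' ∞ pr) (x : M) :
    Function.Surjective (mfderiv I I' pr x) := by
  obtain ⟨σ, hσ, hσx, h⟩ := exists_local_section hpr x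
  intro v
  have d1 : HasMFDerivAt I' I σ (pr x) (mfderiv I' I σ (pr x)) :=
    (hσ.mdifferentiableAt (by simp)).hasMFDerivAt
  have d2 : HasMFDerivAt I I' pr (σ (pr x)) (mfderiv I I' pr (σ (pr x))) :=
    (hpr.contMDiff.mdifferentiable (by simp) _).hasMFDerivAt
  have d3 := d2.comp (pr x) d1
  have d4 : HasMFDerivAt I' I' (pr ∘ σ) (pr x) (ContinuousLinearMap.id ℝ _) :=
    (hasMFDerivAt_id (pr x)).congr_of_eventuallyEq (by filter_upwards [h] with y hy; simpa using hy)
  have := DFunLike.congr_fun (hasMFDerivAt_unique d3 d4) v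
  rw [hσx] at this
  exact ⟨_, this⟩

omit [I'.Boundaryless] in
/-- The kernel of the differential of a submersion is tangent to any embedded submanifold
containing the fibre. -/
lemma ker_submersion_le_range {pr : M → N} (hpr : Manifold.IsSubmersion I I' ∞ pr)
    [I''.Boundaryless] {j : P → M} (hj : Manifold.IsSmoothEmbedding I'' I ∞ j) (s : P)
    (hfib : ∀ x, pr x = pr (j s) → x ∈ Set.range j) (v : TangentSpace I (j s))
    (hv : mfderiv I I' pr (j s) v = 0) : ∃ w, mfderiv I'' I j s w = v := by
  revert v
  set x := j s with hx
  intro v hv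
  have h := hpr.isSubmersionAt x
  set φ := h.domChart.extend I with hφ
  set ψ := h.codChart.extend I' with hψ
  have hxφ : x ∈ φ.source := by
    rw [hφ, OpenPartialHomeomorph.extend_source]; exact h.mem_domChart_source
  have hφo : IsOpen φ.source := by
    rw [hφ, OpenPartialHomeomorph.extend_source]; exact h.domChart.open_source
  have hw : ∀ u ∈ φ.target, ψ (pr (φ.symm u)) = (h.equiv u).1 := h.writtenInCharts
  have hto : IsOpen φ.target := h.domChart.isOpen_extend_target
  have hφd : MDifferentiableAt I 𝓘(ℝ, E) φ x :=
    (h.domChart.contMDiffAt_extend h.domChart_mem_maximalAtlas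
      h.mem_domChart_source).mdifferentiableAt (by simp)
  have hψd : MDifferentiableAt I' 𝓘(ℝ, E') ψ (pr x) :=
    (h.codChart.contMDiffAt_extend h.codChart_mem_maximalAtlas
      h.mem_codChart_source).mdifferentiableAt (by simp)
  have hφsd : MDifferentiableAt 𝓘(ℝ, E) I φ.symm (φ x) := by
    refine ((contMDiffOn_extend_symm h.domChart_mem_maximalAtlas).contMDiffAt
      ?_).mdifferentiableAt (by simp)
    have := hto.mem_nhds (φ.map_source hxφ)
    rw [hφ, OpenPartialHomeomorph.extend_target'] at this
    exact this
  have hprd : MDifferentiableAt I I' pr x := hpr.contMDiff.mdifferentiable (by simp) x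
  set w : E := mfderiv I 𝓘(ℝ, E) φ x v with hwdef
  have hew : (h.equiv w).1 = 0 := by
    have a1 := hψd.hasMFDerivAt.comp x hprd.hasMFDerivAt
    have a2 : HasMFDerivAt 𝓘(ℝ, E) 𝓘(ℝ, E') (fun u => (h.equiv u).1) (φ x)
        ((ContinuousLinearMap.fst ℝ E' h.complement).comp (h.equiv : E →L[ℝ] _)) :=
      ((ContinuousLinearMap.fst ℝ E' h.complement).comp
        (h.equiv : E →L[ℝ] E' × h.complement)).hasFDerivAt.hasMFDerivAt
    have a3 := a2.comp x hφd.hasMFDerivAt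
    have a4 := hasMFDerivAt_unique a1 (a3.congr_of_eventuallyEq (by
      filter_upwards [hφo.mem_nhds hxφ] with y hy
      have := hw _ (φ.map_source hy)
      rw [φ.left_inv hy] at this
      exact this))
    have a5 := DFunLike.congr_fun a4 v
    have a6 : (mfderiv I' 𝓘(ℝ, E') ψ (pr x)) (mfderiv I I' pr x v) = (h.equiv w).1 := a5
    rw [← a6]
    exact (congrArg (mfderiv I' 𝓘(ℝ, E') ψ (pr x)) hv).trans (map_zero _)
  -- A straight line in the submersion chart, with velocity v. The first component of `w` is zero by
  -- `hew`, so the curve stays in the fibre and hence in the range of j.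
  let c : ℝ → M := fun t => φ.symm (φ x + t • w)
  have hc0 : c 0 = x := by simp [c, φ.left_inv hxφ]
  have hline : HasMFDerivAt 𝓘(ℝ, ℝ) 𝓘(ℝ, E) (fun t : ℝ => φ x + t • w) 0
      ((ContinuousLinearMap.id ℝ ℝ).smulRight w) := by
    have : HasFDerivAt (fun t : ℝ => φ x + t • w) ((ContinuousLinearMap.id ℝ ℝ).smulRight w) 0 :=
      ((hasFDerivAt_id (𝕜 := ℝ) (0 : ℝ)).smul_const w).const_add (φ x)
    exact this.hasMFDerivAt
  have hcd : HasMFDerivAt 𝓘(ℝ, ℝ) I c 0 ((mfderiv 𝓘(ℝ, E) I φ.symm (φ x)).comp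
      ((ContinuousLinearMap.id ℝ ℝ).smulRight w)) := by
    refine HasMFDerivAt.comp (I' := 𝓘(ℝ, E)) (g := φ.symm) (0 : ℝ) ?_ hline
    have : φ x + (0 : ℝ) • w = φ x := by simp
    rw [this]
    exact hφsd.hasMFDerivAt
  have hvw : mfderiv 𝓘(ℝ, E) I φ.symm (φ x) w = v := by
    have a1 := hφsd.hasMFDerivAt.comp x hφd.hasMFDerivAt
    have a2 : HasMFDerivAt I I (φ.symm ∘ φ) x (ContinuousLinearMap.id ℝ _) :=
      (hasMFDerivAt_id x).congr_of_eventuallyEq (by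
        filter_upwards [hφo.mem_nhds hxφ] with y hy using φ.left_inv hy)
    exact DFunLike.congr_fun (hasMFDerivAt_unique a1 a2) v
  have hcont : ContinuousAt c 0 := hcd.continuousAt
  have hct : ∀ᶠ t in 𝓝 (0 : ℝ), c t ∈ Set.range j := by
    have b1 : ∀ᶠ t in 𝓝 (0 : ℝ), φ x + t • w ∈ φ.target := by
      have : ContinuousAt (fun t : ℝ => φ x + t • w) 0 := hline.continuousAt
      exact this.eventually (by simpa using hto.mem_nhds (φ.map_source hxφ))
    filter_upwards [b1] with t ht
    apply hfib
    have hsrc : ∀ y ∈ φ.source, pr y ∈ ψ.source := by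
      intro y hy
      rw [hφ, OpenPartialHomeomorph.extend_source] at hy
      rw [hψ, OpenPartialHomeomorph.extend_source]
      exact h.source_subset_preimage_source hy
    refine ψ.injOn (hsrc _ (φ.map_target ht)) (hsrc _ hxφ) ?_
    have b2 := hw _ (φ.map_source hxφ)
    rw [φ.left_inv hxφ] at b2
    rw [hw _ ht, b2]
    simp [hew]
  -- the embedded submanifold
  have hi := hj.isImmersion.isImmersionAt s
  set α := hi.domChart.extend I'' with hα
  set β := hi.codChart.extend I with hβ
  have hsα : s ∈ α.source := by
    rw [hα, OpenPartialHomeomorph.extend_source]; exact hi.mem_domChart_source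
  have hαo : IsOpen α.source := by
    rw [hα, OpenPartialHomeomorph.extend_source]; exact hi.domChart.open_source
  have hαto : IsOpen α.target := hi.domChart.isOpen_extend_target
  have hβo : IsOpen β.source := by
    rw [hβ, OpenPartialHomeomorph.extend_source]; exact hi.codChart.open_source
  have hxβ : x ∈ β.source := by
    rw [hβ, OpenPartialHomeomorph.extend_source]; exact hi.mem_codChart_source
  have hij : ∀ u ∈ α.target, β (j (α.symm u)) = hi.equiv (u, 0) := hi.writtenInCharts
  have hβd : MDifferentiableAt I 𝓘(ℝ, E) β x :=
    (hi.codChart.contMDiffAt_extend hi.codChart_mem_maximalAtlas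
      hi.mem_codChart_source).mdifferentiableAt (by simp)
  have hβto : IsOpen β.target := hi.codChart.isOpen_extend_target
  have hβsd : MDifferentiableAt 𝓘(ℝ, E) I β.symm (β x) := by
    refine ((contMDiffOn_extend_symm hi.codChart_mem_maximalAtlas).contMDiffAt
      ?_).mdifferentiableAt (by simp)
    have := hβto.mem_nhds (β.map_source hxβ)
    rw [hβ, OpenPartialHomeomorph.extend_target'] at this
    exact this
  have hαsd : MDifferentiableAt 𝓘(ℝ, E'') I'' α.symm (α s) := by
    refine ((contMDiffOn_extend_symm hi.domChart_mem_maximalAtlas).contMDiffAt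
      ?_).mdifferentiableAt (by simp)
    have := hαto.mem_nhds (α.map_source hsα)
    rw [hα, OpenPartialHomeomorph.extend_target'] at this
    exact this
  have hβinj : Function.Injective (mfderiv I 𝓘(ℝ, E) β x) := by
    have a1 := hβsd.hasMFDerivAt.comp x hβd.hasMFDerivAt
    have a2 : HasMFDerivAt I I (β.symm ∘ β) x (ContinuousLinearMap.id ℝ _) :=
      (hasMFDerivAt_id x).congr_of_eventuallyEq (by
        filter_upwards [hβo.mem_nhds hxβ] with y hy using β.left_inv hy)
    have a3 := hasMFDerivAt_unique a1 a2
    refine Function.LeftInverse.injective (g := mfderiv 𝓘(ℝ, E) I β.symm (β x)) fun u => ?_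
    exact DFunLike.congr_fun a3 u
  have hsnd : (hi.equiv.symm (mfderiv I 𝓘(ℝ, E) β x v)).2 = 0 := by
    -- The normal coordinate of the immersion chart: it vanishes on the slice, so once c is known to
    -- run in the slice its derivative along v is 0.
    let lam : E →L[ℝ] hi.complement :=
      (ContinuousLinearMap.snd ℝ E'' hi.complement).comp (hi.equiv.symm : E →L[ℝ] _)
    have a1 : HasMFDerivAt 𝓘(ℝ, ℝ) 𝓘(ℝ, E) (β ∘ c) 0 ((mfderiv I 𝓘(ℝ, E) β x).comp
        ((mfderiv 𝓘(ℝ, E) I φ.symm (φ x)).comp ((ContinuousLinearMap.id ℝ ℝ).smulRight w))) := by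
      refine HasMFDerivAt.comp (0 : ℝ) ?_ hcd
      rw [hc0]
      exact hβd.hasMFDerivAt
    have a2 := lam.hasFDerivAt.hasMFDerivAt.comp (0 : ℝ) a1
    have a3 : (lam ∘ (β ∘ c)) =ᶠ[𝓝 0] fun _ => (0 : hi.complement) := by
      -- An immersion would not suffice here: the induced topology is what forces preimages of
      -- points near x into the chart domain around s.
      have hev : ∀ᶠ t in 𝓝 (0 : ℝ), ∀ p, j p = c t → p ∈ α.source := by
        have b1 : α.source ∈ 𝓝 s := hαo.mem_nhds hsα
        rw [hj.isEmbedding.isInducing.nhds_eq_comap] at b1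
        obtain ⟨U, hU, hUs⟩ := Filter.mem_comap.1 b1
        have : ∀ᶠ t in 𝓝 (0 : ℝ), c t ∈ U := hcont.eventually (by rw [hc0]; exact hU)
        filter_upwards [this] with t ht p hp
        exact hUs (by simpa [hp] using ht)
      filter_upwards [hct, hev] with t ⟨p, hp⟩ ht
      have hpα := ht p hp
      have b2 := hij _ (α.map_source hpα)
      rw [α.left_inv hpα, hp] at b2
      simp [lam, b2]
    have a4 : HasMFDerivAt 𝓘(ℝ, ℝ) 𝓘(ℝ, hi.complement) (lam ∘ (β ∘ c)) 0 0 :=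
      (hasMFDerivAt_const (0 : hi.complement) (0 : ℝ)).congr_of_eventuallyEq a3
    have a5 := DFunLike.congr_fun (hasMFDerivAt_unique a2 a4) (1 : ℝ)
    have a6 : lam (mfderiv I 𝓘(ℝ, E) β x (mfderiv 𝓘(ℝ, E) I φ.symm (φ x) ((1 : ℝ) • w))) = 0 := a5
    rw [one_smul, hvw] at a6
    exact a6
  set w' : E'' := (hi.equiv.symm (mfderiv I 𝓘(ℝ, E) β x v)).1 with hw'
  refine ⟨mfderiv 𝓘(ℝ, E'') I'' α.symm (α s) w', hβinj ?_⟩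
  have hjd : MDifferentiableAt I'' I j s :=
    hj.isImmersion.contMDiff.mdifferentiable (by simp) s
  have a1 : HasMFDerivAt 𝓘(ℝ, E'') 𝓘(ℝ, E) (β ∘ j ∘ α.symm) (α s) ((mfderiv I 𝓘(ℝ, E) β x).comp
      ((mfderiv I'' I j s).comp (mfderiv 𝓘(ℝ, E'') I'' α.symm (α s)))) := by
    have hαs := α.left_inv hsα
    refine HasMFDerivAt.comp (I' := I) (α s) ?_ (HasMFDerivAt.comp (I' := I'') (α s) ?_
      hαsd.hasMFDerivAt)
    · simp only [Function.comp]; rw [hαs]; exact hβd.hasMFDerivAt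
    · rw [hαs]; exact hjd.hasMFDerivAt
  let inc : E'' →L[ℝ] E := (hi.equiv : (E'' × hi.complement) →L[ℝ] E).comp
    (ContinuousLinearMap.inl ℝ E'' hi.complement)
  have a2 : HasMFDerivAt 𝓘(ℝ, E'') 𝓘(ℝ, E) (β ∘ j ∘ α.symm) (α s) inc :=
    inc.hasFDerivAt.hasMFDerivAt.congr_of_eventuallyEq (by
      filter_upwards [hαto.mem_nhds (α.map_source hsα)] with u hu
      simp [inc, hij u hu])
  have a3 := DFunLike.congr_fun (hasMFDerivAt_unique a1 a2) w'
  have a4 : inc w' = mfderiv I 𝓘(ℝ, E) β x v := by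
    have : (w', (0 : hi.complement)) = hi.equiv.symm (mfderiv I 𝓘(ℝ, E) β x v) :=
      Prod.ext rfl hsnd.symm
    simp only [inc, ContinuousLinearMap.comp_apply, ContinuousLinearMap.inl_apply, this]
    exact hi.equiv.apply_symm_apply _
  exact a3.trans a4

end Submersion

/-- Tangent spaces at propositionally equal points such as `1 • m` and `m` are distinct types with
the same model space; this moves differentials between them. -/
lemma mfderiv_apply_congr {E E' : Type*} [NormedAddCommGroup E] [NormedSpace ℝ E]
    [NormedAddCommGroup E'] [NormedSpace ℝ E'] {H H' : Type*} [TopologicalSpace H]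
    [TopologicalSpace H'] {I : ModelWithCorners ℝ E H} {I' : ModelWithCorners ℝ E' H'}
    {M M' : Type*} [TopologicalSpace M] [ChartedSpace H M] [TopologicalSpace M']
    [ChartedSpace H' M'] (f : M → M') {x y : M} (h : x = y) (v : E) :
    (mfderiv I I' f x v : E') = mfderiv I I' f y v := by
  rw [h]

/-! ### Smooth actions and fundamental vector fields -/

section Action

variable {E : Type*} [NormedAddCommGroup E] [NormedSpace ℝ E] [FiniteDimensional ℝ E]
  {G : Type*} [TopologicalSpace G] [ChartedSpace E G] [Group G] [LieGroup 𝓘(ℝ, E) ∞ G]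
  {EM : Type*} [NormedAddCommGroup EM] [NormedSpace ℝ EM]
  {M : Type*} [TopologicalSpace M] [ChartedSpace EM M] [IsManifold 𝓘(ℝ, EM) ∞ M]
  [MulAction G M]

variable (E G EM M) in
/-- The action of the Lie group `G` on the manifold `M` is smooth. -/
def IsSmoothAction : Prop :=
  ContMDiff (𝓘(ℝ, E).prod 𝓘(ℝ, EM)) 𝓘(ℝ, EM) ∞ (fun q : G × M => q.1 • q.2)

variable (EM) in
/-- The fundamental vector field of `X ∈ 𝔤` on `M`. -/
def fund (X : LieAlg E G) (m : M) : TangentSpace 𝓘(ℝ, EM) m :=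
  mfderiv 𝓘(ℝ, E) 𝓘(ℝ, EM) (fun a : G => a • m) (1 : G) X

omit [FiniteDimensional ℝ E] in
variable (E G) in
lemma isSmoothAction_self : IsSmoothAction E G E G :=
  contMDiff_mul 𝓘(ℝ, E) ∞

omit [FiniteDimensional ℝ E] [LieGroup 𝓘(ℝ, E) ∞ G] [IsManifold 𝓘(ℝ, EM) ∞ M] in
lemma IsSmoothAction.contMDiff_smul (hact : IsSmoothAction E G EM M) (a : G) :
    ContMDiff 𝓘(ℝ, EM) 𝓘(ℝ, EM) ∞ (fun m : M => a • m) :=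
  ContMDiff.comp (I' := 𝓘(ℝ, E).prod 𝓘(ℝ, EM)) (g := fun q : G × M => q.1 • q.2) hact
    ((contMDiff_const (c := a)).prodMk contMDiff_id)

omit [FiniteDimensional ℝ E] [LieGroup 𝓘(ℝ, E) ∞ G] [IsManifold 𝓘(ℝ, EM) ∞ M] in
lemma IsSmoothAction.contMDiff_orbit (hact : IsSmoothAction E G EM M) (m : M) :
    ContMDiff 𝓘(ℝ, E) 𝓘(ℝ, EM) ∞ (fun a : G => a • m) :=
  ContMDiff.comp (I' := 𝓘(ℝ, E).prod 𝓘(ℝ, EM)) (g := fun q : G × M => q.1 • q.2) hact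
    (contMDiff_id.prodMk (contMDiff_const (c := m)))

omit [FiniteDimensional ℝ E] [LieGroup 𝓘(ℝ, E) ∞ G] [IsManifold 𝓘(ℝ, EM) ∞ M] in
lemma fund_add (X Y : LieAlg E G) (m : M) : fund EM (X + Y) m = fund EM X m + fund EM Y m :=
  map_add (mfderiv 𝓘(ℝ, E) 𝓘(ℝ, EM) (fun a : G => a • m) (1 : G)) X Y

omit [FiniteDimensional ℝ E] [LieGroup 𝓘(ℝ, E) ∞ G] [IsManifold 𝓘(ℝ, EM) ∞ M] in
lemma fund_smul (c : ℝ) (X : LieAlg E G) (m : M) : fund EM (c • X) m = c • fund EM X m :=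
  map_smul (mfderiv 𝓘(ℝ, E) 𝓘(ℝ, EM) (fun a : G => a • m) (1 : G)) c X

omit [FiniteDimensional ℝ E] [LieGroup 𝓘(ℝ, E) ∞ G] [IsManifold 𝓘(ℝ, EM) ∞ M] in
lemma fund_neg (X : LieAlg E G) (m : M) : fund EM (-X) m = - fund EM X m :=
  map_neg (mfderiv 𝓘(ℝ, E) 𝓘(ℝ, EM) (fun a : G => a • m) (1 : G)) X

omit [FiniteDimensional ℝ E] in
-- The field is the tangent map of the action G × M → M applied to the constant X at 1 and the zero
-- section of TM.
lemma IsSmoothAction.contMDiff_fund (hact : IsSmoothAction E G EM M) (X : LieAlg E G) :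
    IsSmoothField EM (fun m : M => fund EM X m) := by
  let fg : M → TangentBundle 𝓘(ℝ, EM) M := fun g ↦ TotalSpace.mk' EM g 0
  have sfg : ContMDiff 𝓘(ℝ, EM) 𝓘(ℝ, EM).tangent ∞ fg := contMDiff_zeroSection _ _
  let fv : M → TangentBundle 𝓘(ℝ, E) G := fun _ ↦ TotalSpace.mk' E 1 X
  have sfv : ContMDiff 𝓘(ℝ, EM) 𝓘(ℝ, E).tangent ∞ fv := contMDiff_const
  let F₁ : M → (TangentBundle 𝓘(ℝ, E) G × TangentBundle 𝓘(ℝ, EM) M) := fun g ↦ (fv g, fg g)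
  have S₁ : ContMDiff 𝓘(ℝ, EM) (𝓘(ℝ, E).tangent.prod 𝓘(ℝ, EM).tangent) ∞ F₁ := sfv.prodMk sfg
  let F₂ : (TangentBundle 𝓘(ℝ, E) G × TangentBundle 𝓘(ℝ, EM) M) →
      TangentBundle (𝓘(ℝ, E).prod 𝓘(ℝ, EM)) (G × M) :=
    (equivTangentBundleProd 𝓘(ℝ, E) G 𝓘(ℝ, EM) M).symm
  have S₂ : ContMDiff (𝓘(ℝ, E).tangent.prod 𝓘(ℝ, EM).tangent) (𝓘(ℝ, E).prod 𝓘(ℝ, EM)).tangent ∞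
    F₂ := contMDiff_equivTangentBundleProd_symm
  let F₃ : TangentBundle (𝓘(ℝ, E).prod 𝓘(ℝ, EM)) (G × M) → TangentBundle 𝓘(ℝ, EM) M :=
    tangentMap (𝓘(ℝ, E).prod 𝓘(ℝ, EM)) 𝓘(ℝ, EM) (fun q : G × M ↦ q.1 • q.2)
  have S₃ : ContMDiff (𝓘(ℝ, E).prod 𝓘(ℝ, EM)).tangent 𝓘(ℝ, EM).tangent ∞ F₃ :=
    ContMDiff.contMDiff_tangentMap hact (m := ∞) (by simp)
  have S := (S₃.comp S₂).comp S₁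
  have : (fun m : M => (TotalSpace.mk' EM m (fund EM X m) : TangentBundle 𝓘(ℝ, EM) M)) =
      (F₃ ∘ F₂) ∘ F₁ := by
    funext m
    have h1 : (1 : G) • m = m := one_smul G m
    have h2 : ∀ m' : M, m' = m → ∀ v : EM, (TotalSpace.mk' EM m v : TangentBundle 𝓘(ℝ, EM) M) =
      TotalSpace.mk' EM m' v := by rintro _ rfl v; rfl
    have h3 : mfderiv (𝓘(ℝ, E).prod 𝓘(ℝ, EM)) 𝓘(ℝ, EM) (fun q : G × M ↦ q.1 • q.2) (1, m)
        ((X, 0) : E × EM) = (fund EM X m : EM) := by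
      have := mfderiv_prod_eq_add_apply (v := ((X, 0) : E × EM))
        (hact.mdifferentiable (by simp) ((1 : G), m))
      refine this.trans ?_
      have h4 : mfderiv 𝓘(ℝ, EM) 𝓘(ℝ, EM) (fun z : M ↦ (1 : G) • z) m (0 : EM) = (0 : EM) :=
        map_zero (mfderiv 𝓘(ℝ, EM) 𝓘(ℝ, EM) (fun z : M ↦ (1 : G) • z) m)
      refine (congrArg (fun z : EM => HAdd.hAdd (α := EM) (β := EM) (fund EM X m) z) h4).trans ?_
      exact add_zero (M := EM) _
    refine (h2 _ h1 _).trans ?_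
    exact congrArg (TotalSpace.mk' EM ((1 : G) • m)) h3.symm
  rw [IsSmoothField, this]
  exact S

omit [FiniteDimensional ℝ E] in
lemma IsSmoothAction.isDiffFieldAt_fund (hact : IsSmoothAction E G EM M) (X : LieAlg E G) (m : M) :
    IsDiffFieldAt EM (fun m : M => fund EM X m) m :=
  (hact.contMDiff_fund X).mdifferentiable (by simp) m

omit [FiniteDimensional ℝ E] [IsManifold 𝓘(ℝ, EM) ∞ M] in
/-- The orbit map relates right-invariant fields and fundamental fields. -/
lemma IsSmoothAction.mfderiv_orbit_fund (hact : IsSmoothAction E G EM M) (X : LieAlg E G)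
    (m : M) (a : G) :
    mfderiv 𝓘(ℝ, E) 𝓘(ℝ, EM) (fun b : G => b • m) a (fund E X a) = fund EM X (a • m) := by
  have h1 : MDifferentiableAt 𝓘(ℝ, E) 𝓘(ℝ, EM) (fun b : G => b • m) ((1 : G) • a) :=
    (hact.contMDiff_orbit m).mdifferentiable (by simp) _
  have h2 : MDifferentiableAt 𝓘(ℝ, E) 𝓘(ℝ, E) (fun b : G => b • a) (1 : G) :=
    ((isSmoothAction_self E G).contMDiff_orbit a).mdifferentiable (by simp) _
  have h3 := h1.hasMFDerivAt.comp (1 : G) h2.hasMFDerivAt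
  have h4 : ((fun b : G => b • m) ∘ fun b : G => b • a) = fun b : G => b • (a • m) := by
    funext b; simp [mul_smul]
  rw [h4] at h3
  have h5 := DFunLike.congr_fun h3.mfderiv X
  have h6 := mfderiv_apply_congr (I := 𝓘(ℝ, E)) (I' := 𝓘(ℝ, EM)) (fun b : G => b • m)
    (one_smul G a) (fund E X a)
  exact h6.symm.trans h5.symm

omit [FiniteDimensional ℝ E] [IsManifold 𝓘(ℝ, EM) ∞ M] in
/-- Translation by `a` maps the fundamental field of `X` to that of `Ad a X`. -/
lemma IsSmoothAction.mfderiv_smul_fund (hact : IsSmoothAction E G EM M) (X : LieAlg E G)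
    (m : M) (a : G) :
    mfderiv 𝓘(ℝ, EM) 𝓘(ℝ, EM) (fun y : M => a • y) m (fund EM X m) =
      fund EM (Ad E a X) (a • m) := by
  have h1 : MDifferentiableAt 𝓘(ℝ, EM) 𝓘(ℝ, EM) (fun y : M => a • y) ((1 : G) • m) :=
    (hact.contMDiff_smul a).mdifferentiable (by simp) _
  have h2 : MDifferentiableAt 𝓘(ℝ, E) 𝓘(ℝ, EM) (fun b : G => b • m) (1 : G) :=
    (hact.contMDiff_orbit m).mdifferentiable (by simp) _
  have h3 := h1.hasMFDerivAt.comp (1 : G) h2.hasMFDerivAt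
  have g1 : MDifferentiableAt 𝓘(ℝ, E) 𝓘(ℝ, EM) (fun b : G => b • (a • m)) (a * 1 * a⁻¹) :=
    (hact.contMDiff_orbit _).mdifferentiable (by simp) _
  have g2 : MDifferentiableAt 𝓘(ℝ, E) 𝓘(ℝ, E) (fun x : G => a * x * a⁻¹) (1 : G) := by
    have : ContMDiff 𝓘(ℝ, E) 𝓘(ℝ, E) ∞ (fun x : G => a * x * a⁻¹) :=
      (contMDiff_const.mul contMDiff_id).mul contMDiff_const
    exact this.mdifferentiable (by simp) _
  have g3 := g1.hasMFDerivAt.comp (1 : G) g2.hasMFDerivAt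
  have h4 : ((fun y : M => a • y) ∘ fun b : G => b • m) =
      (fun b : G => b • (a • m)) ∘ (fun x : G => a * x * a⁻¹) := by
    funext b; simp [mul_smul]
  rw [h4] at h3
  have h5 := DFunLike.congr_fun (hasMFDerivAt_unique h3 g3) X
  have h6 := mfderiv_apply_congr (I := 𝓘(ℝ, EM)) (I' := 𝓘(ℝ, EM)) (fun y : M => a • y)
    (one_smul G m) (fund EM X m)
  have h7 := mfderiv_apply_congr (I := 𝓘(ℝ, E)) (I' := 𝓘(ℝ, EM)) (fun b : G => b • (a • m))
    (show a * 1 * a⁻¹ = 1 by simp) (Ad E a X)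
  exact h6.symm.trans (h5.trans h7)

end Action

/-! ### Invariant fields on a Lie group and the bracket of fundamental fields -/

section LieGroupFields

variable {E : Type*} [NormedAddCommGroup E] [NormedSpace ℝ E] [FiniteDimensional ℝ E]
  {G : Type*} [TopologicalSpace G] [ChartedSpace E G] [Group G] [LieGroup 𝓘(ℝ, E) ∞ G]

omit [FiniteDimensional ℝ E] in
lemma isDiffFieldAt_mulInvariantVectorField (X : LieAlg E G) (a : G) :
    IsDiffFieldAt E (mulInvariantVectorField X : ∀ a : G, TangentSpace 𝓘(ℝ, E) a) a :=
  mdifferentiableAt_mulInvariantVectorField X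

omit [FiniteDimensional ℝ E] [LieGroup 𝓘(ℝ, E) ∞ G] in
lemma mulInvariantVectorField_one (X : LieAlg E G) :
    (mulInvariantVectorField X (1 : G) : E) = X := by
  have : (fun b : G => 1 * b) = id := by funext b; simp
  have h := (hasMFDerivAt_id (I := 𝓘(ℝ, E)) (1 : G)).mfderiv
  rw [← this] at h
  exact DFunLike.congr_fun h X

omit [FiniteDimensional ℝ E] [LieGroup 𝓘(ℝ, E) ∞ G] in
lemma fund_one (X : LieAlg E G) : (fund E X (1 : G) : E) = X := by
  have : (fun b : G => b • (1 : G)) = id := by funext b; simp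
  have h := (hasMFDerivAt_id (I := 𝓘(ℝ, E)) (1 : G)).mfderiv
  rw [← this] at h
  exact DFunLike.congr_fun h X

variable {E' : Type*} [NormedAddCommGroup E'] [NormedSpace ℝ E'] [FiniteDimensional ℝ E']
  {G' : Type*} [TopologicalSpace G'] [ChartedSpace E' G'] [Group G'] [LieGroup 𝓘(ℝ, E') ∞ G']

variable (E E') in
/-- The differential at `1` of a homomorphism of Lie groups. -/
def homDeriv (φ : G →* G') : LieAlg E G →L[ℝ] LieAlg E' G' :=
  mfderiv 𝓘(ℝ, E) 𝓘(ℝ, E') φ (1 : G)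

omit [FiniteDimensional ℝ E] [FiniteDimensional ℝ E'] in
-- Differentiate φ(ab) = φ(a)φ(b) in b at 1.
lemma mfderiv_hom_mulInvariantVectorField (φ : G →* G') (hφ : ContMDiff 𝓘(ℝ, E) 𝓘(ℝ, E') ∞ φ)
    (X : LieAlg E G) (a : G) :
    mfderiv 𝓘(ℝ, E) 𝓘(ℝ, E') φ a (mulInvariantVectorField X a) =
      mulInvariantVectorField (homDeriv E E' φ X) (φ a) := by
  have h1 : MDifferentiableAt 𝓘(ℝ, E) 𝓘(ℝ, E') φ (a * 1) := hφ.mdifferentiable (by simp) _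
  have h2 : MDifferentiableAt 𝓘(ℝ, E) 𝓘(ℝ, E) (fun b : G => a * b) (1 : G) :=
    (contMDiff_mul_left (I := 𝓘(ℝ, E)) (n := ∞)).mdifferentiable (by simp) _
  have h3 := h1.hasMFDerivAt.comp (1 : G) h2.hasMFDerivAt
  have g1 : MDifferentiableAt 𝓘(ℝ, E') 𝓘(ℝ, E') (fun b : G' => φ a * b) (φ 1) :=
    (contMDiff_mul_left (I := 𝓘(ℝ, E')) (n := ∞)).mdifferentiable (by simp) _
  have g2 : MDifferentiableAt 𝓘(ℝ, E) 𝓘(ℝ, E') φ (1 : G) := hφ.mdifferentiable (by simp) _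
  have g3 := g1.hasMFDerivAt.comp (1 : G) g2.hasMFDerivAt
  have h4 : (φ ∘ fun b : G => a * b) = (fun b : G' => φ a * b) ∘ φ := by
    funext b; simp
  rw [h4] at h3
  have h5 := DFunLike.congr_fun (hasMFDerivAt_unique h3 g3) X
  have h6 := mfderiv_apply_congr (I := 𝓘(ℝ, E)) (I' := 𝓘(ℝ, E')) φ (mul_one a)
    (mulInvariantVectorField X a)
  have h7 := mfderiv_apply_congr (I := 𝓘(ℝ, E')) (I' := 𝓘(ℝ, E')) (fun b : G' => φ a * b)
    (map_one φ) (homDeriv E E' φ X)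
  exact h6.symm.trans (h5.trans h7)

/-- The differential of a homomorphism of Lie groups is a homomorphism of Lie algebras. -/
lemma homDeriv_lie (φ : G →* G') (hφ : ContMDiff 𝓘(ℝ, E) 𝓘(ℝ, E') ∞ φ) (X Y : LieAlg E G) :
    homDeriv E E' φ ⁅X, Y⁆ = ⁅homDeriv E E' φ X, homDeriv E E' φ Y⁆ := by
  have h := mlieBracket_related (x := (1 : G)) hφ (isDiffFieldAt_mulInvariantVectorField X 1)
    (isDiffFieldAt_mulInvariantVectorField Y 1)
    (isDiffFieldAt_mulInvariantVectorField (homDeriv E E' φ X) _)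
    (isDiffFieldAt_mulInvariantVectorField (homDeriv E E' φ Y) _)
    (mfderiv_hom_mulInvariantVectorField φ hφ X) (mfderiv_hom_mulInvariantVectorField φ hφ Y)
  have h2 : ∀ g : G', g = 1 → (mlieBracket 𝓘(ℝ, E') (mulInvariantVectorField (homDeriv E E' φ X))
    (mulInvariantVectorField (homDeriv E E' φ Y)) g : E') = ⁅homDeriv E E' φ X, homDeriv E E' φ Y⁆ := by
    rintro _ rfl; rfl
  exact Eq.trans h (h2 _ (map_one φ))

omit [FiniteDimensional ℝ E] in
-- Differentiate a · a⁻¹ = 1 at the identity.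
lemma mfderiv_inv_one (X : LieAlg E G) :
    (mfderiv 𝓘(ℝ, E) 𝓘(ℝ, E) (fun a : G => a⁻¹) (1 : G) X : E) = -X := by
  have hm : MDifferentiableAt (𝓘(ℝ, E).prod 𝓘(ℝ, E)) 𝓘(ℝ, E) (fun q : G × G => q.1 * q.2)
      ((1 : G), (1 : G)⁻¹) := (contMDiff_mul 𝓘(ℝ, E) ∞).mdifferentiable (by simp) _
  have hi : MDifferentiableAt 𝓘(ℝ, E) 𝓘(ℝ, E) (fun a : G => a⁻¹) (1 : G) :=
    (contMDiff_inv 𝓘(ℝ, E) ∞).mdifferentiable (by simp) _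
  have h1 := hm.hasMFDerivAt.comp (1 : G) ((hasMFDerivAt_id (1 : G)).prodMk hi.hasMFDerivAt)
  have h2 : ((fun q : G × G => q.1 * q.2) ∘ fun a : G => (id a, a⁻¹)) = fun _ => (1 : G) := by
    funext a; simp
  have h3 := DFunLike.congr_fun (hasMFDerivAt_unique h1 (by
    change HasMFDerivAt 𝓘(ℝ, E) 𝓘(ℝ, E)
      ((fun q : G × G => q.1 * q.2) ∘ fun a : G => (id a, a⁻¹)) 1 _
    rw [h2]; exact hasMFDerivAt_const _ _)) X
  have h4 := mfderiv_prod_eq_add_apply (v := ((X, mfderiv 𝓘(ℝ, E) 𝓘(ℝ, E) (fun a : G => a⁻¹)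
    (1 : G) X) : E × E)) hm
  have h5 : (mfderiv 𝓘(ℝ, E) 𝓘(ℝ, E) (fun z : G => z * (1 : G)⁻¹) (1 : G) X : E) = X := by
    have : (fun b : G => b * (1 : G)⁻¹) = id := by funext b; simp
    have h := (hasMFDerivAt_id (I := 𝓘(ℝ, E)) (1 : G)).mfderiv
    rw [← this] at h
    exact DFunLike.congr_fun h X
  set v : E := mfderiv 𝓘(ℝ, E) 𝓘(ℝ, E) (fun a : G => a⁻¹) (1 : G) X with hv
  have h6 : (mfderiv 𝓘(ℝ, E) 𝓘(ℝ, E) (fun z : G => 1 * z) (1 : G)⁻¹ v : E) = v := by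
    have : (fun b : G => 1 * b) = id := by funext b; simp
    have h := (hasMFDerivAt_id (I := 𝓘(ℝ, E)) (1 : G)⁻¹).mfderiv
    rw [← this] at h
    exact DFunLike.congr_fun h v
  have h7 : HAdd.hAdd (α := E) (β := E) X v = 0 := by
    refine Eq.trans ?_ (h4.symm.trans h3)
    exact (congrArg₂ (fun a b : E => a + b) h5 h6).symm
  exact (neg_eq_of_add_eq_zero_right h7).symm

omit [FiniteDimensional ℝ E] in
-- Since (ab)⁻¹ = b⁻¹a⁻¹, inversion relates left-invariant fields to right-invariant ones, with a
-- sign from its differential at 1.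
lemma mfderiv_inv_mulInvariantVectorField (X : LieAlg E G) (a : G) :
    mfderiv 𝓘(ℝ, E) 𝓘(ℝ, E) (fun a : G => a⁻¹) a (mulInvariantVectorField X a) =
      fund E (-X) a⁻¹ := by
  have hi : ∀ a, MDifferentiableAt 𝓘(ℝ, E) 𝓘(ℝ, E) (fun a : G => a⁻¹) a :=
    (contMDiff_inv 𝓘(ℝ, E) ∞).mdifferentiable (by simp)
  have h2 : MDifferentiableAt 𝓘(ℝ, E) 𝓘(ℝ, E) (fun b : G => a * b) (1 : G) :=
    (contMDiff_mul_left (I := 𝓘(ℝ, E)) (n := ∞)).mdifferentiable (by simp) _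
  have h3 := (hi (a * 1)).hasMFDerivAt.comp (1 : G) h2.hasMFDerivAt
  have g1 : MDifferentiableAt 𝓘(ℝ, E) 𝓘(ℝ, E) (fun b : G => b • a⁻¹) ((1 : G)⁻¹) :=
    ((isSmoothAction_self E G).contMDiff_orbit _).mdifferentiable (by simp) _
  have g3 := g1.hasMFDerivAt.comp (1 : G) (hi 1).hasMFDerivAt
  have h4 : ((fun a : G => a⁻¹) ∘ fun b : G => a * b) = (fun b : G => b • a⁻¹) ∘ (fun a => a⁻¹) := by
    funext b; simp
  rw [h4] at h3
  have h5 := DFunLike.congr_fun (hasMFDerivAt_unique h3 g3) X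
  have h6 := mfderiv_apply_congr (I := 𝓘(ℝ, E)) (I' := 𝓘(ℝ, E)) (fun a : G => a⁻¹) (mul_one a)
    (mulInvariantVectorField X a)
  have h7 := mfderiv_apply_congr (I := 𝓘(ℝ, E)) (I' := 𝓘(ℝ, E)) (fun b : G => b • a⁻¹)
    (inv_one (G := G)) (mfderiv 𝓘(ℝ, E) 𝓘(ℝ, E) (fun a : G => a⁻¹) (1 : G) X)
  have h8 : (mfderiv 𝓘(ℝ, E) 𝓘(ℝ, E) (fun b : G => b • a⁻¹) 1
      (mfderiv 𝓘(ℝ, E) 𝓘(ℝ, E) (fun a : G => a⁻¹) (1 : G) X) : E) = fund E (-X) a⁻¹ :=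
    congrArg (mfderiv 𝓘(ℝ, E) 𝓘(ℝ, E) (fun b : G => b • a⁻¹) 1 : E →L[ℝ] E) (mfderiv_inv_one X)
  exact h6.symm.trans (h5.trans (h7.trans h8))

/-- The Lie algebra bracket is that of left-invariant fields, while fundamental fields of left
translation are right-invariant. Inversion relates the two, and its differential -1 at the identity
is the source of the sign. -/
lemma mlieBracket_fund_one (X Y : LieAlg E G) :
    (mlieBracket 𝓘(ℝ, E) (fund E X) (fund E Y) (1 : G) : E) = -⁅X, Y⁆ := by
  have hs := isSmoothAction_self E G
  have h := mlieBracket_related (x := (1 : G)) (contMDiff_inv 𝓘(ℝ, E) ∞)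
    (isDiffFieldAt_mulInvariantVectorField (-X) 1) (isDiffFieldAt_mulInvariantVectorField (-Y) 1)
    (hs.isDiffFieldAt_fund (- -X) _) (hs.isDiffFieldAt_fund (- -Y) _)
    (mfderiv_inv_mulInvariantVectorField (-X)) (mfderiv_inv_mulInvariantVectorField (-Y))
  simp only [neg_neg] at h
  have h2 : ∀ g : G, g = 1 → (mlieBracket 𝓘(ℝ, E) (fund E X) (fund E Y) g : E) =
      mlieBracket 𝓘(ℝ, E) (fund E X) (fund E Y) (1 : G) := by rintro _ rfl; rfl
  have h3 := mfderiv_inv_one (E := E) (G := G) ⁅-X, -Y⁆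
  have h4 : -⁅-X, -Y⁆ = -⁅X, Y⁆ := by simp
  exact (h2 _ inv_one).symm.trans (h.symm.trans (h3.trans h4))

variable {EM : Type*} [NormedAddCommGroup EM] [NormedSpace ℝ EM] [CompleteSpace EM]
  {M : Type*} [TopologicalSpace M] [ChartedSpace EM M] [IsManifold 𝓘(ℝ, EM) ∞ M]
  [MulAction G M]

/-- The orbit map relates right-invariant fields on G to fundamental fields on M, so the group case
is pushed forward. -/
lemma IsSmoothAction.mlieBracket_fund (hact : IsSmoothAction E G EM M) (X Y : LieAlg E G) (m : M) :
    mlieBracket 𝓘(ℝ, EM) (fund EM X) (fund EM Y) m = -fund EM ⁅X, Y⁆ m := by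
  have hs := isSmoothAction_self E G
  have h := mlieBracket_related (x := (1 : G)) (hact.contMDiff_orbit m)
    (hs.isDiffFieldAt_fund X _) (hs.isDiffFieldAt_fund Y _)
    (hact.isDiffFieldAt_fund X _) (hact.isDiffFieldAt_fund Y _)
    (hact.mfderiv_orbit_fund X m) (hact.mfderiv_orbit_fund Y m)
  have h2 : ∀ g : M, g = m → (mlieBracket 𝓘(ℝ, EM) (fund EM X) (fund EM Y) g : EM) =
      mlieBracket 𝓘(ℝ, EM) (fund EM X) (fund EM Y) m := by rintro _ rfl; rfl
  have h3 : (mfderiv 𝓘(ℝ, E) 𝓘(ℝ, EM) (fun a : G => a • m) 1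
      (mlieBracket 𝓘(ℝ, E) (fund E X) (fund E Y) (1 : G)) : EM) = fund EM (-⁅X, Y⁆) m :=
    congrArg (mfderiv 𝓘(ℝ, E) 𝓘(ℝ, EM) (fun a : G => a • m) 1 : E →L[ℝ] EM)
      (mlieBracket_fund_one X Y)
  exact (h2 _ (one_smul G m)).symm.trans (h.symm.trans (h3.trans (fund_neg _ _)))

end LieGroupFields

/-! ### Smoothness and derivative of the adjoint representation -/

section Adjoint

variable {E : Type*} [NormedAddCommGroup E] [NormedSpace ℝ E] [FiniteDimensional ℝ E]
  {G : Type*} [TopologicalSpace G] [ChartedSpace E G] [Group G] [LieGroup 𝓘(ℝ, E) ∞ G]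

/-- The fields `(X, 0)` and `(0, Y)` on a product commute. -/
lemma mlieBracket_prod_eq_zero {M : Type*} [TopologicalSpace M] [ChartedSpace E M]
    [IsManifold 𝓘(ℝ, E) ∞ M] {X Y : ∀ m : M, TangentSpace 𝓘(ℝ, E) m}
    (hX : ∀ m, IsDiffFieldAt E X m) (hY : ∀ m, IsDiffFieldAt E Y m)
    {V W : ∀ q : M × M, TangentSpace (𝓘(ℝ, E).prod 𝓘(ℝ, E)) q}
    (hV : ∀ q, V q = ((X q.1, 0) : E × E)) (hW : ∀ q, W q = ((0, Y q.2) : E × E)) (q : M × M)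
    (hVd : MDifferentiableAt (𝓘(ℝ, E).prod 𝓘(ℝ, E)) (𝓘(ℝ, E).prod 𝓘(ℝ, E)).tangent
      (fun y => (TotalSpace.mk' (E × E) y (V y) :
        TangentBundle (𝓘(ℝ, E).prod 𝓘(ℝ, E)) (M × M))) q)
    (hWd : MDifferentiableAt (𝓘(ℝ, E).prod 𝓘(ℝ, E)) (𝓘(ℝ, E).prod 𝓘(ℝ, E)).tangent
      (fun y => (TotalSpace.mk' (E × E) y (W y) :
        TangentBundle (𝓘(ℝ, E).prod 𝓘(ℝ, E)) (M × M))) q) :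
    (mlieBracket (𝓘(ℝ, E).prod 𝓘(ℝ, E)) V W q : E × E) = 0 := by
  have h0 : ∀ m : M, IsDiffFieldAt E (0 : ∀ m : M, TangentSpace 𝓘(ℝ, E) m) m := fun m =>
    (contMDiff_zeroSection (n := ∞) ℝ (TangentSpace 𝓘(ℝ, E) : M → Type _)).mdifferentiable
      (by simp) m
  have h1 := mlieBracket_related (x := q) (f := (Prod.fst : M × M → M)) (V' := X) (W' := 0)
    contMDiff_fst hVd hWd (hX _) (h0 _)
    (fun y => by rw [hV, mfderiv_fst]; rfl) (fun y => by rw [hW, mfderiv_fst]; rfl)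
  have h2 := mlieBracket_related (x := q) (f := (Prod.snd : M × M → M)) (V' := 0) (W' := Y)
    contMDiff_snd hVd hWd (h0 _) (hY _)
    (fun y => by rw [hV, mfderiv_snd]; rfl) (fun y => by rw [hW, mfderiv_snd]; rfl)
  rw [mfderiv_fst, mlieBracket_zero_right] at h1
  rw [mfderiv_snd, mlieBracket_zero_left] at h2
  exact Prod.ext h1 h2

/-- Left and right translations commute. Multiplication G × G → G relates the commuting fields (X,
0), right-invariant, and (0, Y), left-invariant, to the two fields in question. -/
lemma mlieBracket_fund_mulInvariant (X Y : LieAlg E G) :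
    (mlieBracket 𝓘(ℝ, E) (fund E X) (mulInvariantVectorField Y) (1 : G) : E) = 0 := by
  have hs := isSmoothAction_self E G
  let V : ∀ q : G × G, TangentSpace (𝓘(ℝ, E).prod 𝓘(ℝ, E)) q := fun q => ((fund E X q.1, 0) : E × E)
  let W : ∀ q : G × G, TangentSpace (𝓘(ℝ, E).prod 𝓘(ℝ, E)) q :=
    fun q => ((0, mulInvariantVectorField Y q.2) : E × E)
  have hX := hs.isDiffFieldAt_fund X
  have hY := isDiffFieldAt_mulInvariantVectorField Y
  have h0 : ∀ m : G, IsDiffFieldAt E (0 : ∀ m : G, TangentSpace 𝓘(ℝ, E) m) m := fun m =>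
    (contMDiff_zeroSection (n := ∞) ℝ (TangentSpace 𝓘(ℝ, E) : G → Type _)).mdifferentiable
      (by simp) m
  have key : ∀ (A B : ∀ m : G, TangentSpace 𝓘(ℝ, E) m), (∀ m, IsDiffFieldAt E A m) →
      (∀ m, IsDiffFieldAt E B m) → ∀ q : G × G,
      MDifferentiableAt (𝓘(ℝ, E).prod 𝓘(ℝ, E)) (𝓘(ℝ, E).prod 𝓘(ℝ, E)).tangent
      (fun y => (TotalSpace.mk' (E × E) y ((A y.1, B y.2) : E × E) :
        TangentBundle (𝓘(ℝ, E).prod 𝓘(ℝ, E)) (G × G))) q := by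
    intro A B hA hB q
    have a1 := (hA q.1).comp q (mdifferentiableAt_fst (I := 𝓘(ℝ, E)) (I' := 𝓘(ℝ, E)))
    have a2 := (hB q.2).comp q (mdifferentiableAt_snd (I := 𝓘(ℝ, E)) (I' := 𝓘(ℝ, E)))
    have a3 := a1.prodMk a2
    have a4 := (contMDiff_equivTangentBundleProd_symm (n := ∞) (I := 𝓘(ℝ, E)) (M := G)
      (I' := 𝓘(ℝ, E)) (M' := G)).mdifferentiable (by simp)
    exact (a4 _).comp q a3
  have hμ := mlieBracket_related (x := ((1 : G), (1 : G))) (V := V) (W := W)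
    (V' := fund E X) (W' := mulInvariantVectorField Y) (contMDiff_mul 𝓘(ℝ, E) ∞)
    (key _ _ hX h0 _) (key _ _ h0 hY _) (hX _) (hY _) ?_ ?_
  · have h1 := mlieBracket_prod_eq_zero hX hY (V := V) (W := W) (fun _ => rfl) (fun _ => rfl)
      ((1 : G), (1 : G)) (key _ _ hX h0 _) (key _ _ h0 hY _)
    have h2 : (mfderiv (𝓘(ℝ, E).prod 𝓘(ℝ, E)) 𝓘(ℝ, E) (fun q : G × G => q.1 * q.2) (1, 1)
      (mlieBracket (𝓘(ℝ, E).prod 𝓘(ℝ, E)) V W ((1 : G), (1 : G))) : E) = 0 :=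
      (congrArg (mfderiv (𝓘(ℝ, E).prod 𝓘(ℝ, E)) 𝓘(ℝ, E) (fun q : G × G => q.1 * q.2) (1, 1) :
        E × E →L[ℝ] E) h1).trans (map_zero _)
    have h3 : ∀ g : G, g = 1 → (mlieBracket 𝓘(ℝ, E) (fund E X) (mulInvariantVectorField Y) g : E) =
      mlieBracket 𝓘(ℝ, E) (fund E X) (mulInvariantVectorField Y) (1 : G) := by rintro _ rfl; rfl
    exact (h3 _ (mul_one 1)).symm.trans (hμ.symm.trans h2)
  · rintro ⟨a, b⟩
    have a1 := mfderiv_prod_eq_add_apply (v := ((fund E X a, 0) : E × E))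
      ((contMDiff_mul 𝓘(ℝ, E) ∞).mdifferentiable (by simp) (a, b))
    refine a1.trans ?_
    have a2 := hs.mfderiv_orbit_fund X b a
    refine (congrArg₂ (fun x y : E => x + y) a2 (map_zero (mfderiv 𝓘(ℝ, E) 𝓘(ℝ, E)
      (fun z : G => a * z) b))).trans ?_
    exact add_zero (M := E) _
  · rintro ⟨a, b⟩
    have a1 := mfderiv_prod_eq_add_apply (v := ((0, mulInvariantVectorField Y b) : E × E))
      ((contMDiff_mul 𝓘(ℝ, E) ∞).mdifferentiable (by simp) (a, b))
    refine a1.trans ?_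
    have d1 : MDifferentiableAt 𝓘(ℝ, E) 𝓘(ℝ, E) (fun z : G => a * z) (b * 1) :=
      (contMDiff_mul_left (I := 𝓘(ℝ, E)) (n := ∞)).mdifferentiable (by simp) _
    have d2 : MDifferentiableAt 𝓘(ℝ, E) 𝓘(ℝ, E) (fun z : G => b * z) 1 :=
      (contMDiff_mul_left (I := 𝓘(ℝ, E)) (n := ∞)).mdifferentiable (by simp) _
    have d3 := d1.hasMFDerivAt.comp (1 : G) d2.hasMFDerivAt
    have d4 : ((fun z : G => a * z) ∘ fun z : G => b * z) = fun z => a * b * z := by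
      funext z; simp [mul_assoc]
    rw [d4] at d3
    have d5 := mfderiv_apply_congr (I := 𝓘(ℝ, E)) (I' := 𝓘(ℝ, E)) (fun z : G => a * z) (mul_one b)
      (mulInvariantVectorField Y b)
    have a2 : (mfderiv 𝓘(ℝ, E) 𝓘(ℝ, E) (fun z : G => a * z) b (mulInvariantVectorField Y b) : E) =
        mulInvariantVectorField Y (a * b) := d5.symm.trans (DFunLike.congr_fun d3.mfderiv Y).symm
    refine (congrArg₂ (fun x y : E => x + y) (map_zero (mfderiv 𝓘(ℝ, E) 𝓘(ℝ, E)
      (fun z : G => z * b) a)) a2).trans ?_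
    exact zero_add (M := E) _

/-- The orbit map `a ↦ Ad a U` of the adjoint representation, with values in the model space. -/
def adOrbit (U : LieAlg E G) : G → E := fun a => Ad E a U

omit [FiniteDimensional ℝ E] in
-- Apply the tangent map of (a, x) ↦ a x a⁻¹ to the zero vector at a and U at 1. All values lie over
-- the single point 1, so the fibre coordinate there is a smooth map to the model space.
lemma contMDiff_adOrbit (U : LieAlg E G) : ContMDiff 𝓘(ℝ, E) 𝓘(ℝ, E) ∞ (adOrbit U) := by
  let fg : G → TangentBundle 𝓘(ℝ, E) G := fun g ↦ TotalSpace.mk' E g 0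
  have sfg : ContMDiff 𝓘(ℝ, E) 𝓘(ℝ, E).tangent ∞ fg := contMDiff_zeroSection _ _
  let fv : G → TangentBundle 𝓘(ℝ, E) G := fun _ ↦ TotalSpace.mk' E 1 U
  have sfv : ContMDiff 𝓘(ℝ, E) 𝓘(ℝ, E).tangent ∞ fv := contMDiff_const
  let F₁ : G → (TangentBundle 𝓘(ℝ, E) G × TangentBundle 𝓘(ℝ, E) G) := fun g ↦ (fg g, fv g)
  have S₁ : ContMDiff 𝓘(ℝ, E) (𝓘(ℝ, E).tangent.prod 𝓘(ℝ, E).tangent) ∞ F₁ := sfg.prodMk sfv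
  let F₂ : (TangentBundle 𝓘(ℝ, E) G × TangentBundle 𝓘(ℝ, E) G) →
      TangentBundle (𝓘(ℝ, E).prod 𝓘(ℝ, E)) (G × G) :=
    (equivTangentBundleProd 𝓘(ℝ, E) G 𝓘(ℝ, E) G).symm
  have S₂ : ContMDiff (𝓘(ℝ, E).tangent.prod 𝓘(ℝ, E).tangent) (𝓘(ℝ, E).prod 𝓘(ℝ, E)).tangent ∞
    F₂ := contMDiff_equivTangentBundleProd_symm
  let Q : G × G → G := fun q => q.1 * q.2 * q.1⁻¹
  have hQ : ContMDiff (𝓘(ℝ, E).prod 𝓘(ℝ, E)) 𝓘(ℝ, E) ∞ Q :=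
    (contMDiff_fst.mul contMDiff_snd).mul contMDiff_fst.inv
  let F₃ : TangentBundle (𝓘(ℝ, E).prod 𝓘(ℝ, E)) (G × G) → TangentBundle 𝓘(ℝ, E) G :=
    tangentMap (𝓘(ℝ, E).prod 𝓘(ℝ, E)) 𝓘(ℝ, E) Q
  have S₃ : ContMDiff (𝓘(ℝ, E).prod 𝓘(ℝ, E)).tangent 𝓘(ℝ, E).tangent ∞ F₃ :=
    ContMDiff.contMDiff_tangentMap hQ (m := ∞) (by simp)
  have S := (S₃.comp S₂).comp S₁
  have : (fun a : G => (TotalSpace.mk' E (1 : G) (Ad E a U) : TangentBundle 𝓘(ℝ, E) G)) =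
      (F₃ ∘ F₂) ∘ F₁ := by
    funext a
    have h1 : a * 1 * a⁻¹ = 1 := by simp
    have h2 : ∀ m' : G, m' = 1 → ∀ v : E, (TotalSpace.mk' E (1 : G) v : TangentBundle 𝓘(ℝ, E) G) =
      TotalSpace.mk' E m' v := by rintro _ rfl v; rfl
    have h3 : mfderiv (𝓘(ℝ, E).prod 𝓘(ℝ, E)) 𝓘(ℝ, E) Q (a, 1)
        ((0, U) : E × E) = (Ad E a U : E) := by
      have := mfderiv_prod_eq_add_apply (v := ((0, U) : E × E))
        (hQ.mdifferentiable (by simp) (a, (1 : G)))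
      refine this.trans ?_
      have h4 : mfderiv 𝓘(ℝ, E) 𝓘(ℝ, E) (fun z : G ↦ Q (z, 1)) a (0 : E) = (0 : E) :=
        map_zero (mfderiv 𝓘(ℝ, E) 𝓘(ℝ, E) (fun z : G ↦ Q (z, 1)) a)
      refine (congrArg (fun z : E => HAdd.hAdd (α := E) (β := E) z (Ad E a U)) h4).trans ?_
      exact zero_add (M := E) _
    refine (h2 _ h1 _).trans ?_
    exact congrArg (TotalSpace.mk' E (a * 1 * a⁻¹)) h3.symm
  rw [← this] at S
  intro a
  have := (Bundle.contMDiffAt_totalSpace.1 (S a)).2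
  refine this.congr_of_eventuallyEq (Filter.Eventually.of_forall fun b => ?_)
  exact ((tangentBundleCore 𝓘(ℝ, E) G).coordChange_self (achart E 1) 1
    (mem_chart_source E 1) (Ad E b U)).symm

omit [FiniteDimensional ℝ E] in
-- Differentiate a · (a⁻¹ x a) = x a in x at 1.
lemma mfderiv_mul_left_Ad_inv (U : LieAlg E G) (a : G) :
    (mulInvariantVectorField (Ad E a⁻¹ U : LieAlg E G) a : E) = fund E U a := by
  have d1 : MDifferentiableAt 𝓘(ℝ, E) 𝓘(ℝ, E) (fun z : G => a * z) (a⁻¹ * 1 * a⁻¹⁻¹) :=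
    (contMDiff_mul_left (I := 𝓘(ℝ, E)) (n := ∞)).mdifferentiable (by simp) _
  have d2 : MDifferentiableAt 𝓘(ℝ, E) 𝓘(ℝ, E) (fun x : G => a⁻¹ * x * a⁻¹⁻¹) (1 : G) := by
    have : ContMDiff 𝓘(ℝ, E) 𝓘(ℝ, E) ∞ (fun x : G => a⁻¹ * x * a⁻¹⁻¹) :=
      (contMDiff_const.mul contMDiff_id).mul contMDiff_const
    exact this.mdifferentiable (by simp) _
  have d3 := d1.hasMFDerivAt.comp (1 : G) d2.hasMFDerivAt
  have d4 : ((fun z : G => a * z) ∘ fun x : G => a⁻¹ * x * a⁻¹⁻¹) = fun b : G => b • a := by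
    funext z; simp [mul_assoc]
  rw [d4] at d3
  have d5 := mfderiv_apply_congr (I := 𝓘(ℝ, E)) (I' := 𝓘(ℝ, E)) (fun z : G => a * z)
    (show a⁻¹ * 1 * a⁻¹⁻¹ = 1 by simp) (Ad E a⁻¹ U)
  exact d5.symm.trans (DFunLike.congr_fun d3.mfderiv U).symm

lemma mlieBracket_sum_smul {M : Type*} [TopologicalSpace M] [ChartedSpace E M]
    [IsManifold 𝓘(ℝ, E) ∞ M] {ι : Type*} (s : Finset ι) (f : ι → M → ℝ)
    (V : ∀ m : M, TangentSpace 𝓘(ℝ, E) m) (W : ι → ∀ m : M, TangentSpace 𝓘(ℝ, E) m) (m : M)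
    (hf : ∀ i, MDifferentiableAt 𝓘(ℝ, E) 𝓘(ℝ, ℝ) (f i) m) (hW : ∀ i, IsDiffFieldAt E (W i) m) :
    mlieBracket 𝓘(ℝ, E) V (fun y => ∑ i ∈ s, f i y • W i y) m =
      ∑ i ∈ s, (mvfderiv 𝓘(ℝ, E) (f i) m (V m) • W i m +
        f i m • mlieBracket 𝓘(ℝ, E) V (W i) m) := by
  classical
  induction s using Finset.induction_on with
  | empty => simp only [Finset.sum_empty]; exact congrFun (mlieBracket_zero_right) m
  | insert i s hi ih =>
    have h1 : (fun y => ∑ i ∈ insert i s, f i y • W i y) =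
        (f i • W i) + (fun y => ∑ i ∈ s, f i y • W i y) := by
      funext y
      rw [Finset.sum_insert hi]
      rfl
    rw [h1, Finset.sum_insert hi, mlieBracket_add_right, ih, mlieBracket_smul_right (hf i) (hW i)]
    · exact (hf i).smul_section (hW i)
    · have : ∀ i ∈ s, MDifferentiableAt 𝓘(ℝ, E) 𝓘(ℝ, E).tangent (fun y =>
          (TotalSpace.mk' E y (f i y • W i y) : TangentBundle 𝓘(ℝ, E) M)) m :=
        fun i _ => (hf i).smul_section (hW i)
      have := fun i hi => (this i hi).mdifferentiableWithinAt (s := Set.univ)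
      exact mdifferentiableWithinAt_univ.1 (MDifferentiableWithinAt.sum_section this)

/-- The derivative at `1` of `a ↦ Ad a⁻¹ U`. -/
lemma mfderiv_adOrbit_inv (X U : LieAlg E G) :
    (mfderiv 𝓘(ℝ, E) 𝓘(ℝ, E) (fun a : G => adOrbit U a⁻¹) (1 : G) X : E) = -⁅X, U⁆ := by
  have hs := isSmoothAction_self E G
  have hc : ContMDiff 𝓘(ℝ, E) 𝓘(ℝ, E) ∞ (fun a : G => adOrbit U a⁻¹) :=
    (contMDiff_adOrbit U).comp (contMDiff_inv 𝓘(ℝ, E) ∞)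
  set c : G → E := fun a : G => adOrbit U a⁻¹ with hcdef
  let b := Module.finBasis ℝ E
  let l : ∀ i, E →L[ℝ] ℝ := fun i => LinearMap.toContinuousLinearMap (b.coord i)
  let f : Fin (Module.finrank ℝ E) → G → ℝ := fun i a => l i (c a)
  have hcd : HasMFDerivAt 𝓘(ℝ, E) 𝓘(ℝ, E) c 1 (mfderiv 𝓘(ℝ, E) 𝓘(ℝ, E) c 1) :=
    (hc.mdifferentiable (by simp) _).hasMFDerivAt
  have hf : ∀ i, HasMFDerivAt 𝓘(ℝ, E) 𝓘(ℝ, ℝ) (f i) 1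
      ((l i).comp (mfderiv 𝓘(ℝ, E) 𝓘(ℝ, E) c 1 : E →L[ℝ] E)) := fun i =>
    (l i).hasFDerivAt.hasMFDerivAt.comp (1 : G) hcd
  let W : Fin (Module.finrank ℝ E) → ∀ a : G, TangentSpace 𝓘(ℝ, E) a :=
    fun i => mulInvariantVectorField (b i : LieAlg E G)
  -- Expand the right-invariant field of U in the left-invariant frame; the coefficients are the
  -- coordinates of Ad(a⁻¹)U. Bracketing with the right-invariant field of X kills the frame, so the
  -- derivative of the coefficients must equal the bracket -[X, U].
  have hU : (fund E U : ∀ a : G, TangentSpace 𝓘(ℝ, E) a) =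
      fun a => ∑ i, f i a • W i a := by
    funext a
    have h1 : c a = ∑ i, f i a • b i := (b.sum_repr (c a)).symm
    have h2 := mfderiv_mul_left_Ad_inv U a
    let T : E →L[ℝ] E := mfderiv 𝓘(ℝ, E) 𝓘(ℝ, E) (fun z : G => a * z) 1
    have h3 : (mulInvariantVectorField (Ad E a⁻¹ U : LieAlg E G) a : E) = T (∑ i, f i a • b i) :=
      congrArg T h1
    have h4 : T (∑ i, f i a • b i) = ∑ i, f i a • T (b i) := by simp only [map_sum, map_smul]
    exact h2.symm.trans (h3.trans h4)
  have h1 := mlieBracket_sum_smul Finset.univ f (fund E X) W (1 : G)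
    (fun i => (hf i).mdifferentiableAt) (fun i => isDiffFieldAt_mulInvariantVectorField _ _)
  rw [← hU] at h1
  have h2 : ∀ i, (mvfderiv 𝓘(ℝ, E) (f i) 1 (fund E X (1 : G)) • W i 1 +
        f i 1 • mlieBracket 𝓘(ℝ, E) (fund E X) (W i) 1 : TangentSpace 𝓘(ℝ, E) (1 : G)) =
        (l i (mfderiv 𝓘(ℝ, E) 𝓘(ℝ, E) c 1 X)) • (b i : LieAlg E G) := by
    intro i
    have e1 : mvfderiv 𝓘(ℝ, E) (f i) 1 (fund E X (1 : G)) =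
        l i (mfderiv 𝓘(ℝ, E) 𝓘(ℝ, E) c 1 X) :=
      (DFunLike.congr_fun (hf i).mfderiv (fund E X (1 : G))).trans
        (congrArg ((l i).comp (mfderiv 𝓘(ℝ, E) 𝓘(ℝ, E) c 1 : E →L[ℝ] E)) (fund_one X))
    have e2 : W i 1 = (b i : LieAlg E G) := mulInvariantVectorField_one _
    have e3 : mlieBracket 𝓘(ℝ, E) (fund E X) (W i) 1 = 0 := mlieBracket_fund_mulInvariant X _
    rw [e1, e2, e3, smul_zero, add_zero]
    rfl
  have h3 := mlieBracket_fund_one X U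
  have h4 : (∑ i, (l i (mfderiv 𝓘(ℝ, E) 𝓘(ℝ, E) c 1 X)) • b i : E) =
      mfderiv 𝓘(ℝ, E) 𝓘(ℝ, E) c 1 X := b.sum_repr _
  exact h4.symm.trans ((Finset.sum_congr rfl fun i _ => (h2 i).symm).trans (h1.symm.trans h3))

end Adjoint

/-! ### Invariant metrics: the Killing equation and Koszul's formula -/

section Metric

set_option linter.unusedSectionVars false

variable {E : Type*} [NormedAddCommGroup E] [NormedSpace ℝ E] [FiniteDimensional ℝ E]
  {G : Type*} [TopologicalSpace G] [ChartedSpace E G] [Group G] [LieGroup 𝓘(ℝ, E) ∞ G]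
  {EM : Type*} [NormedAddCommGroup EM] [NormedSpace ℝ EM] [FiniteDimensional ℝ EM]
  {M : Type*} [TopologicalSpace M] [ChartedSpace EM M] [IsManifold 𝓘(ℝ, EM) ∞ M]
  [MulAction G M]

lemma mdifferentiableAt_inner (g : RiemannianMetric EM M)
    {Y Z : ∀ m : M, TangentSpace 𝓘(ℝ, EM) m} {m : M} (hY : IsDiffFieldAt EM Y m)
    (hZ : IsDiffFieldAt EM Z m) :
    MDifferentiableAt 𝓘(ℝ, EM) 𝓘(ℝ, ℝ) (fun y => g.inner y (Y y) (Z y)) m := by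
  have hg : MDifferentiableAt 𝓘(ℝ, EM) (𝓘(ℝ, EM).prod 𝓘(ℝ, EM →L[ℝ] EM →L[ℝ] ℝ))
      (fun b ↦ TotalSpace.mk' (EM →L[ℝ] EM →L[ℝ] ℝ)
        (E := fun x : M => TangentSpace 𝓘(ℝ, EM) x →L[ℝ] TangentSpace 𝓘(ℝ, EM) x →L[ℝ] ℝ)
        b (g.inner b)) m := g.contMDiff.mdifferentiable (by simp) m
  have := MDifferentiableAt.clm_bundle_apply₂ (E₃ := fun _ : M => ℝ) hg hY hZ
  exact (mdifferentiableAt_section _ (E := Bundle.Trivial M ℝ) _).1 this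

/-- The derivative of the function `F` in the direction `v`. -/
def derivAlong (F : M → ℝ) (m : M) (v : TangentSpace 𝓘(ℝ, EM) m) : ℝ :=
  mfderiv 𝓘(ℝ, EM) 𝓘(ℝ, ℝ) F m v

/-- The bilinear form on `𝔤` induced by a metric on `M` at `m` via fundamental fields. -/
def fundForm (g : RiemannianMetric EM M) (m : M) : LinearMap.BilinForm ℝ (LieAlg E G) :=
  LinearMap.mk₂ ℝ (fun U V => g.inner m (fund EM U m) (fund EM V m))
    (fun U U' V => by rw [fund_add, map_add, add_apply])
    (fun c U V => by rw [fund_smul, map_smul, smul_apply])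
    (fun U V V' => by rw [fund_add, map_add])
    (fun c U V => by rw [fund_smul, map_smul])

lemma fundForm_apply (g : RiemannianMetric EM M) (m : M) (U V : LieAlg E G) :
    fundForm g m U V = g.inner m (fund EM U m) (fund EM V m) := rfl

lemma fundForm_symm (g : RiemannianMetric EM M) (m : M) (U V : LieAlg E G) :
    fundForm g m U V = fundForm g m V U := g.symm m _ _

lemma Ad_mul (a b : G) (X : LieAlg E G) : Ad E (a * b) X = Ad E a (Ad E b X) := by
  have hd : ∀ (a : G) y, MDifferentiableAt 𝓘(ℝ, E) 𝓘(ℝ, E) (fun x : G => a * x * a⁻¹) y := by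
    intro a
    have : ContMDiff 𝓘(ℝ, E) 𝓘(ℝ, E) ∞ (fun x : G => a * x * a⁻¹) :=
      (contMDiff_const.mul contMDiff_id).mul contMDiff_const
    exact this.mdifferentiable (by simp)
  have h1 := (hd a (b * 1 * b⁻¹)).hasMFDerivAt.comp (1 : G) (hd b 1).hasMFDerivAt
  have h2 : ((fun x : G => a * x * a⁻¹) ∘ fun x : G => b * x * b⁻¹) =
      fun x => (a * b) * x * (a * b)⁻¹ := by funext x; simp [mul_assoc]
  rw [h2] at h1
  have h3 := mfderiv_apply_congr (I := 𝓘(ℝ, E)) (I' := 𝓘(ℝ, E)) (fun x : G => a * x * a⁻¹)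
    (show b * 1 * b⁻¹ = 1 by simp) (Ad E b X)
  exact (DFunLike.congr_fun h1.mfderiv X).trans h3

lemma Ad_one (X : LieAlg E G) : Ad E (1 : G) X = X := by
  have : (fun b : G => 1 * b * 1⁻¹) = id := by funext b; simp
  have h := (hasMFDerivAt_id (I := 𝓘(ℝ, E)) (1 : G)).mfderiv
  rw [← this] at h
  exact DFunLike.congr_fun h X

lemma Ad_inv_apply (a : G) (X : LieAlg E G) : Ad E a (Ad E a⁻¹ X) = X := by
  rw [← Ad_mul, mul_inv_cancel, Ad_one]

/-- Moves the dependence on the point of an orbit into the arguments, where it is governed by Ad and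
can be differentiated. -/
lemma fundForm_smul {g : RiemannianMetric EM M} (hact : IsSmoothAction E G EM M)
    (hg : IsInvariantMetric G g) (m : M) (a : G) (U V : LieAlg E G) :
    fundForm g (a • m) U V = fundForm g m (Ad E a⁻¹ U) (Ad E a⁻¹ V) := by
  have h := hg a m (fund EM (Ad E a⁻¹ U) m) (fund EM (Ad E a⁻¹ V) m)
  rw [hact.mfderiv_smul_fund, hact.mfderiv_smul_fund, Ad_inv_apply, Ad_inv_apply] at h
  exact h

lemma hasMFDerivAt_bilinear {M F : Type*} [TopologicalSpace M] [ChartedSpace E M]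
    [NormedAddCommGroup F] [NormedSpace ℝ F] (B : F →L[ℝ] F →L[ℝ] ℝ)
    {c d : M → F} {m : M} {c' d' : E →L[ℝ] F}
    (hc : HasMFDerivAt 𝓘(ℝ, E) 𝓘(ℝ, F) c m c') (hd : HasMFDerivAt 𝓘(ℝ, E) 𝓘(ℝ, F) d m d') :
    ∃ L : E →L[ℝ] ℝ, HasMFDerivAt 𝓘(ℝ, E) 𝓘(ℝ, ℝ) (fun a => B (c a) (d a)) m L ∧
      ∀ v, L v = B (c m) (d' v) + B (c' v) (d m) := by
  have hcd : HasMFDerivAt 𝓘(ℝ, E) 𝓘(ℝ, F × F) (fun a => (c a, d a)) m (c'.prod d') :=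
    ⟨hc.1.prodMk hd.1, hc.2.prodMk hd.2⟩
  have h2 := HasMFDerivAt.comp (g := fun p : F × F => B p.1 p.2) m
    (B.isBoundedBilinearMap.hasFDerivAt (c m, d m)).hasMFDerivAt hcd
  exact ⟨_, h2, fun v => rfl⟩

/-- Fundamental fields are Killing fields of an invariant metric. -/
lemma derivAlong_fundForm {g : RiemannianMetric EM M} (hact : IsSmoothAction E G EM M)
    (hg : IsInvariantMetric G g) (m : M) (X U V : LieAlg E G) :
    derivAlong (fun y => fundForm g y U V) m (fund EM X m) =
      -(fundForm g m ⁅X, U⁆ V + fundForm g m U ⁅X, V⁆) := by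
  have hF : MDifferentiableAt 𝓘(ℝ, EM) 𝓘(ℝ, ℝ) (fun y => fundForm g y U V) ((1 : G) • m) :=
    mdifferentiableAt_inner g (hact.isDiffFieldAt_fund U _) (hact.isDiffFieldAt_fund V _)
  have ho : MDifferentiableAt 𝓘(ℝ, E) 𝓘(ℝ, EM) (fun a : G => a • m) 1 :=
    (hact.contMDiff_orbit m).mdifferentiable (by simp) _
  have h1 := hF.hasMFDerivAt.comp (1 : G) ho.hasMFDerivAt
  let P : E →L[ℝ] EM := mfderiv 𝓘(ℝ, E) 𝓘(ℝ, EM) (fun a : G => a • m) 1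
  let gm : EM →L[ℝ] EM →L[ℝ] ℝ := g.inner m
  let B : E →L[ℝ] E →L[ℝ] ℝ := gm.bilinearComp P P
  have hB : ∀ U V : LieAlg E G, fundForm g m U V = B U V := fun _ _ => rfl
  have hc : ∀ U : LieAlg E G, HasMFDerivAt 𝓘(ℝ, E) 𝓘(ℝ, E) (fun a : G => adOrbit U a⁻¹) 1
      (mfderiv 𝓘(ℝ, E) 𝓘(ℝ, E) (fun a : G => adOrbit U a⁻¹) 1) := fun U =>
    (((contMDiff_adOrbit U).comp (contMDiff_inv 𝓘(ℝ, E) ∞)).mdifferentiable (by simp)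
      _).hasMFDerivAt
  obtain ⟨L, h2, hL⟩ := hasMFDerivAt_bilinear B (hc U) (hc V)
  have h3 : ((fun y => fundForm g y U V) ∘ fun a : G => a • m) =
      fun a : G => B (adOrbit U a⁻¹) (adOrbit V a⁻¹) := by
    funext a
    exact fundForm_smul hact hg m a U V
  rw [h3] at h1
  have h4 := DFunLike.congr_fun (hasMFDerivAt_unique h1 h2) X
  have h5 := mfderiv_apply_congr (I := 𝓘(ℝ, EM)) (I' := 𝓘(ℝ, ℝ)) (fun y => fundForm g y U V)
    (one_smul G m) (fund EM X m)
  have hone : ∀ U : LieAlg E G, adOrbit U (1 : G)⁻¹ = U := fun U => by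
    rw [inv_one]; exact Ad_one U
  have e1 := mfderiv_adOrbit_inv X U
  have e2 := mfderiv_adOrbit_inv X V
  have h6 : L X = B U (-⁅X, V⁆ : LieAlg E G) + B (-⁅X, U⁆ : LieAlg E G) V := by
    rw [← hone U, ← hone V]
    refine (hL X).trans ?_
    rw [hone, hone]
    exact congrArg₂ (fun x y : E => B U x + B y V) e2 e1
  have h7 : L X = -(fundForm g m ⁅X, U⁆ V + fundForm g m U ⁅X, V⁆) := by
    refine h6.trans ?_
    have e3 : fundForm g m U (-⁅X, V⁆) + fundForm g m (-⁅X, U⁆) V =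
        -(fundForm g m ⁅X, U⁆ V + fundForm g m U ⁅X, V⁆) := by
      rw [map_neg, map_neg, LinearMap.neg_apply]; ring
    exact e3
  exact h5.symm.trans (h4.trans h7)

/-- Koszul's formula for fundamental fields. -/
lemma koszul_fund {g : RiemannianMetric EM M} (hact : IsSmoothAction E G EM M)
    (hg : IsInvariantMetric G g) {cov : Connection EM M} (hcov : IsLeviCivita g cov) (m : M)
    (X Y Z : LieAlg E G) :
    2 * g.inner m (cov (fund EM Y) m (fund EM X m)) (fund EM Z m) =
      -(fundForm g m ⁅X, Y⁆ Z + fundForm g m Y ⁅X, Z⁆ + fundForm g m X ⁅Y, Z⁆) := by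
  have hm : ∀ X Y Z : LieAlg E G,
      g.inner m (cov (fund EM Y) m (fund EM X m)) (fund EM Z m) +
        g.inner m (cov (fund EM Z) m (fund EM X m)) (fund EM Y m) =
      -(fundForm g m ⁅X, Y⁆ Z + fundForm g m Y ⁅X, Z⁆) := by
    intro X Y Z
    rw [← derivAlong_fundForm hact hg, g.symm m (cov (fund EM Z) m (fund EM X m))]
    exact (hcov.metric (fund EM Y) (fund EM Z) m (hact.isDiffFieldAt_fund _ _)
      (hact.isDiffFieldAt_fund _ _) (fund EM X m)).symm
  have ht : ∀ X Y Z : LieAlg E G,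
      g.inner m (cov (fund EM Y) m (fund EM X m)) (fund EM Z m) -
        g.inner m (cov (fund EM X) m (fund EM Y m)) (fund EM Z m) = -fundForm g m ⁅X, Y⁆ Z := by
    intro X Y Z
    have h := hcov.torsion_free (fund EM X) (fund EM Y) m (hact.isDiffFieldAt_fund _ _)
      (hact.isDiffFieldAt_fund _ _)
    rw [hact.mlieBracket_fund] at h
    have h2 := congrArg (fun v => g.inner m v (fund EM Z m)) h
    simp only [map_sub, map_neg, sub_apply, neg_apply] at h2
    exact h2
  have hsk : ∀ X Y Z : LieAlg E G, fundForm g m ⁅Y, X⁆ Z = -fundForm g m ⁅X, Y⁆ Z := by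
    intro X Y Z
    rw [← lie_skew, map_neg, LinearMap.neg_apply]
  have s1 := fundForm_symm g m Y ⁅X, Z⁆
  have s2 := fundForm_symm g m X ⁅Y, Z⁆
  have s3 := fundForm_symm g m X ⁅Z, Y⁆
  have s4 := fundForm_symm g m Z ⁅X, Y⁆
  have s5 := fundForm_symm g m Y ⁅Z, X⁆
  have k1 := hsk X Y Z
  have k2 := hsk X Z Y
  have k3 := hsk Y Z X
  linarith [hm X Y Z, hm Y X Z, hm Z X Y, ht X Y Z, ht X Z Y, ht Y Z X]

end Metric

/-! ### Differentiability tested against a frame -/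

section Frame

set_option linter.unusedSectionVars false

variable {EM : Type*} [NormedAddCommGroup EM] [NormedSpace ℝ EM] [FiniteDimensional ℝ EM]
  {M : Type*} [TopologicalSpace M] [ChartedSpace EM M] [IsManifold 𝓘(ℝ, EM) ∞ M]

/-- The endomorphism of `ι → ℝ` given by a matrix, as a continuous linear map. -/
def gramOp (ι : Type*) [Fintype ι] : (ι × ι → ℝ) →L[ℝ] (ι → ℝ) →L[ℝ] (ι → ℝ) :=
  LinearMap.toContinuousLinearMap
    { toFun := fun A => LinearMap.toContinuousLinearMap
        { toFun := fun v j => ∑ i, v i * A (i, j)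
          map_add' := fun v w => by ext j; simp [add_mul, Finset.sum_add_distrib]
          map_smul' := fun c v => by ext j; simp [Finset.mul_sum, mul_assoc] }
      map_add' := fun A B => by ext v j; simp [mul_add, Finset.sum_add_distrib]
      map_smul' := fun c A => by ext v j; simp [Finset.mul_sum, mul_left_comm] }

lemma gramOp_apply {ι : Type*} [Fintype ι] (A : ι × ι → ℝ) (v : ι → ℝ) (j : ι) :
    gramOp ι A v j = ∑ i, v i * A (i, j) := rfl

lemma isUnit_of_injective {V : Type*} [NormedAddCommGroup V] [NormedSpace ℝ V]
    [FiniteDimensional ℝ V] (T : V →L[ℝ] V) (h : Function.Injective T) : IsUnit T := by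
  have h2 : Function.Surjective T := LinearMap.surjective_of_injective (f := (T : V →ₗ[ℝ] V)) h
  exact ContinuousLinearMap.isUnit_iff_bijective.2 ⟨h, h2⟩

omit [FiniteDimensional ℝ EM] [IsManifold 𝓘(ℝ, EM) ∞ M] in
lemma mdifferentiableAt_pi_iff {κ : Type*} [Fintype κ] {f : M → κ → ℝ} {m : M} :
    MDifferentiableAt 𝓘(ℝ, EM) 𝓘(ℝ, κ → ℝ) f m ↔
      ∀ i, MDifferentiableAt 𝓘(ℝ, EM) 𝓘(ℝ, ℝ) (fun y => f y i) m := by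
  constructor
  · intro h i
    exact (ContinuousLinearMap.proj (R := ℝ) (φ := fun _ : κ => ℝ) i).differentiableAt.mdifferentiableAt.comp
      m h
  · intro h
    rw [mdifferentiableAt_iff]
    exact ⟨continuousAt_pi.2 fun i => (h i).continuousAt, differentiableWithinAt_pi.2 fun i =>
      ((mdifferentiableAt_iff _ _).1 (h i)).2⟩

lemma eq_zero_of_linearIndependent {V : Type*} [NormedAddCommGroup V] [NormedSpace ℝ V]
    [FiniteDimensional ℝ V] {ι : Type*} [Fintype ι] (b : Module.Basis ι ℝ V) {e : ι → V}
    (he : LinearIndependent ℝ e) (L : V →L[ℝ] ℝ) (h : ∀ j, L (e j) = 0) (v : V) : L v = 0 := by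
  have hsp : Submodule.span ℝ (Set.range e) = ⊤ :=
    he.span_eq_top_of_card_eq_finrank' (Module.finrank_eq_card_basis b).symm
  have h5 : Submodule.span ℝ (Set.range e) ≤ LinearMap.ker (L : V →ₗ[ℝ] ℝ) := by
    rw [Submodule.span_le]
    rintro _ ⟨j, rfl⟩
    exact h j
  rw [hsp] at h5
  exact h5 (Submodule.mem_top (x := v))

/-- A vector field is differentiable at `m` if its inner products with the members of a
differentiable frame are. -/
lemma isDiffFieldAt_of_inner_frame (g : RiemannianMetric EM M) {ι : Type*} [Fintype ι] {m : M}
    (e : ι → ∀ y : M, TangentSpace 𝓘(ℝ, EM) y) (he : ∀ i, IsDiffFieldAt EM (e i) m)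
    (b : Module.Basis ι ℝ EM) (hb : ∀ i, e i m = b i)
    (S : ∀ y : M, TangentSpace 𝓘(ℝ, EM) y)
    (hS : ∀ j, MDifferentiableAt 𝓘(ℝ, EM) 𝓘(ℝ, ℝ) (fun y => g.inner y (S y) (e j y)) m) :
    IsDiffFieldAt EM S m := by
  classical
  let A : M → (ι × ι → ℝ) := fun y p => g.inner y (e p.1 y) (e p.2 y)
  let r : M → (ι → ℝ) := fun y j => g.inner y (S y) (e j y)
  have hA : MDifferentiableAt 𝓘(ℝ, EM) 𝓘(ℝ, ι × ι → ℝ) A m :=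
    mdifferentiableAt_pi_iff.2 fun p => mdifferentiableAt_inner g (he _) (he _)
  have hr : MDifferentiableAt 𝓘(ℝ, EM) 𝓘(ℝ, ι → ℝ) r m := mdifferentiableAt_pi_iff.2 hS
  have hcomb : ∀ (y : M) (v : ι → ℝ) (u : TangentSpace 𝓘(ℝ, EM) y),
      g.inner y u (∑ i, v i • e i y) = ∑ i, v i * g.inner y u (e i y) := by
    intro y v u
    rw [map_sum]
    exact Finset.sum_congr rfl fun i _ => map_smul _ _ _
  have hsum : ∀ (y : M) (v : ι → ℝ) (j : ι), gramOp ι (A y) v j =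
      g.inner y (∑ i, v i • e i y) (e j y) := by
    intro y v j
    rw [gramOp_apply, g.symm, hcomb]
    exact Finset.sum_congr rfl fun i _ => congrArg (v i * ·) (g.symm _ _ _)
  have hinj : ∀ y, LinearIndependent ℝ (fun i => (e i y : EM)) →
      Function.Injective (gramOp ι (A y)) := by
    intro y hli
    rw [injective_iff_map_eq_zero]
    intro v hv
    set w : TangentSpace 𝓘(ℝ, EM) y := ∑ i, v i • e i y with hw
    have h1 : ∀ j, g.inner y w (e j y) = 0 := fun j => by rw [← hsum, hv]; rfl
    have h2 : g.inner y w w = 0 :=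
      (hcomb y v w).trans (Finset.sum_eq_zero fun i _ => by rw [h1, mul_zero])
    have h3 : w = 0 := by
      by_contra hne
      exact (g.pos y w hne).ne' h2
    have h4 : ∑ i, v i • (e i y : EM) = 0 := h3
    funext i
    exact Fintype.linearIndependent_iff.1 hli v h4 i
  have hbm : (fun i => (e i m : EM)) = b := funext hb
  have hAm : IsUnit (gramOp ι (A m)) :=
    isUnit_of_injective _ (hinj m (by rw [hbm]; exact b.linearIndependent))
  have hAev : ∀ᶠ y in 𝓝 m, IsUnit (gramOp ι (A y)) := by
    have hc : ContinuousAt (fun y => gramOp ι (A y)) m :=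
      (gramOp ι).continuous.continuousAt.comp hA.continuousAt
    exact hc.eventually (Units.isOpen.mem_nhds hAm)
  -- The frame coefficients are the inverse Gram matrix applied to the inner products; inversion is
  -- differentiable at invertible matrices.
  let Ψ : (ι × ι → ℝ) × (ι → ℝ) → (ι → ℝ) := fun p => Ring.inverse (gramOp ι p.1) p.2
  have hΨ : DifferentiableAt ℝ Ψ (A m, r m) := by
    have h1 : DifferentiableAt ℝ (fun p : (ι × ι → ℝ) × (ι → ℝ) => gramOp ι p.1) (A m, r m) := by
      fun_prop
    have h2 : DifferentiableAt ℝ (Ring.inverse : ((ι → ℝ) →L[ℝ] (ι → ℝ)) → _)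
        (gramOp ι (A m, r m).1) :=
      differentiableAt_inverse hAm
    exact (h2.comp (A m, r m) h1).clm_apply differentiableAt_snd
  let c : M → (ι → ℝ) := fun y => Ψ (A y, r y)
  have hc : MDifferentiableAt 𝓘(ℝ, EM) 𝓘(ℝ, ι → ℝ) c m :=
    hΨ.mdifferentiableAt.comp m (hA.prodMk_space hr)
  have hci : ∀ i, MDifferentiableAt 𝓘(ℝ, EM) 𝓘(ℝ, ℝ) (fun y => c y i) m :=
    mdifferentiableAt_pi_iff.1 hc
  have hS' : IsDiffFieldAt EM (fun y => ∑ i, c y i • e i y) m := by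
    have : ∀ i ∈ Finset.univ, MDifferentiableAt 𝓘(ℝ, EM) 𝓘(ℝ, EM).tangent (fun y =>
        (TotalSpace.mk' EM y (c y i • e i y) : TangentBundle 𝓘(ℝ, EM) M)) m :=
      fun i _ => (hci i).smul_section (he i)
    have := fun i hi => (this i hi).mdifferentiableWithinAt (s := Set.univ)
    exact mdifferentiableWithinAt_univ.1 (MDifferentiableWithinAt.sum_section this)
  -- Where the Gram matrix is invertible the frame is a basis, so the difference of the two fields,
  -- being orthogonal to it, vanishes.
  refine hS'.congr_of_eventuallyEq ?_
  filter_upwards [hAev] with y hy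
  have h1 : gramOp ι (A y) (c y) = r y := by
    have := Ring.mul_inverse_cancel _ hy
    exact DFunLike.congr_fun this (r y)
  have hli : LinearIndependent ℝ (fun i => (e i y : EM)) := by
    rw [Fintype.linearIndependent_iff]
    intro v hv
    have h2 : gramOp ι (A y) v = 0 := by
      funext j
      rw [hsum]
      have : (∑ i, v i • e i y : TangentSpace 𝓘(ℝ, EM) y) = 0 := hv
      rw [this, map_zero]; rfl
    have h3 := (ContinuousLinearMap.isUnit_iff_bijective.1 hy).1
    have h4 : v = 0 := h3 (h2.trans (map_zero _).symm)
    intro i; rw [h4]; rfl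
  set w : TangentSpace 𝓘(ℝ, EM) y := S y - ∑ i, c y i • e i y with hw
  have h2 : ∀ j, g.inner y w (e j y) = 0 := by
    intro j
    rw [hw, map_sub, sub_apply, ← hsum, h1, sub_eq_zero]
  have h3 : ∀ v : EM, g.inner y w v = 0 := eq_zero_of_linearIndependent b hli (g.inner y w) h2
  have h4 : w = 0 := by
    by_contra hne
    exact (g.pos y w hne).ne' (h3 w)
  exact congrArg (TotalSpace.mk' EM y) (sub_eq_zero.1 h4)

end Frame

/-! ### Curvature in the direction of a geodesic vector -/

section Curvature

set_option linter.unusedSectionVars false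

variable {E : Type*} [NormedAddCommGroup E] [NormedSpace ℝ E] [FiniteDimensional ℝ E]
  {G : Type*} [TopologicalSpace G] [ChartedSpace E G] [Group G] [LieGroup 𝓘(ℝ, E) ∞ G]
  {EM : Type*} [NormedAddCommGroup EM] [NormedSpace ℝ EM] [FiniteDimensional ℝ EM]
  {M : Type*} [TopologicalSpace M] [ChartedSpace EM M] [IsManifold 𝓘(ℝ, EM) ∞ M]
  [MulAction G M]

/-- Covariant derivatives of fundamental fields along fundamental fields are differentiable. -/
lemma isDiffFieldAt_cov_fund {g : RiemannianMetric EM M} (hact : IsSmoothAction E G EM M)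
    (hg : IsInvariantMetric G g) {cov : Connection EM M} (hcov : IsLeviCivita g cov) {m : M}
    (hsurj : ∀ v : TangentSpace 𝓘(ℝ, EM) m, ∃ X : LieAlg E G, fund EM X m = v)
    (Y Z : LieAlg E G) :
    IsDiffFieldAt EM (fun y : M => cov (fund EM Z) y (fund EM Y y)) m := by
  let b := Module.finBasis ℝ EM
  choose X hX using fun i => hsurj (b i)
  refine isDiffFieldAt_of_inner_frame g (fun i => fund EM (X i))
    (fun i => hact.isDiffFieldAt_fund _ _) b hX _ fun j => ?_
  have h1 : ∀ U V : LieAlg E G,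
      MDifferentiableAt 𝓘(ℝ, EM) 𝓘(ℝ, ℝ) (fun y : M => fundForm g y U V) m := fun U V =>
    mdifferentiableAt_inner g (hact.isDiffFieldAt_fund U _) (hact.isDiffFieldAt_fund V _)
  -- Koszul's formula, valid at every point y, replaces the covariant derivative by functions
  -- already known to be differentiable.
  have h2 : (fun y : M => g.inner y (cov (fund EM Z) y (fund EM Y y)) (fund EM (X j) y)) =
      fun y => (-(1 / 2) : ℝ) * (fundForm g y ⁅Y, Z⁆ (X j) + fundForm g y Z ⁅Y, X j⁆ +
        fundForm g y Y ⁅Z, X j⁆) := by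
    funext y
    have := koszul_fund hact hg hcov y Y Z (X j)
    linarith
  rw [h2]
  exact mdifferentiableAt_const.mul (((h1 _ _).add (h1 _ _)).add (h1 _ _))

lemma derivAlong_inner {g : RiemannianMetric EM M} {cov : Connection EM M}
    (hcov : IsLeviCivita g cov) {Y Z : ∀ m : M, TangentSpace 𝓘(ℝ, EM) m} {m : M}
    (hY : IsDiffFieldAt EM Y m) (hZ : IsDiffFieldAt EM Z m) (v : TangentSpace 𝓘(ℝ, EM) m) :
    derivAlong (fun y => g.inner y (Y y) (Z y)) m v =
      g.inner m (cov Y m v) (Z m) + g.inner m (Y m) (cov Z m v) :=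
  hcov.metric Y Z m hY hZ v

lemma derivAlong_const_mul {F : M → ℝ} {m : M} (c : ℝ)
    (hF : MDifferentiableAt 𝓘(ℝ, EM) 𝓘(ℝ, ℝ) F m) (v : TangentSpace 𝓘(ℝ, EM) m) :
    derivAlong (fun y => c * F y) m v = c * derivAlong F m v :=
  DFunLike.congr_fun (hF.hasMFDerivAt.const_smul c).mfderiv v

lemma derivAlong_zero (m : M) (v : TangentSpace 𝓘(ℝ, EM) m) :
    derivAlong (fun _ : M => (0 : ℝ)) m v = 0 :=
  DFunLike.congr_fun (hasMFDerivAt_const (0 : ℝ) m).mfderiv v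

/-- The sectional curvature expression `g(R(e, X) X, e)` of an invariant metric on a homogeneous
space, for `X` a geodesic vector. -/
lemma inner_curvature_fund {g : RiemannianMetric EM M} (hact : IsSmoothAction E G EM M)
    (hg : IsInvariantMetric G g) {cov : Connection EM M} (hcov : IsLeviCivita g cov)
    {R : ∀ x : M, TangentSpace 𝓘(ℝ, EM) x →ₗ[ℝ] TangentSpace 𝓘(ℝ, EM) x →ₗ[ℝ]
      TangentSpace 𝓘(ℝ, EM) x →ₗ[ℝ] TangentSpace 𝓘(ℝ, EM) x} (hR : IsCurvatureTensor cov R)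
    {m : M} (hsurj : ∀ v : TangentSpace 𝓘(ℝ, EM) m, ∃ X : LieAlg E G, fund EM X m = v)
    {X : LieAlg E G} (hX : ∀ Z, fundForm g m X ⁅X, Z⁆ = 0) (e : LieAlg E G) :
    g.inner m (R m (fund EM e m) (fund EM X m) (fund EM X m)) (fund EM e m) =
      -(1 / 2) * fundForm g m ⁅X, e⁆ ⁅X, e⁆ + 1 / 2 * fundForm g m X ⁅e, ⁅X, e⁆⁆ -
        1 / 2 * fundForm g m ⁅X, ⁅X, e⁆⁆ e +
        g.inner m (cov (fund EM e) m (fund EM X m) + fund EM ⁅X, e⁆ m)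
          (cov (fund EM e) m (fund EM X m)) := by
  have hsm := fun U : LieAlg E G => hact.contMDiff_fund U
  have hd := fun U : LieAlg E G => hact.isDiffFieldAt_fund U m
  have hdc := fun U V : LieAlg E G => isDiffFieldAt_cov_fund hact hg hcov hsurj U V
  have hK := fun U V W : LieAlg E G => koszul_fund hact hg hcov m U V W
  have hsk : ∀ U V W : LieAlg E G, fundForm g m ⁅V, U⁆ W = -fundForm g m ⁅U, V⁆ W := by
    intro X Y Z
    rw [← lie_skew, map_neg, LinearMap.neg_apply]
  have hsk' : ∀ U V W : LieAlg E G, fundForm g m W ⁅V, U⁆ = -fundForm g m W ⁅U, V⁆ := by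
    intro X Y Z
    rw [← lie_skew, map_neg]
  -- Koszul's formula with both arguments X leaves only the terms q(X, [X, Z]), which vanish for a
  -- geodesic vector.
  have hXX : cov (fund EM X) m (fund EM X m) = 0 := by
    by_contra hne
    obtain ⟨Z, hZ⟩ := hsurj (cov (fund EM X) m (fund EM X m))
    have h1 := hK X X Z
    rw [hX, lie_self, map_zero, LinearMap.zero_apply, hZ] at h1
    have := g.pos m _ hne
    linarith
  have h0 := hR _ _ _ (hsm e) (hsm X) (hsm X) m
  -- Differentiate g(∇_X X, e) = -q(X, [X, e]) along e; the term with ∇_X X drops because that field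
  -- vanishes at m.
  have T1 : g.inner m (cov (fun y => cov (fund EM X) y (fund EM X y)) m (fund EM e m))
      (fund EM e m) = -fundForm g m ⁅X, e⁆ ⁅X, e⁆ + fundForm g m X ⁅e, ⁅X, e⁆⁆ := by
    have h1 := derivAlong_inner hcov (hdc X X) (hd e) (fund EM e m)
    have h2 : (fun y : M => g.inner y (cov (fund EM X) y (fund EM X y)) (fund EM e y)) =
        fun y => (-1 : ℝ) * fundForm g y X ⁅X, e⁆ := by
      funext y
      have := koszul_fund hact hg hcov y X X e
      rw [lie_self, map_zero, LinearMap.zero_apply] at this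
      linarith
    have h4 : MDifferentiableAt 𝓘(ℝ, EM) 𝓘(ℝ, ℝ) (fun y => fundForm g y X ⁅X, e⁆) m :=
      mdifferentiableAt_inner g (hd X) (hd _)
    rw [h2, derivAlong_const_mul _ h4,
      derivAlong_fundForm hact hg, hXX, map_zero, zero_apply, add_zero] at h1
    rw [← h1, hsk]
    ring
  -- As X is Killing, g(∇_e X, e) is identically 0. Its derivative along X gives g(∇_X ∇_e X, e) =
  -- -g(∇_e X, ∇_X e), and torsion-freeness rewrites ∇_e X as ∇_X e + [X, e]*.
  have T2 : g.inner m (cov (fun y => cov (fund EM X) y (fund EM e y)) m (fund EM X m))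
      (fund EM e m) = -g.inner m (cov (fund EM e) m (fund EM X m) + fund EM ⁅X, e⁆ m)
          (cov (fund EM e) m (fund EM X m)) := by
    have h1 := derivAlong_inner hcov (hdc e X) (hd e) (fund EM X m)
    have h2 : (fun y : M => g.inner y (cov (fund EM X) y (fund EM e y)) (fund EM e y)) =
        fun y => 0 := by
      funext y
      have := koszul_fund hact hg hcov y e X e
      have h4 : fundForm g y ⁅e, X⁆ e = - fundForm g y e ⁅X, e⁆ := by
        rw [← lie_skew, map_neg, LinearMap.neg_apply, fundForm_symm]
      rw [lie_self, map_zero, h4] at this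
      linarith
    have h3 := hcov.torsion_free (fund EM X) (fund EM e) m (hd _) (hd _)
    rw [hact.mlieBracket_fund] at h3
    have h5 : cov (fund EM e) m (fund EM X m) + fund EM ⁅X, e⁆ m =
        cov (fund EM X) m (fund EM e m) := by
      rw [sub_eq_iff_eq_add] at h3
      rw [h3]; abel
    rw [h2, derivAlong_zero] at h1
    rw [h5]
    linarith
  have T3 : g.inner m (cov (fund EM X) m (mlieBracket 𝓘(ℝ, EM) (fund EM e) (fund EM X) m))
      (fund EM e m) = -(1 / 2) * (-fundForm g m ⁅X, ⁅X, e⁆⁆ e - fundForm g m X ⁅e, ⁅X, e⁆⁆ +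
        fundForm g m ⁅X, e⁆ ⁅X, e⁆) := by
    have h1 := hK ⁅X, e⁆ X e
    have h2 : mlieBracket 𝓘(ℝ, EM) (fund EM e) (fund EM X) m = fund EM ⁅X, e⁆ m := by
      rw [hact.mlieBracket_fund, ← lie_skew e X, fund_neg, neg_neg]
    rw [h2]
    have h3 := hsk X ⁅X, e⁆ e
    have h4 := hsk' e ⁅X, e⁆ X
    linarith
  have h1 : g.inner m (R m (fund EM e m) (fund EM X m) (fund EM X m)) (fund EM e m) =
      g.inner m (cov (fun y => cov (fund EM X) y (fund EM X y)) m (fund EM e m)) (fund EM e m) -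
      g.inner m (cov (fun y => cov (fund EM X) y (fund EM e y)) m (fund EM X m)) (fund EM e m) -
      g.inner m (cov (fund EM X) m (mlieBracket 𝓘(ℝ, EM) (fund EM e) (fund EM X) m))
        (fund EM e m) := by
    rw [h0, map_sub, map_sub, sub_apply, sub_apply]
  rw [h1, T1, T2, T3]
  ring

/-- What the Einstein condition for an invariant metric on a homogeneous space says about geodesic
vectors. -/
lemma exists_trace_of_isEinstein {g : RiemannianMetric EM M} (hact : IsSmoothAction E G EM M)
    (hg : IsInvariantMetric G g) (hE : IsEinstein g) {m : M}
    (hsurj : ∀ v : TangentSpace 𝓘(ℝ, EM) m, ∃ X : LieAlg E G, fund EM X m = v) :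
    ∃ c : ℝ, ∀ X : LieAlg E G, (∀ Z, fundForm g m X ⁅X, Z⁆ = 0) →
      ∃ A : TangentSpace 𝓘(ℝ, EM) m →ₗ[ℝ] TangentSpace 𝓘(ℝ, EM) m,
        LinearMap.trace ℝ _ A = c * fundForm g m X X ∧
        ∀ e : LieAlg E G, ∃ w : TangentSpace 𝓘(ℝ, EM) m,
          (∀ Z, 2 * g.inner m w (fund EM Z m) =
            -(fundForm g m ⁅X, e⁆ Z + fundForm g m e ⁅X, Z⁆ + fundForm g m X ⁅e, Z⁆)) ∧
          g.inner m (A (fund EM e m)) (fund EM e m) =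
            -(1 / 2) * fundForm g m ⁅X, e⁆ ⁅X, e⁆ + 1 / 2 * fundForm g m X ⁅e, ⁅X, e⁆⁆ -
              1 / 2 * fundForm g m ⁅X, ⁅X, e⁆⁆ e + g.inner m (w + fund EM ⁅X, e⁆ m) w := by
  obtain ⟨cov, hcov, R, hR, c, hc⟩ := hE
  -- A is u ↦ R(u, X)X and w is ∇_X e; Koszul's formula determines w, so the connection disappears
  -- from the statement.
  refine ⟨c, fun X hX => ⟨((R m).flip (fund EM X m)).flip (fund EM X m), hc m _ _, fun e =>
    ⟨cov (fund EM e) m (fund EM X m), fun Z => koszul_fund hact hg hcov m X e Z,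
      inner_curvature_fund hact hg hcov hR hsurj hX e⟩⟩⟩

end Curvature

/-! ### Coset spaces: the action, isotropy and invariance of the form -/

section Coset

set_option linter.unusedSectionVars false

variable {E : Type*} [NormedAddCommGroup E] [NormedSpace ℝ E] [FiniteDimensional ℝ E]
  {G : Type*} [TopologicalSpace G] [ChartedSpace E G] [Group G] [LieGroup 𝓘(ℝ, E) ∞ G]
  {H : Subgroup G}
  {EM : Type*} [NormedAddCommGroup EM] [NormedSpace ℝ EM] [FiniteDimensional ℝ EM]
  [ChartedSpace EM (G ⧸ H)] [IsManifold 𝓘(ℝ, EM) ∞ (G ⧸ H)]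

/-- Smoothness descends along the surjective submersion id × projection from G × G, where the action
becomes multiplication followed by projection. -/
lemma isSmoothAction_quotient
    (hM : Manifold.IsSubmersion 𝓘(ℝ, E) 𝓘(ℝ, EM) ∞ (fun a : G => (a : G ⧸ H))) :
    IsSmoothAction E G EM (G ⧸ H) := by
  have h1 : Manifold.IsSubmersion (𝓘(ℝ, E).prod 𝓘(ℝ, E)) (𝓘(ℝ, E).prod 𝓘(ℝ, EM)) ∞
      (Prod.map (@id G) (fun a : G => (a : G ⧸ H))) := Manifold.IsSubmersion.id.prodMap hM
  refine contMDiff_of_comp_submersion h1 (Function.surjective_id.prodMap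
    Quotient.mk_surjective) ?_
  exact hM.contMDiff.comp (contMDiff_mul 𝓘(ℝ, E) ∞)

lemma smul_one_coset (a : G) : a • ((1 : G) : G ⧸ H) = (a : G ⧸ H) :=
  congrArg _ (mul_one a)

lemma smul_one_coset_of_mem {h : G} (hh : h ∈ H) : h • ((1 : G) : G ⧸ H) = ((1 : G) : G ⧸ H) := by
  rw [smul_one_coset, QuotientGroup.eq]
  simpa using hh

lemma fund_one_coset (X : LieAlg E G) :
    fund EM X ((1 : G) : G ⧸ H) =
      mfderiv 𝓘(ℝ, E) 𝓘(ℝ, EM) (fun a : G => (a : G ⧸ H)) 1 X := by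
  have : (fun a : G => a • ((1 : G) : G ⧸ H)) = fun a : G => (a : G ⧸ H) :=
    funext smul_one_coset
  rw [← this]
  rfl

/-- The kernel of the differential of G → G/H is the tangent space of the fibre H: one inclusion is
`ker_submersion_le_range`, the other holds because the projection is constant on H. -/
lemma fund_one_coset_eq_zero_iff
    (hM : Manifold.IsSubmersion 𝓘(ℝ, E) 𝓘(ℝ, EM) ∞ (fun a : G => (a : G ⧸ H)))
    {EH : Type*} [NormedAddCommGroup EH] [NormedSpace ℝ EH] [FiniteDimensional ℝ EH]
    [ChartedSpace EH H] [LieGroup 𝓘(ℝ, EH) ∞ H]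
    (hemb : Manifold.IsSmoothEmbedding 𝓘(ℝ, EH) 𝓘(ℝ, E) ∞ (fun h : H => (h : G)))
    (X : LieAlg E G) :
    fund EM X ((1 : G) : G ⧸ H) = 0 ↔ X ∈ subgroupLieAlg E EH H := by
  rw [fund_one_coset]
  constructor
  · intro h
    obtain ⟨w, hw⟩ := ker_submersion_le_range hM hemb (1 : H) (fun x hx => by
      have h1 : ((1 : G) : G ⧸ H) = x := hx.symm
      rw [QuotientGroup.eq] at h1
      exact ⟨⟨x, by simpa using h1⟩, rfl⟩) X h
    exact ⟨w, hw⟩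
  · rintro ⟨w, rfl⟩
    have h1 : MDifferentiableAt 𝓘(ℝ, EH) 𝓘(ℝ, E) (fun h : H => (h : G)) 1 :=
      hemb.contMDiff.mdifferentiable (by simp) _
    have h2 : MDifferentiableAt 𝓘(ℝ, E) 𝓘(ℝ, EM) (fun a : G => (a : G ⧸ H)) ((1 : H) : G) :=
      hM.contMDiff.mdifferentiable (by simp) _
    have h3 := h2.hasMFDerivAt.comp (1 : H) h1.hasMFDerivAt
    have h4 : ((fun a : G => (a : G ⧸ H)) ∘ fun h : H => (h : G)) = fun _ => ((1 : G) : G ⧸ H) := by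
      funext h
      exact (QuotientGroup.eq.2 (by simp)).symm
    rw [h4] at h3
    exact DFunLike.congr_fun (hasMFDerivAt_unique h3 (hasMFDerivAt_const _ _)) w

lemma fundForm_Ad {g : RiemannianMetric EM (G ⧸ H)}
    (hM : Manifold.IsSubmersion 𝓘(ℝ, E) 𝓘(ℝ, EM) ∞ (fun a : G => (a : G ⧸ H)))
    (hg : IsInvariantMetric G g) {h : G} (hh : h ∈ H) (U V : LieAlg E G) :
    fundForm g ((1 : G) : G ⧸ H) (Ad E h U) (Ad E h V) = fundForm g ((1 : G) : G ⧸ H) U V := by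
  have h1 := fundForm_smul (isSmoothAction_quotient hM) hg ((1 : G) : G ⧸ H) h⁻¹ U V
  rw [smul_one_coset_of_mem (H.inv_mem hh), inv_inv] at h1
  exact h1.symm

/-- The Killing equation in the direction of the fundamental field of Z, which is zero at the base
coset. -/
lemma fundForm_ad {g : RiemannianMetric EM (G ⧸ H)}
    (hM : Manifold.IsSubmersion 𝓘(ℝ, E) 𝓘(ℝ, EM) ∞ (fun a : G => (a : G ⧸ H)))
    (hg : IsInvariantMetric G g) {Z : LieAlg E G} (hZ : fund EM Z ((1 : G) : G ⧸ H) = 0)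
    (U V : LieAlg E G) :
    fundForm g ((1 : G) : G ⧸ H) ⁅Z, U⁆ V = -fundForm g ((1 : G) : G ⧸ H) U ⁅Z, V⁆ := by
  have h1 := derivAlong_fundForm (isSmoothAction_quotient hM) hg ((1 : G) : G ⧸ H) Z U V
  rw [hZ] at h1
  have h2 : derivAlong (fun y => fundForm g y U V) ((1 : G) : G ⧸ H) 0 = 0 :=
    map_zero (mfderiv 𝓘(ℝ, EM) 𝓘(ℝ, ℝ) (fun y => fundForm g y U V) ((1 : G) : G ⧸ H))
  linarith [h1.symm.trans h2]

end Coset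

/-! ### Automorphisms Ad a, invariance of the Killing form, Lie algebras of subgroups -/

section Group

set_option linter.unusedSectionVars false

variable {E : Type*} [NormedAddCommGroup E] [NormedSpace ℝ E] [FiniteDimensional ℝ E]
  {G : Type*} [TopologicalSpace G] [ChartedSpace E G] [Group G] [LieGroup 𝓘(ℝ, E) ∞ G]

lemma Ad_inv_apply' (a : G) (X : LieAlg E G) : Ad E a⁻¹ (Ad E a X) = X := by
  rw [← Ad_mul, inv_mul_cancel, Ad_one]

lemma Ad_lie (a : G) (X Y : LieAlg E G) : Ad E a ⁅X, Y⁆ = ⁅Ad E a X, Ad E a Y⁆ := by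
  have h : ContMDiff 𝓘(ℝ, E) 𝓘(ℝ, E) ∞ (MulAut.conj a).toMonoidHom :=
    (contMDiff_const.mul contMDiff_id).mul contMDiff_const
  exact homDeriv_lie (E := E) (E' := E) (MulAut.conj a).toMonoidHom h X Y

variable (E) in
/-- The adjoint action of `a` as an automorphism of the Lie algebra. -/
def AdEquiv (a : G) : LieAlg E G ≃ₗ⁅ℝ⁆ LieAlg E G where
  toFun := Ad E a
  map_add' := map_add _
  map_smul' := map_smul _
  map_lie' := Ad_lie a _ _
  invFun := Ad E a⁻¹
  left_inv := Ad_inv_apply' a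
  right_inv := Ad_inv_apply a

lemma killing_Ad (a : G) (X Y : LieAlg E G) :
    killing E G (Ad E a X) (Ad E a Y) = killing E G X Y :=
  LieAlgebra.killingForm_of_equiv_apply (AdEquiv E a) X Y

variable {K : Subgroup G} {EK : Type*} [NormedAddCommGroup EK] [NormedSpace ℝ EK]
  [FiniteDimensional ℝ EK] [ChartedSpace EK K] [LieGroup 𝓘(ℝ, EK) ∞ K]

lemma mem_subgroupLieAlg {X : LieAlg E G} :
    X ∈ subgroupLieAlg E EK K ↔ ∃ U : LieAlg EK K, homDeriv EK E K.subtype U = X := Iff.rfl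

lemma lie_mem_subgroupLieAlg
    (hK : ContMDiff 𝓘(ℝ, EK) 𝓘(ℝ, E) ∞ (fun k : K => (k : G))) {X Y : LieAlg E G}
    (hX : X ∈ subgroupLieAlg E EK K) (hY : Y ∈ subgroupLieAlg E EK K) :
    ⁅X, Y⁆ ∈ subgroupLieAlg E EK K := by
  obtain ⟨U, rfl⟩ := mem_subgroupLieAlg.1 hX
  obtain ⟨V, rfl⟩ := mem_subgroupLieAlg.1 hY
  exact ⟨⁅U, V⁆, homDeriv_lie K.subtype hK U V⟩

lemma Ad_homDeriv_subtype (hK : ContMDiff 𝓘(ℝ, EK) 𝓘(ℝ, E) ∞ (fun k : K => (k : G))) (k : K)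
    (U : LieAlg EK K) :
    Ad E (k : G) (homDeriv EK E K.subtype U) = homDeriv EK E K.subtype (Ad EK k U) := by
  have hd : ∀ x : K, MDifferentiableAt 𝓘(ℝ, EK) 𝓘(ℝ, E) (fun k : K => (k : G)) x :=
    hK.mdifferentiable (by simp)
  have hc : ∀ y : G, MDifferentiableAt 𝓘(ℝ, E) 𝓘(ℝ, E) (fun x : G => (k : G) * x * (k : G)⁻¹) y :=
    ((contMDiff_const.mul contMDiff_id).mul contMDiff_const).mdifferentiable (n := ∞) (by simp)
  have hc' : MDifferentiableAt 𝓘(ℝ, EK) 𝓘(ℝ, EK) (fun x : K => k * x * k⁻¹) 1 :=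
    ((contMDiff_const.mul contMDiff_id).mul contMDiff_const).mdifferentiable (n := ∞) (by simp) _
  have h1 := (hc _).hasMFDerivAt.comp (1 : K) (hd 1).hasMFDerivAt
  have h2 := (hd _).hasMFDerivAt.comp (1 : K) hc'.hasMFDerivAt
  have h3 := DFunLike.congr_fun (hasMFDerivAt_unique h1 h2) U
  have h4 := mfderiv_apply_congr (I := 𝓘(ℝ, EK)) (I' := 𝓘(ℝ, E)) (fun k : K => (k : G))
    (show k * 1 * k⁻¹ = 1 by simp) (Ad EK k U)
  exact h3.trans h4

lemma isAdSubmodule_subgroupLieAlg (hK : ContMDiff 𝓘(ℝ, EK) 𝓘(ℝ, E) ∞ (fun k : K => (k : G))) :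
    IsAdSubmodule E K (subgroupLieAlg E EK K) := by
  intro k hk X hX
  obtain ⟨U, rfl⟩ := mem_subgroupLieAlg.1 hX
  exact ⟨_, (Ad_homDeriv_subtype hK ⟨k, hk⟩ U).symm⟩

end Group

/-! ### The fibre K/L inside G/L -/

section Fibration

set_option linter.unusedSectionVars false

variable {E : Type*} [NormedAddCommGroup E] [NormedSpace ℝ E] [FiniteDimensional ℝ E]
  {G : Type*} [TopologicalSpace G] [ChartedSpace E G] [Group G] [LieGroup 𝓘(ℝ, E) ∞ G]
  {K L : Subgroup G}
  {EK : Type*} [NormedAddCommGroup EK] [NormedSpace ℝ EK] [FiniteDimensional ℝ EK]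
  [ChartedSpace EK K] [LieGroup 𝓘(ℝ, EK) ∞ K]
  {EM : Type*} [NormedAddCommGroup EM] [NormedSpace ℝ EM] [FiniteDimensional ℝ EM]
  [ChartedSpace EM (G ⧸ L)] [IsManifold 𝓘(ℝ, EM) ∞ (G ⧸ L)]
  {EN : Type*} [NormedAddCommGroup EN] [NormedSpace ℝ EN] [FiniteDimensional ℝ EN]
  [ChartedSpace EN (G ⧸ K)] [IsManifold 𝓘(ℝ, EN) ∞ (G ⧸ K)]
  {EF : Type*} [NormedAddCommGroup EF] [NormedSpace ℝ EF] [FiniteDimensional ℝ EF]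
  [ChartedSpace EF (K ⧸ L.subgroupOf K)] [IsManifold 𝓘(ℝ, EF) ∞ (K ⧸ L.subgroupOf K)]

lemma contMDiff_fiberInclusion
    (hK : ContMDiff 𝓘(ℝ, EK) 𝓘(ℝ, E) ∞ (fun k : K => (k : G)))
    (hM : Manifold.IsSubmersion 𝓘(ℝ, E) 𝓘(ℝ, EM) ∞ (fun a : G => (a : G ⧸ L)))
    (hF : Manifold.IsSubmersion 𝓘(ℝ, EK) 𝓘(ℝ, EF) ∞ (fun k : K => (k : K ⧸ L.subgroupOf K))) :
    ContMDiff 𝓘(ℝ, EF) 𝓘(ℝ, EM) ∞ (fiberInclusion K L) :=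
  contMDiff_of_comp_submersion hF Quotient.mk_surjective (hM.contMDiff.comp hK)

lemma mfderiv_fiberInclusion_fund
    (hK : ContMDiff 𝓘(ℝ, EK) 𝓘(ℝ, E) ∞ (fun k : K => (k : G)))
    (hM : Manifold.IsSubmersion 𝓘(ℝ, E) 𝓘(ℝ, EM) ∞ (fun a : G => (a : G ⧸ L)))
    (hF : Manifold.IsSubmersion 𝓘(ℝ, EK) 𝓘(ℝ, EF) ∞ (fun k : K => (k : K ⧸ L.subgroupOf K)))
    (U : LieAlg EK K) :
    (mfderiv 𝓘(ℝ, EF) 𝓘(ℝ, EM) (fiberInclusion K L) ((1 : K) : K ⧸ L.subgroupOf K)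
      (fund EF U ((1 : K) : K ⧸ L.subgroupOf K)) : EM) =
      fund EM (homDeriv EK E K.subtype U) ((1 : G) : G ⧸ L) := by
  have h1 : MDifferentiableAt 𝓘(ℝ, EF) 𝓘(ℝ, EM) (fiberInclusion K L)
      ((1 : K) : K ⧸ L.subgroupOf K) :=
    (contMDiff_fiberInclusion hK hM hF).mdifferentiable (by simp) _
  have h2 : MDifferentiableAt 𝓘(ℝ, EK) 𝓘(ℝ, EF) (fun k : K => (k : K ⧸ L.subgroupOf K)) 1 :=
    hF.contMDiff.mdifferentiable (by simp) _
  have h3 := h1.hasMFDerivAt.comp (1 : K) h2.hasMFDerivAt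
  have h4 : MDifferentiableAt 𝓘(ℝ, EK) 𝓘(ℝ, E) (fun k : K => (k : G)) 1 :=
    hK.mdifferentiable (by simp) _
  have h5 : MDifferentiableAt 𝓘(ℝ, E) 𝓘(ℝ, EM) (fun a : G => (a : G ⧸ L)) ((1 : K) : G) :=
    hM.contMDiff.mdifferentiable (by simp) _
  have h6 := DFunLike.congr_fun (hasMFDerivAt_unique h3
    (h5.hasMFDerivAt.comp (1 : K) h4.hasMFDerivAt)) U
  rw [fund_one_coset, fund_one_coset]
  exact h6

/-- Lets the Einstein equation of the fibre be written with the same form on 𝔤 as that of the total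
space. -/
lemma fundForm_pullback {gM : RiemannianMetric EM (G ⧸ L)}
    {gF : RiemannianMetric EF (K ⧸ L.subgroupOf K)}
    (hgF : IsPullbackMetric (fiberInclusion K L) gF gM)
    (hK : ContMDiff 𝓘(ℝ, EK) 𝓘(ℝ, E) ∞ (fun k : K => (k : G)))
    (hM : Manifold.IsSubmersion 𝓘(ℝ, E) 𝓘(ℝ, EM) ∞ (fun a : G => (a : G ⧸ L)))
    (hF : Manifold.IsSubmersion 𝓘(ℝ, EK) 𝓘(ℝ, EF) ∞ (fun k : K => (k : K ⧸ L.subgroupOf K)))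
    (U V : LieAlg EK K) :
    fundForm gF ((1 : K) : K ⧸ L.subgroupOf K) U V =
      fundForm gM ((1 : G) : G ⧸ L) (homDeriv EK E K.subtype U) (homDeriv EK E K.subtype V) := by
  have h1 := hgF ((1 : K) : K ⧸ L.subgroupOf K) (fund EF U _) (fund EF V _)
  have h2 := mfderiv_fiberInclusion_fund hK hM hF
  let gm : EM →L[ℝ] EM →L[ℝ] ℝ := gM.inner ((1 : G) : G ⧸ L)
  exact h1.trans (congrArg₂ (fun x y => gm x y) (h2 U) (h2 V))

/-- The inclusion K/L → G/L is K-equivariant, so invariance passes to the pullback. -/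
lemma isInvariantMetric_pullback {gM : RiemannianMetric EM (G ⧸ L)}
    {gF : RiemannianMetric EF (K ⧸ L.subgroupOf K)} (hgM : IsInvariantMetric G gM)
    (hgF : IsPullbackMetric (fiberInclusion K L) gF gM)
    (hK : ContMDiff 𝓘(ℝ, EK) 𝓘(ℝ, E) ∞ (fun k : K => (k : G)))
    (hM : Manifold.IsSubmersion 𝓘(ℝ, E) 𝓘(ℝ, EM) ∞ (fun a : G => (a : G ⧸ L)))
    (hF : Manifold.IsSubmersion 𝓘(ℝ, EK) 𝓘(ℝ, EF) ∞ (fun k : K => (k : K ⧸ L.subgroupOf K))) :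
    IsInvariantMetric K gF := by
  intro k x v w
  have hι : ∀ x, MDifferentiableAt 𝓘(ℝ, EF) 𝓘(ℝ, EM) (fiberInclusion K L) x :=
    (contMDiff_fiberInclusion hK hM hF).mdifferentiable (by simp)
  have h1 : MDifferentiableAt 𝓘(ℝ, EF) 𝓘(ℝ, EF) (fun y : K ⧸ L.subgroupOf K => k • y) x :=
    ((isSmoothAction_quotient hF).contMDiff_smul k).mdifferentiable (by simp) _
  have h2 : MDifferentiableAt 𝓘(ℝ, EM) 𝓘(ℝ, EM) (fun y : G ⧸ L => (k : G) • y)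
      (fiberInclusion K L x) :=
    ((isSmoothAction_quotient hM).contMDiff_smul (k : G)).mdifferentiable (by simp) _
  have heq : (fiberInclusion K L) ∘ (fun y : K ⧸ L.subgroupOf K => k • y) =
      (fun y : G ⧸ L => (k : G) • y) ∘ fiberInclusion K L := by
    funext y
    induction y using QuotientGroup.induction_on with
    | H a => rfl
  have h3 := (hι _).hasMFDerivAt.comp x h1.hasMFDerivAt
  rw [heq] at h3
  have h4 := hasMFDerivAt_unique h3 (h2.hasMFDerivAt.comp x (hι x).hasMFDerivAt)
  have h5 := fun u => DFunLike.congr_fun h4 u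
  have hbase : fiberInclusion K L (k • x) = (k : G) • fiberInclusion K L x := congrFun heq x
  rw [hgF (k • x), hgF x, ← hgM (k : G) (fiberInclusion K L x)]
  have h6 : ∀ y, y = (k : G) • fiberInclusion K L x → ∀ a b : EM,
      (gM.inner y : EM →L[ℝ] EM →L[ℝ] ℝ) a b =
        (gM.inner ((k : G) • fiberInclusion K L x) : EM →L[ℝ] EM →L[ℝ] ℝ) a b := by
    rintro _ rfl a b; rfl
  refine (h6 _ hbase _ _).trans ?_
  exact congrArg₂ (fun a b => (gM.inner ((k : G) • fiberInclusion K L x) :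
    EM →L[ℝ] EM →L[ℝ] ℝ) a b) (h5 v) (h5 w)

end Fibration

/-! ### Linear algebra: positive forms, eigenvectors and traces -/

section PositiveForms

open LinearMap (BilinForm)

variable {V : Type*} [AddCommGroup V] [Module ℝ V] [FiniteDimensional ℝ V]

lemma exists_equiv_dual (h : BilinForm ℝ V) (hpos : ∀ v, v ≠ 0 → 0 < h v v) :
    ∃ D : V ≃ₗ[ℝ] Module.Dual ℝ V, ∀ v w, D v w = h v w := by
  have hinj : Function.Injective h := by
    rw [injective_iff_map_eq_zero]
    intro v hv
    by_contra hne
    have := hpos v hne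
    rw [hv] at this
    exact lt_irrefl _ this
  exact ⟨LinearEquiv.ofInjectiveOfFinrankEq h hinj Subspace.dual_finrank_eq.symm, fun v w => rfl⟩

/-- Two symmetric forms, one of them positive definite, have a common eigenvector. -/
lemma exists_common_eigenvector [Nontrivial V] (b₁ b₂ : BilinForm ℝ V)
    (h₁ : ∀ v w, b₁ v w = b₁ w v) (hpos : ∀ v, v ≠ 0 → 0 < b₁ v v)
    (h₂ : ∀ v w, b₂ v w = b₂ w v) :
    ∃ (c : ℝ) (v : V), v ≠ 0 ∧ ∀ w, b₂ v w = c * b₁ v w := by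
  obtain ⟨D, hD⟩ := exists_equiv_dual b₁ hpos
  let core : InnerProductSpace.Core ℝ V :=
    { inner := fun v w => b₁ v w
      conj_inner_symm := fun v w => h₁ w v
      re_inner_nonneg := fun v => by
        by_cases hv : v = 0
        · simp [hv]
        · exact (hpos v hv).le
      add_left := fun u v w => by simp
      smul_left := fun u v c => by simp
      definite := fun v hv => by
        by_contra hne
        exact (hpos v hne).ne' hv }
  let _ : NormedAddCommGroup V := core.toNormedAddCommGroup
  let _ : InnerProductSpace ℝ V := InnerProductSpace.ofCore core.toCore
  -- The operator representing `b₂` through `b₁`; it is self-adjoint for the inner product `b₁`,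
  -- hence has a real eigenvector.
  let T : V →ₗ[ℝ] V := D.symm.toLinearMap ∘ₗ b₂
  have hT : ∀ v w, b₁ (T v) w = b₂ v w := fun v w => by
    rw [← hD]
    simp [T]
  have hsym : T.IsSymmetric := fun v w => by
    change b₁ (T v) w = b₁ v (T w)
    rw [h₁ v, hT, hT, h₂]
  have hn : 0 < Module.finrank ℝ V := Module.finrank_pos
  have hev := hsym.hasEigenvalue_eigenvalues rfl ⟨0, hn⟩
  obtain ⟨v, hv⟩ := hev.exists_hasEigenvector
  refine ⟨hsym.eigenvalues rfl ⟨0, hn⟩, v, hv.2, fun w => ?_⟩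
  rw [← hT, hv.apply_eq_smul, map_smul, LinearMap.smul_apply, smul_eq_mul]
  rfl

omit [FiniteDimensional ℝ V] in
/-- The trace of an endomorphism in terms of an orthogonal spanning family. -/
lemma trace_eq_sum_of_orthogonal (h : BilinForm ℝ V) {ι : Type*} [Fintype ι] (f : ι → V)
    (ho : ∀ i j, i ≠ j → h (f i) (f j) = 0) (hne : ∀ i, h (f i) (f i) ≠ 0)
    (hspan : ⊤ ≤ Submodule.span ℝ (Set.range f)) (A : V →ₗ[ℝ] V) :
    LinearMap.trace ℝ V A = ∑ i, h (A (f i)) (f i) / h (f i) (f i) := by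
  classical
  have hsum : ∀ (c : ι → ℝ) (j : ι), h (∑ i, c i • f i) (f j) = c j * h (f j) (f j) := by
    intro c j
    rw [map_sum, LinearMap.sum_apply, Finset.sum_eq_single j]
    · simp
    · intro i _ hij
      simp [ho i j hij]
    · simp
  have hli : LinearIndependent ℝ f := by
    rw [Fintype.linearIndependent_iff]
    intro c hc j
    have := hsum c j
    rw [hc, map_zero, LinearMap.zero_apply] at this
    exact (mul_eq_zero.1 this.symm).resolve_right (hne j)
  let b := Module.Basis.mk hli hspan
  have hb : ∀ i, b i = f i := fun i => Module.Basis.mk_apply hli hspan i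
  rw [LinearMap.trace_eq_matrix_trace ℝ b, Matrix.trace]
  refine Finset.sum_congr rfl fun i _ => ?_
  rw [Matrix.diag_apply, LinearMap.toMatrix_apply, eq_div_iff (hne i), hb]
  have h1 := b.sum_repr (A (f i))
  simp only [hb] at h1
  conv_rhs => rw [← h1]
  rw [hsum]

/-- The trace of an endomorphism over an invariant subspace, computed with a projection. -/
lemma trace_comp_proj_eq_sum (h : BilinForm ℝ V) {U : Submodule ℝ V} (π' : V →ₗ[ℝ] V)
    (hmem : ∀ x, π' x ∈ U) (hid : ∀ x ∈ U, π' x = x) (T : V →ₗ[ℝ] V) (hT : ∀ x ∈ U, T x ∈ U)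
    {ι : Type*} [Fintype ι] (e : Module.Basis ι ℝ U)
    (ho : ∀ i j, i ≠ j → h (e i) (e j) = 0) (hne : ∀ i, h (e i) (e i) ≠ 0) :
    LinearMap.trace ℝ V (T ∘ₗ π') =
      ∑ i, h (T (e i)) (e i) / h (e i) (e i) := by
  have hm : ∀ x, (T ∘ₗ π') x ∈ U := fun x => hT _ (hmem x)
  rw [← LinearMap.trace_restrict_eq_of_forall_mem U _ hm,
    trace_eq_sum_of_orthogonal (h.restrict U) e ho hne e.span_eq.ge]
  refine Finset.sum_congr rfl fun i _ => ?_
  have : (((T ∘ₗ π').restrict fun x _ => hm x) (e i) : V) = T (e i) := by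
    rw [LinearMap.restrict_apply]
    simp [hid _ (e i).2]
  change h (((T ∘ₗ π').restrict fun x _ => hm x) (e i) : V) (e i) / h (e i) (e i) = _
  rw [this]

lemma exists_orthogonal_basis_submodule (h : BilinForm ℝ V) (hs : ∀ v w, h v w = h w v)
    (U : Submodule ℝ V) :
    ∃ e : Module.Basis (Fin (Module.finrank ℝ U)) ℝ U,
      ∀ i j, i ≠ j → h (e i) (e j) = 0 := by
  have hs' : LinearMap.IsSymm (h.restrict U) := ⟨fun v w => hs v w⟩
  obtain ⟨e, he⟩ := LinearMap.BilinForm.exists_orthogonal_basis hs'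
  exact ⟨e, fun i j hij => he hij⟩

end PositiveForms

/-! ### Schur's lemma for invariant symmetric forms -/

section Schur

open LinearMap (BilinForm)

variable {V : Type*} [AddCommGroup V] [Module ℝ V] [FiniteDimensional ℝ V]
  {Γ : Type*} {ρ : Γ → V → V}

/-- An irreducible module and a module containing no copy of it are orthogonal for any invariant
symmetric form that is positive definite on the latter. -/
lemma form_eq_zero_of_not_equivalent (h : BilinForm ℝ V)
    (hinv : ∀ a v w, h (ρ a v) (ρ a w) = h v w)
    {U W : Submodule ℝ V} (hU : ∀ a, ∀ v ∈ U, ρ a v ∈ U) (hW : ∀ a, ∀ v ∈ W, ρ a v ∈ W)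
    (hW' : ∀ a, ∀ v ∈ W, ∃ w ∈ W, ρ a w = v)
    (hirr : ∀ U' : Submodule ℝ V, U' ≤ U → (∀ a, ∀ v ∈ U', ρ a v ∈ U') → U' = ⊥ ∨ U' = U)
    (hpos : ∀ w ∈ W, w ≠ 0 → 0 < h w w)
    (hne : ∀ W' : Submodule ℝ V, W' ≤ W → (∀ a, ∀ v ∈ W', ρ a v ∈ W') →
      ¬ ∃ f : U ≃ₗ[ℝ] W', ∀ a, ∀ v v' : U, (v' : V) = ρ a v → (f v' : V) = ρ a (f v))
    {v w : V} (hv : v ∈ U) (hw : w ∈ W) : h v w = 0 := by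
  obtain ⟨D, hD⟩ := exists_equiv_dual (h.restrict W) fun w hw => hpos w w.2 fun h0 =>
    hw (Subtype.ext h0)
  -- T represents h on U × W through the inner product of W and is equivariant. Its kernel is 0 or U
  -- by irreducibility; if it were 0, the image would be a copy of U inside W.
  let T : U →ₗ[ℝ] W := D.symm.toLinearMap ∘ₗ W.subtype.dualMap ∘ₗ h ∘ₗ U.subtype
  have hT : ∀ (v : U) (w : W), h (T v) w = h v w := fun v w => by
    refine (hD (T v) w).symm.trans ?_
    simp [T]
  have heq : ∀ a, ∀ v v' : U, (v' : V) = ρ a v → (T v' : V) = ρ a (T v) := by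
    intro a v v' hv'
    have hm : ρ a (T v) ∈ W := hW a _ (T v).2
    set d : W := T v' - ⟨_, hm⟩ with hd
    have h0 : ∀ w : W, h d w = 0 := by
      intro w
      obtain ⟨w₀, hw₀, hw₀'⟩ := hW' a w w.2
      have e1 : h (T v') w = h v w₀ := by rw [hT, hv', ← hw₀', hinv]
      have e2 : h (ρ a (T v)) w = h v w₀ := by
        rw [← hw₀', hinv]
        exact hT v ⟨w₀, hw₀⟩
      have e3 : (d : V) = T v' - ρ a (T v) := by simp [hd]
      rw [e3, map_sub, LinearMap.sub_apply, e1, e2, sub_self]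
    have hd0 : (d : V) = 0 := by
      by_contra hne
      exact (hpos d d.2 hne).ne' (h0 d)
    have e3 : (d : V) = T v' - ρ a (T v) := by simp [hd]
    rw [e3] at hd0
    exact sub_eq_zero.1 hd0
  let N : Submodule ℝ V := (LinearMap.ker T).map U.subtype
  have hNmem : ∀ x, x ∈ N ↔ x ∈ U ∧ ∀ w ∈ W, h x w = 0 := by
    intro x
    constructor
    · rintro ⟨y, hy, rfl⟩
      refine ⟨y.2, fun w hw => ?_⟩
      have := hT y ⟨w, hw⟩
      rw [LinearMap.mem_ker.1 hy] at this
      simpa using this.symm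
    · rintro ⟨hx, hx'⟩
      refine ⟨⟨x, hx⟩, ?_, rfl⟩
      rw [SetLike.mem_coe, LinearMap.mem_ker]
      by_contra hne
      have h1 := hpos (T ⟨x, hx⟩) (T ⟨x, hx⟩).2 fun h0 => hne (Subtype.ext h0)
      rw [hT] at h1
      exact h1.ne' (hx' _ (T ⟨x, hx⟩).2)
  have hN : N = ⊥ ∨ N = U := by
    refine hirr N (fun x hx => ((hNmem x).1 hx).1) fun a x hx => ?_
    obtain ⟨hxU, hx'⟩ := (hNmem x).1 hx
    refine (hNmem _).2 ⟨hU a x hxU, fun w hw => ?_⟩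
    obtain ⟨w₀, hw₀, rfl⟩ := hW' a w hw
    rw [hinv]
    exact hx' _ hw₀
  rcases hN with hN | hN
  · exfalso
    have hinj : Function.Injective (W.subtype ∘ₗ T) := by
      rw [LinearMap.coe_comp]
      refine W.injective_subtype.comp (LinearMap.ker_eq_bot.1 ?_)
      exact Submodule.map_injective_of_injective U.injective_subtype (hN.trans (Submodule.map_bot _).symm)
    refine hne (LinearMap.range (W.subtype ∘ₗ T)) ?_ ?_ ⟨LinearEquiv.ofInjective _ hinj, ?_⟩
    · rintro _ ⟨x, rfl⟩
      exact (T x).2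
    · rintro a _ ⟨x, rfl⟩
      exact ⟨⟨_, hU a x x.2⟩, heq a x _ rfl⟩
    · intro a v v' hv'
      exact heq a v v' hv'
  · exact ((hNmem v).1 (hN ▸ hv)).2 w hw

/-- On an irreducible module, an invariant symmetric form is a multiple of an invariant inner
product. -/
lemma exists_eq_mul_of_irreducible (b₁ b₂ : BilinForm ℝ V) {U : Submodule ℝ V}
    (h₁ : ∀ v ∈ U, ∀ w ∈ U, b₁ v w = b₁ w v) (h₂ : ∀ v ∈ U, ∀ w ∈ U, b₂ v w = b₂ w v)
    (hinv₁ : ∀ a, ∀ v ∈ U, ∀ w ∈ U, b₁ (ρ a v) (ρ a w) = b₁ v w)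
    (hinv₂ : ∀ a, ∀ v ∈ U, ∀ w ∈ U, b₂ (ρ a v) (ρ a w) = b₂ v w)
    (hU : ∀ a, ∀ v ∈ U, ρ a v ∈ U)
    (hU' : ∀ a, ∀ v ∈ U, ∃ w ∈ U, ρ a w = v) (hbot : U ≠ ⊥)
    (hirr : ∀ U' : Submodule ℝ V, U' ≤ U → (∀ a, ∀ v ∈ U', ρ a v ∈ U') → U' = ⊥ ∨ U' = U)
    (hpos : ∀ w ∈ U, w ≠ 0 → 0 < b₁ w w) :
    ∃ c : ℝ, ∀ v ∈ U, ∀ w ∈ U, b₂ v w = c * b₁ v w := by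
  have : Nontrivial U := Submodule.nontrivial_iff_ne_bot.2 hbot
  obtain ⟨c, v, hv, hcv⟩ := exists_common_eigenvector (b₁.restrict U) (b₂.restrict U)
    (fun v w => h₁ v v.2 w w.2) (fun v hv => hpos v v.2 fun h0 => hv (Subtype.ext h0))
    (fun v w => h₂ v v.2 w w.2)
  -- The eigenspace of b₂ relative to b₁ in U for the real eigenvalue c: invariant and nonzero,
  -- hence all of U. Symmetry of the forms is what makes Schur work over ℝ.
  let N : Submodule ℝ V :=
    { carrier := {x | x ∈ U ∧ ∀ w ∈ U, b₂ x w = c * b₁ x w}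
      add_mem' := fun {x y} hx hy => ⟨U.add_mem hx.1 hy.1, fun w hw => by
        rw [map_add, map_add, LinearMap.add_apply, LinearMap.add_apply, hx.2 w hw, hy.2 w hw,
          mul_add]⟩
      zero_mem' := ⟨U.zero_mem, fun w _ => by simp⟩
      smul_mem' := fun a x hx => ⟨U.smul_mem a hx.1, fun w hw => by
        simp only [map_smul, LinearMap.smul_apply, smul_eq_mul, hx.2 w hw]
        ring⟩ }
  have hN : N = ⊥ ∨ N = U := by
    refine hirr N (fun x hx => hx.1) fun a x hx => ⟨hU a x hx.1, fun w hw => ?_⟩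
    obtain ⟨w₀, hw₀, rfl⟩ := hU' a w hw
    rw [hinv₁ a x hx.1 w₀ hw₀, hinv₂ a x hx.1 w₀ hw₀]
    exact hx.2 w₀ hw₀
  rcases hN with hN | hN
  · exfalso
    have h1 : (v : V) ∈ N := ⟨v.2, fun w hw => hcv ⟨w, hw⟩⟩
    rw [hN, Submodule.mem_bot] at h1
    exact hv (Subtype.ext h1)
  · refine ⟨c, fun x hx w hw => ?_⟩
    rw [← hN] at hx
    exact hx.2 w hw

end Schur

/-! ### The algebra of 𝔤 = 𝔩 ⊕ 𝔭 ⊕ 𝔫 and the two Einstein equations -/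

section SplitForm

open LinearMap (BilinForm)

variable {𝔤 : Type*} [LieRing 𝔤] [LieAlgebra ℝ 𝔤]

lemma killingForm_lie (x y z : 𝔤) :
    killingForm ℝ 𝔤 ⁅x, y⁆ z = killingForm ℝ 𝔤 x ⁅y, z⁆ :=
  LieModule.traceForm_apply_lie_apply ℝ 𝔤 𝔤 x y z

lemma killingForm_lie' (x y z : 𝔤) :
    killingForm ℝ 𝔤 ⁅x, y⁆ z = -killingForm ℝ 𝔤 y ⁅x, z⁆ := by
  rw [← lie_skew, map_neg, LinearMap.neg_apply, killingForm_lie]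

lemma killingForm_symm (x y : 𝔤) : killingForm ℝ 𝔤 x y = killingForm ℝ 𝔤 y x :=
  LieModule.traceForm_comm ℝ 𝔤 𝔤 x y

/-- The algebraic data of an invariant metric `q` on `G/L` for a tower `L ⊆ K ⊆ G` with
`𝔨 = 𝔩 ⊕ 𝔭` symmetric and `𝔤 = 𝔩 ⊕ 𝔭 ⊕ 𝔫`. -/
structure IsFibrationForm (𝔩 𝔭 𝔫 : Submodule ℝ 𝔤) (q : BilinForm ℝ 𝔤) : Prop where
  symm : ∀ x y, q x y = q y x
  null : ∀ z ∈ 𝔩, ∀ x, q z x = 0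
  ad : ∀ z ∈ 𝔩, ∀ x y, q ⁅z, x⁆ y = -q x ⁅z, y⁆
  lie_lp : ∀ z ∈ 𝔩, ∀ x ∈ 𝔭, ⁅z, x⁆ ∈ 𝔭
  lie_pp : ∀ x ∈ 𝔭, ∀ y ∈ 𝔭, ⁅x, y⁆ ∈ 𝔩
  lie_ln : ∀ z ∈ 𝔩, ∀ x ∈ 𝔫, ⁅z, x⁆ ∈ 𝔫
  lie_pn : ∀ x ∈ 𝔭, ∀ y ∈ 𝔫, ⁅x, y⁆ ∈ 𝔫
  decomp : ∀ x, ∃ l ∈ 𝔩, ∃ p ∈ 𝔭, ∃ n ∈ 𝔫, l + p + n = x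
  orth : ∀ x ∈ 𝔭, ∀ y ∈ 𝔫, q x y = 0
  pos_p : ∀ x ∈ 𝔭, x ≠ 0 → 0 < q x x
  pos_n : ∀ x ∈ 𝔫, x ≠ 0 → 0 < q x x

variable {𝔩 𝔭 𝔫 : Submodule ℝ 𝔤} {q : BilinForm ℝ 𝔤}

namespace IsFibrationForm

lemma null' (h : IsFibrationForm 𝔩 𝔭 𝔫 q) {z : 𝔤} (hz : z ∈ 𝔩) (x : 𝔤) : q x z = 0 := by
  rw [h.symm]; exact h.null z hz x

/-- This is ∇_X e = 0 at the base coset for X, e ∈ 𝔭. Since [𝔭, 𝔭] ⊆ 𝔩 is null and [𝔭, 𝔫] ⊆ 𝔫 is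
orthogonal to 𝔭, only the 𝔩-part of Z contributes, and its two terms cancel by skewness of ad 𝔩. -/
lemma koszul_eq_zero (h : IsFibrationForm 𝔩 𝔭 𝔫 q) {X e : 𝔤} (hX : X ∈ 𝔭) (he : e ∈ 𝔭)
    (Z : 𝔤) : q ⁅X, e⁆ Z + q e ⁅X, Z⁆ + q X ⁅e, Z⁆ = 0 := by
  have h0 : q ⁅X, e⁆ Z = 0 := h.null _ (h.lie_pp X hX e he) _
  obtain ⟨l, hl, p, hp, n, hn, rfl⟩ := h.decomp Z
  have h1 : ∀ x ∈ 𝔭, ∀ y ∈ 𝔭, q x ⁅y, p⁆ = 0 := fun x _ y hy =>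
    h.null' (h.lie_pp y hy p hp) x
  have h2 : ∀ x ∈ 𝔭, ∀ y ∈ 𝔭, q x ⁅y, n⁆ = 0 := fun x hx y hy =>
    h.orth x hx _ (h.lie_pn y hy n hn)
  have h3 : q e ⁅X, l⁆ = q ⁅l, e⁆ X := by
    rw [h.ad l hl, ← lie_skew, map_neg]
  have h4 : q X ⁅e, l⁆ = -q ⁅l, e⁆ X := by
    rw [← lie_skew, map_neg, h.symm]
  rw [h0, lie_add, lie_add, lie_add, lie_add, map_add, map_add, map_add, map_add, h1 e he X hX,
    h1 X hX e he, h2 e he X hX, h2 X hX e he, h3, h4]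
  ring

/-- [X, e] lies in 𝔩, which is null for q and acts by skew maps. -/
lemma curvature_fiber (h : IsFibrationForm 𝔩 𝔭 𝔫 q) {X e : 𝔤} (hX : X ∈ 𝔭) (he : e ∈ 𝔭) :
    -(1 / 2) * q ⁅X, e⁆ ⁅X, e⁆ + 1 / 2 * q X ⁅e, ⁅X, e⁆⁆ - 1 / 2 * q ⁅X, ⁅X, e⁆⁆ e =
      -q ⁅X, ⁅X, e⁆⁆ e := by
  have hz := h.lie_pp X hX e he
  have h1 : q X ⁅e, ⁅X, e⁆⁆ = -q ⁅X, ⁅X, e⁆⁆ e := by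
    rw [← lie_skew e, map_neg, ← neg_neg (q X _), ← h.ad _ hz, ← lie_skew X ⁅X, e⁆, map_neg,
      LinearMap.neg_apply]
  rw [h.null _ hz, h1]
  ring

section Base

variable {lam β : ℝ} {X : 𝔤}

lemma geodesic (hXq : ∀ y, q X y = -lam * killingForm ℝ 𝔤 X y) (Z : 𝔤) : q X ⁅X, Z⁆ = 0 := by
  rw [hXq, ← killingForm_lie, lie_self, map_zero, LinearMap.zero_apply, mul_zero]

/-- On 𝔫 the form is a multiple of Φ, for which ad X is skew. -/
lemma lie_skew_base (h : IsFibrationForm 𝔩 𝔭 𝔫 q) (hβ : β ≠ 0)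
    (hn : ∀ x ∈ 𝔫, ∀ y ∈ 𝔫, killingForm ℝ 𝔤 x y = -β * q x y) (hX : X ∈ 𝔭) {e f : 𝔤}
    (he : e ∈ 𝔫) (hf : f ∈ 𝔫) : q ⁅X, e⁆ f = -q e ⁅X, f⁆ := by
  have h1 := killingForm_lie' X e f
  rw [hn _ (h.lie_pn X hX e he) f hf, hn e he _ (h.lie_pn X hX f hf)] at h1
  refine mul_left_cancel₀ hβ ?_
  linarith

lemma form_lie_base (h : IsFibrationForm 𝔩 𝔭 𝔫 q)
    (hn : ∀ x ∈ 𝔫, ∀ y ∈ 𝔫, killingForm ℝ 𝔤 x y = -β * q x y) (hX : X ∈ 𝔭)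
    (hXq : ∀ y, q X y = -lam * killingForm ℝ 𝔤 X y) {e f : 𝔤} (he : e ∈ 𝔫) (hf : f ∈ 𝔫) :
    q X ⁅e, f⁆ = lam * β * q ⁅X, e⁆ f := by
  rw [hXq, ← killingForm_lie, hn _ (h.lie_pn X hX e he) f hf]
  ring

/-- Identifies ∇_X e as -(λβ/2)[X, e] for e ∈ 𝔫. The first two terms cancel by skewness of ad X on
𝔫; in the third, q(X, ·) = -λΦ(X, ·) lets invariance of Φ move the bracket onto X and e. -/
lemma koszul_base (h : IsFibrationForm 𝔩 𝔭 𝔫 q) (hβ : β ≠ 0)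
    (hn : ∀ x ∈ 𝔫, ∀ y ∈ 𝔫, killingForm ℝ 𝔤 x y = -β * q x y) (hX : X ∈ 𝔭)
    (hXq : ∀ y, q X y = -lam * killingForm ℝ 𝔤 X y) {e : 𝔤} (he : e ∈ 𝔫) (Z : 𝔤) :
    q ⁅X, e⁆ Z + q e ⁅X, Z⁆ + q X ⁅e, Z⁆ = lam * β * q ⁅X, e⁆ Z := by
  have hXe := h.lie_pn X hX e he
  obtain ⟨l, hl, p, hp, n, hn', rfl⟩ := h.decomp Z
  have a1 : q ⁅X, e⁆ l = 0 := h.null' hl _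
  have a2 : q ⁅X, e⁆ p = 0 := by rw [h.symm]; exact h.orth p hp _ hXe
  have b1 : q e ⁅X, l⁆ = 0 := by
    rw [← lie_skew, map_neg, h.symm, h.orth _ (h.lie_lp l hl X hX) e he, neg_zero]
  have b2 : q e ⁅X, p⁆ = 0 := h.null' (h.lie_pp X hX p hp) e
  have c1 : q X ⁅e, l⁆ = 0 := by
    rw [← lie_skew, map_neg, h.orth X hX _ (h.lie_ln l hl e he), neg_zero]
  have c2 : q X ⁅e, p⁆ = 0 := by
    rw [← lie_skew, map_neg, h.orth X hX _ (h.lie_pn p hp e he), neg_zero]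
  have d1 := h.lie_skew_base hβ hn hX he hn'
  have d2 := h.form_lie_base hn hX hXq he hn'
  simp only [lie_add, map_add, a1, a2, b1, b2, c1, c2, d2]
  rw [d1]
  ring

lemma curvature_base (h : IsFibrationForm 𝔩 𝔭 𝔫 q) (hβ : β ≠ 0)
    (hn : ∀ x ∈ 𝔫, ∀ y ∈ 𝔫, killingForm ℝ 𝔤 x y = -β * q x y) (hX : X ∈ 𝔭)
    (hXq : ∀ y, q X y = -lam * killingForm ℝ 𝔤 X y) {e : 𝔤} (he : e ∈ 𝔫) :
    -(1 / 2) * q ⁅X, e⁆ ⁅X, e⁆ + 1 / 2 * q X ⁅e, ⁅X, e⁆⁆ - 1 / 2 * q ⁅X, ⁅X, e⁆⁆ e =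
      1 / 2 * (lam * β) * q ⁅X, e⁆ ⁅X, e⁆ := by
  have hXe := h.lie_pn X hX e he
  rw [h.form_lie_base hn hX hXq he hXe, h.lie_skew_base hβ hn hX hXe he]
  ring

end Base

end IsFibrationForm

/-- The Ricci curvature, in the direction of geodesic vectors, of an invariant Einstein metric on a
homogeneous space with tangent space `V`, expressed through the form `q` on the Lie algebra. -/
def IsEinsteinForm (V : Type*) [AddCommGroup V] [Module ℝ V] (q : BilinForm ℝ 𝔤) (c : ℝ) : Prop :=
  ∃ (g : BilinForm ℝ V) (P : 𝔤 →ₗ[ℝ] V), (∀ v w, g v w = g w v) ∧ (∀ v, v ≠ 0 → 0 < g v v) ∧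
    Function.Surjective P ∧ (∀ x y, q x y = g (P x) (P y)) ∧
    ∀ X : 𝔤, (∀ Z, q X ⁅X, Z⁆ = 0) →
      ∃ A : V →ₗ[ℝ] V, LinearMap.trace ℝ V A = c * q X X ∧
        ∀ e : 𝔤, ∃ w : V,
          (∀ Z, 2 * g w (P Z) = -(q ⁅X, e⁆ Z + q e ⁅X, Z⁆ + q X ⁅e, Z⁆)) ∧
          g (A (P e)) (P e) =
            -(1 / 2) * q ⁅X, e⁆ ⁅X, e⁆ + 1 / 2 * q X ⁅e, ⁅X, e⁆⁆ - 1 / 2 * q ⁅X, ⁅X, e⁆⁆ e +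
              g (w + P ⁅X, e⁆) w

variable {V : Type*} [AddCommGroup V] [Module ℝ V]

lemma eq_of_form_eq {g : BilinForm ℝ V} (hpos : ∀ v, v ≠ 0 → 0 < g v v) {P : 𝔤 →ₗ[ℝ] V}
    (hP : Function.Surjective P) {v w : V} (h : ∀ Z, g v (P Z) = g w (P Z)) : v = w := by
  by_contra hne
  obtain ⟨Z, hZ⟩ := hP (v - w)
  have h1 := hpos (v - w) (sub_ne_zero.2 hne)
  rw [map_sub g, LinearMap.sub_apply, ← hZ, h, sub_self] at h1
  exact lt_irrefl _ h1

/-- The Einstein equation of the total space in the direction of `X ∈ 𝔭ₐ`. -/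
lemma ricci_total [FiniteDimensional ℝ V] (h : IsFibrationForm 𝔩 𝔭 𝔫 q) {c lam β : ℝ}
    (hE : IsEinsteinForm V q c) (hβ : β ≠ 0)
    (hn : ∀ x ∈ 𝔫, ∀ y ∈ 𝔫, killingForm ℝ 𝔤 x y = -β * q x y) {X : 𝔤} (hX : X ∈ 𝔭)
    (hXq : ∀ y, q X y = -lam * killingForm ℝ 𝔤 X y)
    {ι κ : Type*} [Fintype ι] [Fintype κ] (bp : Module.Basis ι ℝ 𝔭) (bn : Module.Basis κ ℝ 𝔫)
    (hbp : ∀ i j, i ≠ j → q (bp i) (bp j) = 0) (hbn : ∀ i j, i ≠ j → q (bn i) (bn j) = 0) :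
    c * q X X = -(∑ i, q ⁅X, ⁅X, (bp i : 𝔤)⁆⁆ (bp i) / q (bp i) (bp i)) -
      (lam * β) ^ 2 / 4 * ∑ i, q ⁅X, ⁅X, (bn i : 𝔤)⁆⁆ (bn i) / q (bn i) (bn i) := by
  obtain ⟨g, P, hgs, hgp, hP, hq, hR⟩ := hE
  obtain ⟨A, hA, hK⟩ := hR X (IsFibrationForm.geodesic hXq)
  have hp0 : ∀ i, q (bp i) (bp i) ≠ 0 := fun i =>
    (h.pos_p _ (bp i).2 fun h0 => bp.ne_zero i (Subtype.ext h0)).ne'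
  have hn0 : ∀ i, q (bn i) (bn i) ≠ 0 := fun i =>
    (h.pos_n _ (bn i).2 fun h0 => bn.ne_zero i (Subtype.ext h0)).ne'
  -- The q-orthogonal bases of 𝔭 and 𝔫 project to an orthogonal basis of the tangent space, since 𝔩
  -- maps to 0.
  let f : ι ⊕ κ → V := Sum.elim (fun i => P (bp i)) (fun i => P (bn i))
  have htr := trace_eq_sum_of_orthogonal g f
    (by
      rintro (i | i) (j | j) hij
      · exact (hq _ _).symm.trans (hbp i j fun h0 => hij (by rw [h0]))
      · exact (hq _ _).symm.trans (h.orth _ (bp i).2 _ (bn j).2)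
      · exact (hq _ _).symm.trans ((h.symm _ _).trans (h.orth _ (bp j).2 _ (bn i).2))
      · exact (hq _ _).symm.trans (hbn i j fun h0 => hij (by rw [h0])))
    (by
      rintro (i | i)
      · exact fun h0 => hp0 i ((hq _ _).trans h0)
      · exact fun h0 => hn0 i ((hq _ _).trans h0))
    (by
      rintro v -
      obtain ⟨x, rfl⟩ := hP v
      obtain ⟨l, hl, p, hp, n, hn', rfl⟩ := h.decomp x
      have hl0 : P l = 0 := by
        by_contra hne
        have := hgp _ hne
        rw [← hq, h.null l hl] at this
        exact lt_irrefl _ this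
      rw [map_add, map_add, hl0, zero_add]
      refine Submodule.add_mem _ ?_ ?_
      · have h1 := congrArg (fun z : 𝔭 => P z) (bp.sum_repr ⟨p, hp⟩)
        simp only [Submodule.coe_sum, Submodule.coe_smul, map_sum, map_smul] at h1
        rw [← h1]
        exact Submodule.sum_mem _ fun i _ => Submodule.smul_mem _ _
          (Submodule.subset_span ⟨Sum.inl i, rfl⟩)
      · have h1 := congrArg (fun z : 𝔫 => P z) (bn.sum_repr ⟨n, hn'⟩)
        simp only [Submodule.coe_sum, Submodule.coe_smul, map_sum, map_smul] at h1
        rw [← h1]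
        exact Submodule.sum_mem _ fun i _ => Submodule.smul_mem _ _
          (Submodule.subset_span ⟨Sum.inr i, rfl⟩))
    A
  have hKp : ∀ e ∈ 𝔭, g (A (P e)) (P e) = -q ⁅X, ⁅X, e⁆⁆ e := by
    intro e he
    obtain ⟨w, hw, hw'⟩ := hK e
    have hw0 : w = 0 := by
      refine eq_of_form_eq hgp hP fun Z => ?_
      have := hw Z
      rw [h.koszul_eq_zero hX he] at this
      rw [map_zero, LinearMap.zero_apply]
      linarith
    rw [hw', h.curvature_fiber hX he, hw0, map_zero, add_zero]
  have hKn : ∀ e ∈ 𝔫, g (A (P e)) (P e) = -((lam * β) ^ 2 / 4 * q ⁅X, ⁅X, e⁆⁆ e) := by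
    intro e he
    obtain ⟨w, hw, hw'⟩ := hK e
    have hw0 : w = (-(lam * β) / 2) • P ⁅X, e⁆ := by
      refine eq_of_form_eq hgp hP fun Z => ?_
      have := hw Z
      rw [h.koszul_base hβ hn hX hXq he] at this
      rw [map_smul, LinearMap.smul_apply, smul_eq_mul, ← hq]
      linarith
    -- With t = λβ, the coefficient t/2 from `curvature_base` and (1 - t/2)(-t/2) from the covariant
    -- derivative add up to t²/4; skewness turns q([X, e], [X, e]) into -q([X, [X, e]], e).
    have h2 := h.lie_skew_base hβ hn hX (h.lie_pn X hX e he) he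
    rw [hw', h.curvature_base hβ hn hX hXq he, hw0, h2]
    simp only [map_add, map_smul, LinearMap.add_apply, LinearMap.smul_apply, smul_eq_mul, ← hq]
    ring
  rw [← hA, htr, Fintype.sum_sum_type, ← Finset.sum_neg_distrib, sub_eq_add_neg, Finset.mul_sum,
    ← Finset.sum_neg_distrib]
  congr 1
  · refine Finset.sum_congr rfl fun i _ => ?_
    change g (A (P (bp i))) (P (bp i)) / g (P (bp i)) (P (bp i)) = _
    rw [hKp _ (bp i).2, ← hq, neg_div]
  · refine Finset.sum_congr rfl fun i _ => ?_
    change g (A (P (bn i))) (P (bn i)) / g (P (bn i)) (P (bn i)) = _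
    rw [hKn _ (bn i).2, ← hq, neg_div, mul_div_assoc]

/-- The Einstein equation of the fibre in the direction of `X ∈ 𝔭ₐ`. -/
lemma ricci_fiber [FiniteDimensional ℝ V] (h : IsFibrationForm 𝔩 𝔭 𝔫 q) {c lam : ℝ}
    {𝔥 : Type*} [LieRing 𝔥] [LieAlgebra ℝ 𝔥] (φ : 𝔥 →ₗ[ℝ] 𝔤) (hφ : ∀ x y, φ ⁅x, y⁆ = ⁅φ x, φ y⁆)
    (hφp : ∀ x ∈ 𝔭, ∃ u, φ u = x) (hφr : ∀ u, ∃ l ∈ 𝔩, ∃ p ∈ 𝔭, l + p = φ u)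
    {qF : BilinForm ℝ 𝔥} (hqF : ∀ u v, qF u v = q (φ u) (φ v))
    (hE : IsEinsteinForm V qF c) {X : 𝔤} (hX : X ∈ 𝔭)
    (hXq : ∀ y, q X y = -lam * killingForm ℝ 𝔤 X y)
    {ι : Type*} [Fintype ι] (bp : Module.Basis ι ℝ 𝔭)
    (hbp : ∀ i j, i ≠ j → q (bp i) (bp j) = 0) :
    c * q X X = -(∑ i, q ⁅X, ⁅X, (bp i : 𝔤)⁆⁆ (bp i) / q (bp i) (bp i)) := by
  obtain ⟨g, P, hgs, hgp, hP, hq, hR⟩ := hE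
  obtain ⟨U, rfl⟩ := hφp X hX
  -- The basis of 𝔭 is lifted to 𝔥; different lifts differ by elements null for `qF`, so the choice
  -- is harmless.
  choose b hb using fun i => hφp (bp i) (bp i).2
  obtain ⟨A, hA, hK⟩ := hR U fun Z => by
    rw [hqF, hφ]; exact IsFibrationForm.geodesic hXq _
  have hq' : ∀ u v, g (P u) (P v) = q (φ u) (φ v) := fun u v => (hq u v).symm.trans (hqF u v)
  have hp0 : ∀ i, q (bp i) (bp i) ≠ 0 := fun i =>
    (h.pos_p _ (bp i).2 fun h0 => bp.ne_zero i (Subtype.ext h0)).ne'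
  have hker : ∀ u, φ u ∈ 𝔩 → P u = 0 := by
    intro u hu
    by_contra hne
    have := hgp _ hne
    rw [hq', h.null _ hu] at this
    exact lt_irrefl _ this
  have htr := trace_eq_sum_of_orthogonal g (fun i => P (b i))
    (fun i j hij => by rw [hq', hb, hb]; exact hbp i j hij)
    (fun i => by rw [hq', hb]; exact hp0 i)
    (by
      rintro v -
      obtain ⟨x, rfl⟩ := hP v
      obtain ⟨l, hl, p, hp, hlp⟩ := hφr x
      have h1 := congrArg (fun z : 𝔭 => (z : 𝔤)) (bp.sum_repr ⟨p, hp⟩)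
      simp only [Submodule.coe_sum, Submodule.coe_smul] at h1
      have h2 : P (x - ∑ i, bp.repr ⟨p, hp⟩ i • b i) = 0 := by
        refine hker _ ?_
        rw [map_sub, map_sum]
        simp only [map_smul, hb]
        rw [h1, ← hlp]
        simpa using hl
      rw [map_sub, map_sum, sub_eq_zero] at h2
      rw [h2]
      simp only [map_smul]
      exact Submodule.sum_mem _ fun i _ => Submodule.smul_mem _ _ (Submodule.subset_span ⟨i, rfl⟩))
    A
  rw [← hqF U U, ← hA, htr, ← Finset.sum_neg_distrib]
  refine Finset.sum_congr rfl fun i _ => ?_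
  have he : φ (b i) ∈ 𝔭 := by rw [hb]; exact (bp i).2
  obtain ⟨w, hw, hw'⟩ := hK (b i)
  simp only [hqF, hφ] at hw hw'
  have hw0 : w = 0 := by
    refine eq_of_form_eq hgp hP fun Z => ?_
    have := hw Z
    rw [h.koszul_eq_zero hX he] at this
    rw [map_zero, LinearMap.zero_apply]
    linarith
  rw [hw', h.curvature_fiber hX he, hw0, map_zero, add_zero, hq', hb, neg_div]

end SplitForm

/-! ### Traces of (ad X)² over 𝔭 and 𝔫 -/

section Traces

open LinearMap (BilinForm)

variable {V : Type*} [AddCommGroup V] [Module ℝ V]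

lemma exists_projections {𝔩 𝔭 𝔫 : Submodule ℝ V}
    (hdec : ∀ x, ∃ l ∈ 𝔩, ∃ p ∈ 𝔭, ∃ n ∈ 𝔫, l + p + n = x)
    (hind : ∀ l ∈ 𝔩, ∀ p ∈ 𝔭, ∀ n ∈ 𝔫, l + p + n = 0 → l = 0 ∧ p = 0 ∧ n = 0) :
    ∃ πl πp πn : V →ₗ[ℝ] V, (∀ x, πl x ∈ 𝔩) ∧ (∀ x, πp x ∈ 𝔭) ∧ (∀ x, πn x ∈ 𝔫) ∧
      πl + πp + πn = 1 ∧ (∀ l ∈ 𝔩, ∀ p ∈ 𝔭, ∀ n ∈ 𝔫, πl (l + p + n) = l ∧ πp (l + p + n) = p ∧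
        πn (l + p + n) = n) := by
  let f : (𝔩 × 𝔭 × 𝔫) →ₗ[ℝ] V := 𝔩.subtype.coprod (𝔭.subtype.coprod 𝔫.subtype)
  have hf : ∀ y, f y = y.1 + y.2.1 + y.2.2 := fun y => by simp [f, add_assoc]
  have hb : Function.Bijective f := by
    constructor
    · rw [injective_iff_map_eq_zero]
      rintro ⟨l, p, n⟩ h0
      rw [hf] at h0
      obtain ⟨h1, h2, h3⟩ := hind l l.2 p p.2 n n.2 h0
      simp only [Submodule.coe_eq_zero] at h1 h2 h3
      rw [h1, h2, h3]; rfl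
    · intro x
      obtain ⟨l, hl, p, hp, n, hn, rfl⟩ := hdec x
      exact ⟨⟨⟨l, hl⟩, ⟨p, hp⟩, ⟨n, hn⟩⟩, hf _⟩
  let F := LinearEquiv.ofBijective f hb
  have hF : ∀ x, ((F.symm x).1 : V) + (F.symm x).2.1 + (F.symm x).2.2 = x := fun x => by
    rw [← hf]; exact F.apply_symm_apply x
  refine ⟨𝔩.subtype ∘ₗ LinearMap.fst ℝ _ _ ∘ₗ F.symm.toLinearMap,
    𝔭.subtype ∘ₗ LinearMap.fst ℝ _ _ ∘ₗ LinearMap.snd ℝ _ _ ∘ₗ F.symm.toLinearMap,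
    𝔫.subtype ∘ₗ LinearMap.snd ℝ _ _ ∘ₗ LinearMap.snd ℝ _ _ ∘ₗ F.symm.toLinearMap,
    fun x => (F.symm x).1.2, fun x => (F.symm x).2.1.2, fun x => (F.symm x).2.2.2,
    LinearMap.ext hF, fun l hl p hp n hn => ?_⟩
  have h1 : F.symm (l + p + n) = ⟨⟨l, hl⟩, ⟨p, hp⟩, ⟨n, hn⟩⟩ := by
    rw [LinearEquiv.symm_apply_eq]
    exact (hf ⟨⟨l, hl⟩, ⟨p, hp⟩, ⟨n, hn⟩⟩).symm
  refine ⟨?_, ?_, ?_⟩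
  · exact congrArg (fun y => (y.1 : V)) h1
  · exact congrArg (fun y => (y.2.1 : V)) h1
  · exact congrArg (fun y => (y.2.2 : V)) h1

variable {𝔤 : Type*} [LieRing 𝔤] [LieAlgebra ℝ 𝔤] [FiniteDimensional ℝ 𝔤]
  {𝔩 𝔭 𝔫 : Submodule ℝ 𝔤} {q : BilinForm ℝ 𝔤}

/-- The partial traces of `ad X ^ 2` over `𝔭` and `𝔫`. -/
lemma IsFibrationForm.partial_traces (h : IsFibrationForm 𝔩 𝔭 𝔫 q)
    (hind : ∀ l ∈ 𝔩, ∀ p ∈ 𝔭, ∀ n ∈ 𝔫, l + p + n = 0 → l = 0 ∧ p = 0 ∧ n = 0)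
    {ν : Type*} [Fintype ν] {𝔨 : Submodule ℝ 𝔤} (hk : ∀ x, x ∈ 𝔨 ↔ ∃ l ∈ 𝔩, ∃ p ∈ 𝔭, l + p = x)
    (hkk : ∀ x ∈ 𝔨, ∀ y ∈ 𝔨, ⁅x, y⁆ ∈ 𝔨) (u : Module.Basis ν ℝ 𝔨)
    (huo : ∀ i j, i ≠ j → killingForm ℝ 𝔤 (u i) (u j) = 0)
    (hu : ∀ i, killingForm ℝ 𝔤 (u i) (u i) = -1) {γ : ℝ} {X : 𝔤} (hX : X ∈ 𝔭)
    (hC : -∑ i, ⁅(u i : 𝔤), ⁅(u i : 𝔤), X⁆⁆ = γ • X)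
    {ι κ : Type*} [Fintype ι] [Fintype κ] (bp : Module.Basis ι ℝ 𝔭) (bn : Module.Basis κ ℝ 𝔫)
    (hbp : ∀ i j, i ≠ j → q (bp i) (bp j) = 0) (hbn : ∀ i j, i ≠ j → q (bn i) (bn j) = 0) :
    ∑ i, q ⁅X, ⁅X, (bp i : 𝔤)⁆⁆ (bp i) / q (bp i) (bp i) = γ / 2 * killingForm ℝ 𝔤 X X ∧
    ∑ i, q ⁅X, ⁅X, (bn i : 𝔤)⁆⁆ (bn i) / q (bn i) (bn i) = (1 - γ) * killingForm ℝ 𝔤 X X := by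
  obtain ⟨πl, πp, πn, hl, hp, hn, hsum, hπ⟩ := exists_projections h.decomp hind
  have hp0 : ∀ i, q (bp i) (bp i) ≠ 0 := fun i =>
    (h.pos_p _ (bp i).2 fun h0 => bp.ne_zero i (Subtype.ext h0)).ne'
  have hn0 : ∀ i, q (bn i) (bn i) ≠ 0 := fun i =>
    (h.pos_n _ (bn i).2 fun h0 => bn.ne_zero i (Subtype.ext h0)).ne'
  let S : 𝔤 →ₗ[ℝ] 𝔤 := LieAlgebra.ad ℝ 𝔤 X
  have hpid : ∀ x ∈ 𝔭, πp x = x := fun x hx => by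
    have := (hπ 0 𝔩.zero_mem x hx 0 𝔫.zero_mem).2.1
    simpa using this
  have hlid : ∀ x ∈ 𝔩, πl x = x := fun x hx => by
    have := (hπ x hx 0 𝔭.zero_mem 0 𝔫.zero_mem).1
    simpa using this
  have hnid : ∀ x ∈ 𝔫, πn x = x := fun x hx => by
    have := (hπ 0 𝔩.zero_mem 0 𝔭.zero_mem x hx).2.2
    simpa using this
  have hXl : ∀ x ∈ 𝔩, ⁅X, x⁆ ∈ 𝔭 := fun x hx => by
    rw [← lie_skew]; exact 𝔭.neg_mem (h.lie_lp x hx X hX)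
  have hXk : X ∈ 𝔨 := (hk X).2 ⟨0, 𝔩.zero_mem, X, hX, zero_add X⟩
  have tp := trace_comp_proj_eq_sum q πp hp hpid (S * S)
    (fun x hx => hXl _ (h.lie_pp X hX x hx)) bp hbp hp0
  have tn := trace_comp_proj_eq_sum q πn hn hnid (S * S)
    (fun x hx => h.lie_pn X hX _ (h.lie_pn X hX x hx)) bn hbn hn0
  have tk := trace_comp_proj_eq_sum (killingForm ℝ 𝔤) (πl + πp)
    (fun x => (hk _).2 ⟨πl x, hl x, πp x, hp x, rfl⟩)
    (fun x hx => by
      obtain ⟨l, hl', p, hp', rfl⟩ := (hk x).1 hx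
      have := hπ l hl' p hp' 0 𝔫.zero_mem
      rw [add_zero] at this
      rw [LinearMap.add_apply, this.1, this.2.1])
    (S * S) (fun x hx => hkk X hXk _ (hkk X hXk x hx)) u huo (fun i => by rw [hu]; norm_num)
  -- In the basis u, with Φ(uᵢ, uᵢ) = -1, the trace is -∑ Φ([X, [X, uᵢ]], uᵢ). Invariance of Φ moves
  -- both brackets over, giving Φ(C X, X) for the Casimir operator C.
  have hk' : LinearMap.trace ℝ 𝔤 ((S * S) ∘ₗ (πl + πp)) = γ * killingForm ℝ 𝔤 X X := by
    have h1 := congrArg (fun y => killingForm ℝ 𝔤 y X) hC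
    simp only [map_neg, map_sum, LinearMap.neg_apply, LinearMap.sum_apply, map_smul,
      LinearMap.smul_apply, smul_eq_mul] at h1
    rw [tk, ← h1, ← Finset.sum_neg_distrib]
    refine Finset.sum_congr rfl fun i _ => ?_
    have h2 : (S * S) (u i) = ⁅X, ⁅X, (u i : 𝔤)⁆⁆ := rfl
    rw [hu, h2, killingForm_lie' X, killingForm_lie' (u i : 𝔤), ← lie_skew X (u i : 𝔤)]
    simp only [map_neg, LinearMap.neg_apply, neg_neg, div_neg, div_one]
  -- Since ad X exchanges 𝔩 and 𝔭, the two compositions are products of the same two maps in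
  -- opposite orders.
  have hlp : LinearMap.trace ℝ 𝔤 ((S * S) ∘ₗ πl) = LinearMap.trace ℝ 𝔤 ((S * S) ∘ₗ πp) := by
    have e1 : (S * S) ∘ₗ πl = (S * πp) * (S * πl) := by
      refine LinearMap.ext fun x => ?_
      change S (S (πl x)) = S (πp (S (πl x)))
      rw [hpid (S (πl x)) (hXl _ (hl x))]
    have e2 : (S * S) ∘ₗ πp = (S * πl) * (S * πp) := by
      refine LinearMap.ext fun x => ?_
      change S (S (πp x)) = S (πl (S (πp x)))
      rw [hlid (S (πp x)) (h.lie_pp X hX _ (hp x))]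
    rw [e1, e2, LinearMap.trace_mul_comm]
  have htot : LinearMap.trace ℝ 𝔤 ((S * S) ∘ₗ (πl + πp)) + LinearMap.trace ℝ 𝔤 ((S * S) ∘ₗ πn) =
      killingForm ℝ 𝔤 X X := by
    rw [← map_add, ← LinearMap.comp_add, hsum]
    rfl
  have hadd : LinearMap.trace ℝ 𝔤 ((S * S) ∘ₗ (πl + πp)) =
      LinearMap.trace ℝ 𝔤 ((S * S) ∘ₗ πl) + LinearMap.trace ℝ 𝔤 ((S * S) ∘ₗ πp) := by
    rw [LinearMap.comp_add, map_add]
  constructor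
  · refine tp.symm.trans ?_
    linarith
  · refine tn.symm.trans ?_
    linarith

end Traces

/-- Subtracting the fibre equation makes λ(1 - γ) a constant, and λ is proportional to γ unless `cF`
is 0; so γ(1 - γ) agrees for both indices, a quadratic that factors. -/
lemma eq_or_eq_one_sub_of_ricci {cF cM β γ₁ γ₂ lam₁ lam₂ : ℝ} (hβ : β ≠ 0) (h₁ : 0 < lam₁)
    (h₂ : 0 < lam₂) (hF₁ : cF * lam₁ = γ₁ / 2) (hF₂ : cF * lam₂ = γ₂ / 2)
    (hM₁ : cM * lam₁ = γ₁ / 2 + (lam₁ * β) ^ 2 / 4 * (1 - γ₁))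
    (hM₂ : cM * lam₂ = γ₂ / 2 + (lam₂ * β) ^ 2 / 4 * (1 - γ₂)) : γ₁ = γ₂ ∨ γ₁ = 1 - γ₂ := by
  by_cases hc : cF = 0
  · left
    rw [hc] at hF₁ hF₂
    linarith
  · have e₁ : cM = cF + lam₁ * β ^ 2 / 4 * (1 - γ₁) := by
      refine mul_right_cancel₀ h₁.ne' ?_
      rw [hM₁, ← hF₁]; ring
    have e₂ : cM = cF + lam₂ * β ^ 2 / 4 * (1 - γ₂) := by
      refine mul_right_cancel₀ h₂.ne' ?_
      rw [hM₂, ← hF₂]; ring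
    have e₃ : lam₁ * (1 - γ₁) = lam₂ * (1 - γ₂) := by
      refine mul_right_cancel₀ (pow_ne_zero 2 hβ) ?_
      linarith
    have e₄ : γ₁ * (1 - γ₁) = γ₂ * (1 - γ₂) := by
      have g₁ : γ₁ = 2 * (cF * lam₁) := by linarith
      have g₂ : γ₂ = 2 * (cF * lam₂) := by linarith
      linear_combination (1 - γ₁) * g₁ - (1 - γ₂) * g₂ + 2 * cF * e₃
    have e₅ : (γ₁ - γ₂) * (γ₁ - (1 - γ₂)) = 0 := by linear_combination -e₄
    rcases mul_eq_zero.1 e₅ with h | h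
    · exact Or.inl (sub_eq_zero.1 h)
    · exact Or.inr (sub_eq_zero.1 h)

/-! ### From the metrics to forms on the Lie algebra -/

section Bridge

set_option linter.unusedSectionVars false

variable {E : Type*} [NormedAddCommGroup E] [NormedSpace ℝ E] [FiniteDimensional ℝ E]
  {G : Type*} [TopologicalSpace G] [ChartedSpace E G] [Group G] [LieGroup 𝓘(ℝ, E) ∞ G]

instance finiteDimensional_lieAlg : FiniteDimensional ℝ (LieAlg E G) :=
  inferInstanceAs (FiniteDimensional ℝ E)

/-- The tangent space at m is read as the fixed model space, which leaves a purely algebraic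
condition on the form. -/
lemma isEinsteinForm_of_isEinstein
    {EM : Type*} [NormedAddCommGroup EM] [NormedSpace ℝ EM] [FiniteDimensional ℝ EM]
    {M : Type*} [TopologicalSpace M] [ChartedSpace EM M] [IsManifold 𝓘(ℝ, EM) ∞ M]
    [MulAction G M] {g : RiemannianMetric EM M} (hact : IsSmoothAction E G EM M)
    (hg : IsInvariantMetric G g) (hE : IsEinstein g) {m : M}
    (hsurj : ∀ v : TangentSpace 𝓘(ℝ, EM) m, ∃ X : LieAlg E G, fund EM X m = v) :
    ∃ c : ℝ, IsEinsteinForm (𝔤 := LieAlg E G) EM (fundForm g m) c := by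
  obtain ⟨c, hc⟩ := exists_trace_of_isEinstein hact hg hE hsurj
  let g₀ : EM →L[ℝ] EM →L[ℝ] ℝ := g.inner m
  let P : E →L[ℝ] EM := mfderiv 𝓘(ℝ, E) 𝓘(ℝ, EM) (fun a : G => a • m) (1 : G)
  exact ⟨c, LinearMap.mk₂ ℝ (fun v w => g₀ v w) (fun u v w => by simp) (fun a v w => by simp)
    (fun u v w => by simp) (fun a v w => by simp), (P : E →ₗ[ℝ] EM), fun v w => g.symm m v w,
    fun v hv => g.pos m v hv, hsurj, fun x y => rfl, fun X hX => hc X hX⟩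

variable {K L : Subgroup G}
  {EM : Type*} [NormedAddCommGroup EM] [NormedSpace ℝ EM] [FiniteDimensional ℝ EM]
  [ChartedSpace EM (G ⧸ L)] [IsManifold 𝓘(ℝ, EM) ∞ (G ⧸ L)]
  {EN : Type*} [NormedAddCommGroup EN] [NormedSpace ℝ EN] [FiniteDimensional ℝ EN]
  [ChartedSpace EN (G ⧸ K)] [IsManifold 𝓘(ℝ, EN) ∞ (G ⧸ K)]

lemma exists_fund_eq_tangent (a : G) (v : TangentSpace 𝓘(ℝ, E) a) :
    ∃ X : LieAlg E G, fund E X a = v := by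
  have hd : ∀ b c : G, MDifferentiableAt 𝓘(ℝ, E) 𝓘(ℝ, E) (fun x : G => x * b) c := fun b c =>
    (contMDiff_mul_right (I := 𝓘(ℝ, E)) (n := ∞)).mdifferentiable (by simp) _
  have h1 := (hd a (a * a⁻¹)).hasMFDerivAt.comp a (hd a⁻¹ a).hasMFDerivAt
  have h2 : ((fun x : G => x * a) ∘ fun x : G => x * a⁻¹) = id := by funext x; simp
  rw [h2] at h1
  have h3 := DFunLike.congr_fun (hasMFDerivAt_unique h1 (hasMFDerivAt_id a)) v
  let X : LieAlg E G := (mfderiv 𝓘(ℝ, E) 𝓘(ℝ, E) (fun x : G => x * a⁻¹) a v : E)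
  have h4 := mfderiv_apply_congr (I := 𝓘(ℝ, E)) (I' := 𝓘(ℝ, E)) (fun x : G => x * a)
    (mul_inv_cancel a) X
  exact ⟨X, h4.symm.trans h3⟩

lemma exists_fund_coset_eq
    (hM : Manifold.IsSubmersion 𝓘(ℝ, E) 𝓘(ℝ, EM) ∞ (fun a : G => (a : G ⧸ L))) (x : G ⧸ L)
    (v : TangentSpace 𝓘(ℝ, EM) x) : ∃ X : LieAlg E G, fund EM X x = v := by
  induction x using QuotientGroup.induction_on with
  | H a =>
    obtain ⟨ξ, hξ⟩ := mfderiv_surjective_of_submersion hM a v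
    obtain ⟨X, rfl⟩ := exists_fund_eq_tangent a ξ
    refine ⟨X, ?_⟩
    have h1 := (isSmoothAction_quotient hM).mfderiv_orbit_fund X ((1 : G) : G ⧸ L) a
    have h2 : (fun b : G => b • ((1 : G) : G ⧸ L)) = fun b : G => (b : G ⧸ L) :=
      funext smul_one_coset
    rw [h2] at h1
    have h3 : ∀ y, y = (a : G ⧸ L) → (fund EM X y : EM) = fund EM X (a : G ⧸ L) := by
      rintro _ rfl; rfl
    exact (h3 _ (smul_one_coset a)).symm.trans (h1.symm.trans hξ)

/-- G/L → G/K is equivariant, so it relates the fundamental fields of the same X. -/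
lemma mfderiv_quotientMap_fund (hLK : L ≤ K)
    (hM : Manifold.IsSubmersion 𝓘(ℝ, E) 𝓘(ℝ, EM) ∞ (fun a : G => (a : G ⧸ L)))
    (hpr : ContMDiff 𝓘(ℝ, EM) 𝓘(ℝ, EN) ∞ (Subgroup.quotientMapOfLE hLK)) (X : LieAlg E G)
    (x : G ⧸ L) :
    mfderiv 𝓘(ℝ, EM) 𝓘(ℝ, EN) (Subgroup.quotientMapOfLE hLK) x (fund EM X x) =
      fund EN X (Subgroup.quotientMapOfLE hLK x) := by
  have h1 : MDifferentiableAt 𝓘(ℝ, EM) 𝓘(ℝ, EN) (Subgroup.quotientMapOfLE hLK) ((1 : G) • x) :=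
    hpr.mdifferentiable (by simp) _
  have h2 : MDifferentiableAt 𝓘(ℝ, E) 𝓘(ℝ, EM) (fun a : G => a • x) 1 :=
    ((isSmoothAction_quotient hM).contMDiff_orbit x).mdifferentiable (by simp) _
  have h3 := DFunLike.congr_fun (h1.hasMFDerivAt.comp (1 : G) h2.hasMFDerivAt).mfderiv X
  have h4 : (Subgroup.quotientMapOfLE hLK) ∘ (fun a : G => a • x) =
      fun a : G => a • Subgroup.quotientMapOfLE hLK x := by
    funext a
    induction x using QuotientGroup.induction_on with
    | H b => rfl
  rw [h4] at h3
  have h5 := mfderiv_apply_congr (I := 𝓘(ℝ, EM)) (I' := 𝓘(ℝ, EN)) (Subgroup.quotientMapOfLE hLK)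
    (one_smul G x) (fund EM X x)
  exact h5.symm.trans h3.symm

/-- The metric of the total space of a Riemannian submersion `G/L → G/K` is `Ad K`-invariant in
horizontal directions. -/
lemma fundForm_Ad_of_submersion (hLK : L ≤ K)
    (hM : Manifold.IsSubmersion 𝓘(ℝ, E) 𝓘(ℝ, EM) ∞ (fun a : G => (a : G ⧸ L)))
    {gM : RiemannianMetric EM (G ⧸ L)} {gN : RiemannianMetric EN (G ⧸ K)}
    (hgM : IsInvariantMetric G gM)
    (hsub : IsRiemannianSubmersion gM gN (Subgroup.quotientMapOfLE hLK))
    {𝔨 : Submodule ℝ (LieAlg E G)}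
    (h𝔨 : ∀ X, fund EN X ((1 : G) : G ⧸ K) = 0 → X ∈ 𝔨) (hAd : IsAdSubmodule E K 𝔨)
    {k : G} (hk : k ∈ K) {X Y : LieAlg E G}
    (hX : ∀ W ∈ 𝔨, fundForm gM ((1 : G) : G ⧸ L) X W = 0)
    (hY : ∀ W ∈ 𝔨, fundForm gM ((1 : G) : G ⧸ L) Y W = 0)
    (hX' : ∀ W ∈ 𝔨, fundForm gM ((1 : G) : G ⧸ L) (Ad E k X) W = 0)
    (hY' : ∀ W ∈ 𝔨, fundForm gM ((1 : G) : G ⧸ L) (Ad E k Y) W = 0) :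
    fundForm gM ((1 : G) : G ⧸ L) (Ad E k X) (Ad E k Y) =
      fundForm gM ((1 : G) : G ⧸ L) X Y := by
  -- Over the base coset of G/K, vertical vectors come from 𝔨; on vectors orthogonal to them the
  -- form of gM is that of gN downstairs.
  have key : ∀ x : G ⧸ L, Subgroup.quotientMapOfLE hLK x = ((1 : G) : G ⧸ K) →
      ∀ U V : LieAlg E G, (∀ W ∈ 𝔨, fundForm gM x U W = 0) → (∀ W ∈ 𝔨, fundForm gM x V W = 0) →
      fundForm gN (Subgroup.quotientMapOfLE hLK x) U V = fundForm gM x U V := by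
    intro x hx U V hU hV
    have hvert : ∀ u : TangentSpace 𝓘(ℝ, EM) x,
        mfderiv 𝓘(ℝ, EM) 𝓘(ℝ, EN) (Subgroup.quotientMapOfLE hLK) x u = 0 →
        ∃ W ∈ 𝔨, fund EM W x = u := by
      intro u hu
      obtain ⟨W, rfl⟩ := exists_fund_coset_eq hM x u
      rw [mfderiv_quotientMap_fund hLK hM hsub.1.contMDiff] at hu
      exact ⟨W, h𝔨 W (by rw [← hx]; exact hu), rfl⟩
    have h1 := hsub.2 x (fund EM U x) (fund EM V x)
      (fun u hu => by obtain ⟨W, hW, rfl⟩ := hvert u hu; exact hU W hW)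
      (fun u hu => by obtain ⟨W, hW, rfl⟩ := hvert u hu; exact hV W hW)
    rw [mfderiv_quotientMap_fund hLK hM hsub.1.contMDiff,
      mfderiv_quotientMap_fund hLK hM hsub.1.contMDiff] at h1
    exact h1
  have hs := fundForm_smul (isSmoothAction_quotient hM) hgM ((1 : G) : G ⧸ L) k
  have hx : Subgroup.quotientMapOfLE hLK (k • ((1 : G) : G ⧸ L)) = ((1 : G) : G ⧸ K) :=
    smul_one_coset_of_mem hk
  have hhor : ∀ U : LieAlg E G, (∀ W ∈ 𝔨, fundForm gM ((1 : G) : G ⧸ L) U W = 0) →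
      ∀ W ∈ 𝔨, fundForm gM (k • ((1 : G) : G ⧸ L)) (Ad E k U) W = 0 := by
    intro U hU W hW
    rw [hs, Ad_inv_apply']
    exact hU _ (hAd _ (K.inv_mem hk) W hW)
  -- The cosets kL and L lie over the same point of G/K, so both forms of gM are compared with one
  -- form of gN; translation by k then brings in Ad k.
  have h1 := key _ hx _ _ (hhor X hX) (hhor Y hY)
  have h2 := key _ rfl _ _ hX' hY'
  rw [hx, hs, Ad_inv_apply', Ad_inv_apply'] at h1
  exact h2.symm.trans h1

end Bridge

/-! ### Negative definite subspaces and their orthogonal complements -/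

section Complements

open LinearMap (BilinForm)

variable {V : Type*} [AddCommGroup V] [Module ℝ V]

/-- Turns the normalised basis in `IsCasimir` into negative definiteness of Φ on 𝔨. -/
lemma neg_of_basis (b : BilinForm ℝ V) {U : Submodule ℝ V} {ι : Type*} [Fintype ι]
    [DecidableEq ι] (u : Module.Basis ι ℝ U)
    (hu : ∀ i j, b (u i) (u j) = if i = j then -1 else 0) {x : V} (hx : x ∈ U) (hx0 : x ≠ 0) :
    b x x < 0 := by
  have h1 := congrArg (fun z : U => (z : V)) (u.sum_repr ⟨x, hx⟩)
  simp only [Submodule.coe_sum, Submodule.coe_smul] at h1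
  have h2 : b x x = -∑ i, u.repr ⟨x, hx⟩ i ^ 2 := by
    conv_lhs => rw [← h1]
    simp [LinearMap.sum_apply, hu, sq]
  have h3 : ∃ i, u.repr ⟨x, hx⟩ i ≠ 0 := by
    by_contra! h
    refine hx0 ?_
    rw [← h1]
    simp [h]
  obtain ⟨i, hi⟩ := h3
  rw [h2, neg_lt_zero]
  exact Finset.sum_pos' (fun j _ => sq_nonneg _) ⟨i, Finset.mem_univ i, by positivity⟩

/-- The form is definite on U, so some u ∈ U represents the functional b(x, ·) on U. No definiteness
is required on the whole space. -/
lemma exists_orthogonal_decomposition [FiniteDimensional ℝ V] (b : BilinForm ℝ V)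
    (hs : ∀ x y, b x y = b y x) {U : Submodule ℝ V}
    (hneg : ∀ x ∈ U, x ≠ 0 → b x x < 0) (x : V) :
    ∃ u ∈ U, ∀ z ∈ U, b z (x - u) = 0 := by
  obtain ⟨D, hD⟩ := exists_equiv_dual (-(b.restrict U)) fun v hv => by
    have := hneg v v.2 fun h0 => hv (Subtype.ext h0)
    change 0 < -(b v v)
    linarith
  let u : U := D.symm (-(b x ∘ₗ U.subtype))
  have hu : ∀ z : U, -(b u z) = -(b x z) := fun z => by
    refine (hD u z).symm.trans ?_
    simp [u]
  refine ⟨u, u.2, fun z hz => ?_⟩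
  have := hu ⟨z, hz⟩
  rw [hs, map_sub, LinearMap.sub_apply]
  simp only at this
  linarith

end Complements

open LinearMap (BilinForm)

/-! ### Schur's lemma for Ad and the algebraic core of the theorem -/

section Isotropy

set_option linter.unusedSectionVars false

variable {E : Type*} [NormedAddCommGroup E] [NormedSpace ℝ E] [FiniteDimensional ℝ E]
  {G : Type*} [TopologicalSpace G] [ChartedSpace E G] [Group G] [LieGroup 𝓘(ℝ, E) ∞ G]
  {K L : Subgroup G} {𝔨 𝔩 𝔭 𝔫 : Submodule ℝ (LieAlg E G)} {q : BilinForm ℝ (LieAlg E G)}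

lemma mem_orthIn {U V : Submodule ℝ (LieAlg E G)} {x : LieAlg E G} :
    x ∈ orthIn E U V ↔ x ∈ V ∧ ∀ z ∈ U, killing E G z x = 0 := Iff.rfl

lemma IsAdSubmodule.exists_Ad_eq {H : Subgroup G} {U : Submodule ℝ (LieAlg E G)}
    (hU : IsAdSubmodule E H U) {h : G} (hh : h ∈ H) {v : LieAlg E G} (hv : v ∈ U) :
    ∃ w ∈ U, Ad E h w = v :=
  ⟨_, hU _ (H.inv_mem hh) v hv, Ad_inv_apply h v⟩

/-- Schur's lemma for symmetric forms on an irreducible `Ad H`-module. -/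
lemma IsAdIrreducible.exists_eq_mul {H : Subgroup G} {U : Submodule ℝ (LieAlg E G)}
    (hU : IsAdIrreducible E H U) (b₁ b₂ : BilinForm ℝ (LieAlg E G))
    (h₁ : ∀ v w, b₁ v w = b₁ w v) (h₂ : ∀ v w, b₂ v w = b₂ w v)
    (hinv₁ : ∀ h ∈ H, ∀ v ∈ U, ∀ w ∈ U, b₁ (Ad E h v) (Ad E h w) = b₁ v w)
    (hinv₂ : ∀ h ∈ H, ∀ v ∈ U, ∀ w ∈ U, b₂ (Ad E h v) (Ad E h w) = b₂ v w)
    (hpos : ∀ w ∈ U, w ≠ 0 → 0 < b₁ w w) :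
    ∃ c : ℝ, ∀ v ∈ U, ∀ w ∈ U, b₂ v w = c * b₁ v w :=
  exists_eq_mul_of_irreducible (ρ := fun h : H => Ad E (h : G)) b₁ b₂
    (fun v _ w _ => h₁ v w) (fun v _ w _ => h₂ v w) (fun h => hinv₁ h h.2) (fun h => hinv₂ h h.2)
    (fun h => hU.2.1 h h.2) (fun h _ hv => hU.2.1.exists_Ad_eq h.2 hv) hU.1
    (fun U' hU' hinv => hU.2.2 U' hU' fun h hh => hinv ⟨h, hh⟩) hpos

lemma IsAdIrreducible.form_eq_zero {H : Subgroup G} {U W : Submodule ℝ (LieAlg E G)}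
    (hU : IsAdIrreducible E H U) (hW : IsAdSubmodule E H W)
    (hinv : ∀ h ∈ H, ∀ v w, q (Ad E h v) (Ad E h w) = q v w)
    (hpos : ∀ w ∈ W, w ≠ 0 → 0 < q w w)
    (hne : ∀ W' : Submodule ℝ (LieAlg E G), W' ≤ W → IsAdSubmodule E H W' →
      ¬ AdEquivalent E H U W') {v w : LieAlg E G} (hv : v ∈ U) (hw : w ∈ W) : q v w = 0 := by
  refine form_eq_zero_of_not_equivalent (ρ := fun h : H => Ad E (h : G)) q
    (fun h => hinv h h.2) (fun h => hU.2.1 h h.2) (fun h => hW h h.2)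
    (fun h _ hv => hW.exists_Ad_eq h.2 hv)
    (fun U' hU' hinv => hU.2.2 U' hU' fun h hh => hinv ⟨h, hh⟩) hpos
    (fun W' hW' hinv' => ?_) hv hw
  rintro ⟨f, hf⟩
  exact hne W' hW' (fun h hh => hinv' ⟨h, hh⟩) ⟨f, fun h hh => hf ⟨h, hh⟩⟩

/-- The theorem with all geometry replaced by the form q and its restriction to the fibre.
Invariance under `Ad K` on 𝔫 is assumed only conditionally (`hAdK`), because a submersion controls
the metric on horizontal vectors alone, and that 𝔫 is horizontal is itself a consequence of Schur's
lemma. -/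
lemma casimir_eigenvalue_relation [LieAlgebra.IsSemisimple ℝ (LieAlg E G)] (hLK : L ≤ K)
    (h𝔩𝔨 : 𝔩 ≤ 𝔨) (h𝔨 : ∀ x ∈ 𝔨, ∀ y ∈ 𝔨, ⁅x, y⁆ ∈ 𝔨) (h𝔩 : ∀ x ∈ 𝔩, ∀ y ∈ 𝔩, ⁅x, y⁆ ∈ 𝔩)
    (h𝔭 : 𝔭 = orthIn E 𝔩 𝔨) (h𝔫 : 𝔫 = orthIn E 𝔨 ⊤) (hNirr : IsAdIrreducible E K 𝔫)
    (hFsymm : ∀ x ∈ 𝔭, ∀ y ∈ 𝔭, ⁅x, y⁆ ∈ 𝔩)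
    {s : ℕ} {p : Fin s → Submodule ℝ (LieAlg E G)} (hpsum : ⨆ a, p a = 𝔭)
    (hporth : ∀ a b, a ≠ b → ∀ x ∈ p a, ∀ y ∈ p b, killing E G x y = 0)
    (hpirr : ∀ a, IsAdIrreducible E L (p a))
    (hpineq : ∀ a b, a ≠ b → ¬ AdEquivalent E L (p a) (p b))
    (hpn : ∀ V W : Submodule ℝ (LieAlg E G), V ≤ 𝔭 → W ≤ 𝔫 → V ≠ ⊥ →
      IsAdSubmodule E L V → IsAdSubmodule E L W → ¬ AdEquivalent E L V W)
    {C : LieAlg E G →ₗ[ℝ] LieAlg E G} (hC : IsCasimir E 𝔨 C)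
    {γ : Fin s → ℝ} (hγ : ∀ a, ∀ x ∈ p a, C x = γ a • x)
    (hsymm : ∀ x y, q x y = q y x) (hnull : ∀ z ∈ 𝔩, ∀ x, q z x = 0)
    (hpos : ∀ x, x ∉ 𝔩 → 0 < q x x) (had : ∀ z ∈ 𝔩, ∀ x y, q ⁅z, x⁆ y = -q x ⁅z, y⁆)
    (hAdL : ∀ l ∈ L, ∀ x y, q (Ad E l x) (Ad E l y) = q x y)
    (hAdK : (∀ x ∈ 𝔫, ∀ y ∈ 𝔨, q x y = 0) →
      ∀ k ∈ K, ∀ x ∈ 𝔫, ∀ y ∈ 𝔫, q (Ad E k x) (Ad E k y) = q x y)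
    {VM VF 𝔥 : Type*} [AddCommGroup VM] [Module ℝ VM] [FiniteDimensional ℝ VM]
    [AddCommGroup VF] [Module ℝ VF] [FiniteDimensional ℝ VF] [LieRing 𝔥] [LieAlgebra ℝ 𝔥]
    {cM cF : ℝ} (hM : IsEinsteinForm VM q cM) (φ : 𝔥 →ₗ[ℝ] LieAlg E G)
    (hφ : ∀ x y, φ ⁅x, y⁆ = ⁅φ x, φ y⁆) (hφr : ∀ x, x ∈ 𝔨 ↔ ∃ u, φ u = x)
    {qF : BilinForm ℝ 𝔥} (hqF : ∀ u v, qF u v = q (φ u) (φ v)) (hF : IsEinsteinForm VF qF cF)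
    (a b : Fin s) : γ a = γ b ∨ γ a = 1 - γ b := by
  obtain ⟨d, u, hu, hCu⟩ := hC
  have hΦs := killingForm_symm (𝔤 := LieAlg E G)
  have hneg : ∀ x ∈ 𝔨, x ≠ 0 → killing E G x x < 0 := fun x hx hx0 => neg_of_basis _ u hu hx hx0
  have hmp : ∀ x, x ∈ 𝔭 ↔ x ∈ 𝔨 ∧ ∀ z ∈ 𝔩, killing E G z x = 0 := fun x => by
    rw [h𝔭]; exact mem_orthIn
  have hmn : ∀ x, x ∈ 𝔫 ↔ ∀ z ∈ 𝔨, killing E G z x = 0 := fun x => by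
    rw [h𝔫, mem_orthIn]; simp
  have hlp0 : ∀ x ∈ 𝔩, x ∈ 𝔭 → x = 0 := fun x hx hx' => by
    by_contra hne
    exact (hneg x (h𝔩𝔨 hx) hne).ne (((hmp x).1 hx').2 x hx)
  have hkn0 : ∀ x ∈ 𝔨, x ∈ 𝔫 → x = 0 := fun x hx hx' => by
    by_contra hne
    exact (hneg x hx hne).ne ((hmn x).1 hx' x hx)
  have hdk : ∀ x ∈ 𝔨, ∃ l ∈ 𝔩, ∃ p ∈ 𝔭, l + p = x := by
    intro x hx
    obtain ⟨l, hl, hl'⟩ := exists_orthogonal_decomposition (killing E G) hΦs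
      (fun y hy hy0 => hneg y (h𝔩𝔨 hy) hy0) x
    exact ⟨l, hl, x - l, (hmp _).2 ⟨𝔨.sub_mem hx (h𝔩𝔨 hl), hl'⟩, add_sub_cancel _ _⟩
  have hdg : ∀ x, ∃ k ∈ 𝔨, ∃ n ∈ 𝔫, k + n = x := by
    intro x
    obtain ⟨k, hk, hk'⟩ := exists_orthogonal_decomposition (killing E G) hΦs hneg x
    exact ⟨k, hk, x - k, (hmn _).2 hk', add_sub_cancel _ _⟩
  have hkn : ∀ z ∈ 𝔨, ∀ x ∈ 𝔫, ⁅z, x⁆ ∈ 𝔫 := fun z hz x hx => by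
    refine (hmn _).2 fun z' hz' => ?_
    rw [killing, ← killingForm_lie]
    exact (hmn x).1 hx _ (h𝔨 _ hz' _ hz)
  have hpk : 𝔭 ≤ 𝔨 := fun x hx => ((hmp x).1 hx).1
  have hpa : ∀ a, p a ≤ 𝔭 := fun a => hpsum ▸ le_iSup p a
  have hpos_p : ∀ x ∈ 𝔭, x ≠ 0 → 0 < q x x := fun x hx hx0 =>
    hpos x fun hl => hx0 (hlp0 x hl hx)
  have hpos_n : ∀ x ∈ 𝔫, x ≠ 0 → 0 < q x x := fun x hx hx0 =>
    hpos x fun hl => hx0 (hkn0 x (h𝔩𝔨 hl) hx)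
  have hnL : IsAdSubmodule E L 𝔫 := fun l hl => hNirr.2.1 l (hLK hl)
  have hqpp : ∀ a b, a ≠ b → ∀ x ∈ p a, ∀ y ∈ p b, q x y = 0 := by
    intro a b hab x hx y hy
    -- A submodule of the irreducible p b is 0 or everything: the first is excluded because p a is
    -- nonzero, the second by inequivalence.
    refine (hpirr a).form_eq_zero (hpirr b).2.1 hAdL (fun w hw => hpos_p w (hpa b hw))
      (fun W' hW' hinv hequiv => ?_) hx hy
    rcases (hpirr b).2.2 W' hW' hinv with rfl | rfl
    · obtain ⟨f, -⟩ := hequiv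
      refine (hpirr a).1 ?_
      rw [Submodule.eq_bot_iff]
      intro v hv
      have h1 : f ⟨v, hv⟩ = 0 := Subsingleton.elim _ _
      exact congrArg Subtype.val ((LinearEquiv.map_eq_zero_iff f).1 h1)
    · exact hpineq a b hab hequiv
  have hqpn : ∀ a, ∀ x ∈ p a, ∀ y ∈ 𝔫, q x y = 0 := fun a x hx y hy =>
    (hpirr a).form_eq_zero hnL hAdL hpos_n
      (fun W' hW' hinv => hpn _ W' (hpa a) hW' (hpirr a).1 (hpirr a).2.1 hinv) hx hy
  have horth : ∀ x ∈ 𝔭, ∀ y ∈ 𝔫, q x y = 0 := by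
    intro x hx y hy
    have h1 : 𝔭 ≤ LinearMap.ker (q.flip y) := by
      rw [← hpsum]
      exact iSup_le fun a x hx => hqpn a x hx y hy
    exact h1 hx
  have hfib : IsFibrationForm 𝔩 𝔭 𝔫 q :=
    { symm := hsymm
      null := hnull
      ad := had
      lie_lp := fun z hz x hx => by
        refine (hmp _).2 ⟨h𝔨 z (h𝔩𝔨 hz) x (hpk hx), fun z' hz' => ?_⟩
        rw [killing, ← killingForm_lie]
        exact ((hmp x).1 hx).2 _ (h𝔩 _ hz' _ hz)
      lie_pp := hFsymm
      lie_ln := fun z hz => hkn z (h𝔩𝔨 hz)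
      lie_pn := fun z hz => hkn z (hpk hz)
      decomp := fun x => by
        obtain ⟨k, hk, n, hn, rfl⟩ := hdg x
        obtain ⟨l, hl, p, hp, rfl⟩ := hdk k hk
        exact ⟨l, hl, p, hp, n, hn, rfl⟩
      orth := horth
      pos_p := hpos_p
      pos_n := hpos_n }
  have hind : ∀ l ∈ 𝔩, ∀ p ∈ 𝔭, ∀ n ∈ 𝔫, l + p + n = 0 → l = 0 ∧ p = 0 ∧ n = 0 := by
    intro l hl p hp n hn h0
    have hn0 : n = 0 := hkn0 n (by
      rw [eq_neg_of_add_eq_zero_right h0]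
      exact 𝔨.neg_mem (𝔨.add_mem (h𝔩𝔨 hl) (hpk hp))) hn
    rw [hn0, add_zero] at h0
    have hp0 : p = 0 := hlp0 p (by
      rw [eq_neg_of_add_eq_zero_right h0]
      exact 𝔩.neg_mem hl) hp
    rw [hp0, add_zero] at h0
    exact ⟨h0, hp0, hn0⟩
  have hlam : ∀ a, ∃ lam : ℝ, 0 < lam ∧ ∀ x ∈ p a, ∀ y, q x y = -lam * killing E G x y := by
    intro a
    obtain ⟨lam, hlam⟩ := (hpirr a).exists_eq_mul (-killing E G) q
      (fun v w => congrArg Neg.neg (hΦs v w)) hsymm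
      (fun h hh v _ w _ => congrArg Neg.neg (killing_Ad h v w))
      (fun h hh v _ w _ => hAdL h hh v w)
      (fun w hw hw0 => neg_pos.2 (hneg w (hpk (hpa a hw)) hw0))
    have hlam' : ∀ v ∈ p a, ∀ w ∈ p a, q v w = -lam * killing E G v w := fun v hv w hw => by
      rw [hlam v hv w hw, LinearMap.neg_apply, LinearMap.neg_apply]; ring
    refine ⟨lam, ?_, fun x hx y => ?_⟩
    · obtain ⟨v, hv, hv0⟩ := Submodule.exists_mem_ne_zero_of_ne_bot (hpirr a).1
      have h1 := hpos_p v (hpa a hv) hv0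
      rw [hlam' v hv v hv] at h1
      have h2 := hneg v (hpk (hpa a hv)) hv0
      by_contra hle
      nlinarith
    -- Proportionality on p a extends to an arbitrary second argument, since q and Φ both make p a
    -- orthogonal to 𝔩, to the other summands and to 𝔫.
    · let f : LieAlg E G →ₗ[ℝ] ℝ := q x + lam • killing E G x
      have hf : ∀ y, f y = q x y + lam * killing E G x y := fun y => rfl
      have hfp : 𝔭 ≤ LinearMap.ker f := by
        rw [← hpsum]
        refine iSup_le fun b y hy => ?_
        rw [LinearMap.mem_ker, hf]
        by_cases hab : a = b
        · subst hab
          rw [hlam' x hx y hy]; ring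
        · rw [hqpp a b hab x hx y hy, hporth a b hab x hx y hy]; ring
      obtain ⟨l, hl, p', hp', n, hn, rfl⟩ := hfib.decomp y
      have e1 : f l = 0 := by
        have := ((hmp x).1 (hpa a hx)).2 l hl
        rw [hf, hfib.null' hl, hΦs, this]; ring
      have e2 : f p' = 0 := hfp hp'
      have e3 : f n = 0 := by
        rw [hf, horth x (hpa a hx) n hn, (hmn n).1 hn x (hpk (hpa a hx))]; ring
      have e4 : f (l + p' + n) = 0 := by rw [map_add, map_add, e1, e2, e3]; ring
      rw [hf] at e4
      linarith
  have hnk : ∀ x ∈ 𝔫, ∀ y ∈ 𝔨, q x y = 0 := by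
    intro x hx y hy
    obtain ⟨l, hl, p', hp', rfl⟩ := hdk y hy
    rw [map_add, hfib.null' hl, hsymm, horth p' hp' x hx, add_zero]
  obtain ⟨β, hβ⟩ := hNirr.exists_eq_mul q (-killing E G) hsymm
    (fun v w => congrArg Neg.neg (hΦs v w)) (hAdK hnk)
    (fun h _ v _ w _ => congrArg Neg.neg (killing_Ad h v w)) hpos_n
  have hβn : ∀ x ∈ 𝔫, ∀ y ∈ 𝔫, killing E G x y = -β * q x y := fun x hx y hy => by
    have h1 : -killing E G x y = β * q x y := hβ x hx y hy
    linarith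
  -- With β = 0 the Killing form would vanish on 𝔫 × 𝔫; as 𝔫 is also orthogonal to 𝔨, this
  -- contradicts nondegeneracy.
  have hβ0 : β ≠ 0 := by
    rintro rfl
    obtain ⟨v, hv, hv0⟩ := Submodule.exists_mem_ne_zero_of_ne_bot hNirr.1
    refine hv0 ((LieAlgebra.IsKilling.killingForm_nondegenerate ℝ (LieAlg E G)).1 v fun y => ?_)
    obtain ⟨k, hk, n, hn, rfl⟩ := hdg y
    have h1 : killing E G v k = 0 := (hΦs _ _).trans ((hmn v).1 hv k hk)
    have h2 : killing E G v n = 0 := by rw [hβn v hv n hn]; ring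
    rw [map_add, h1, h2, add_zero]
  obtain ⟨bp, hbp⟩ := exists_orthogonal_basis_submodule q hsymm 𝔭
  obtain ⟨bn, hbn⟩ := exists_orthogonal_basis_submodule q hsymm 𝔫
  have main : ∀ a, ∃ lam : ℝ, 0 < lam ∧ cF * lam = γ a / 2 ∧
      cM * lam = γ a / 2 + (lam * β) ^ 2 / 4 * (1 - γ a) := by
    intro a
    obtain ⟨lam, hlam0, hlam⟩ := hlam a
    -- One nonzero X in p a suffices: both equations become multiples of Φ(X, X) < 0, which is
    -- cancelled.
    obtain ⟨X, hX, hX0⟩ := Submodule.exists_mem_ne_zero_of_ne_bot (hpirr a).1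
    have hXp := hpa a hX
    have hΦX := hneg X (hpk hXp) hX0
    have hM' := ricci_total hfib hM hβ0 hβn hXp (hlam X hX) bp bn hbp hbn
    have hF' := ricci_fiber hfib φ hφ (fun x hx => (hφr x).1 (hpk hx))
      (fun u => hdk _ ((hφr _).2 ⟨u, rfl⟩)) hqF hF hXp (hlam X hX) bp hbp
    obtain ⟨t1, t2⟩ := hfib.partial_traces hind
      (fun x => ⟨hdk x, by
        rintro ⟨l, hl, p', hp', rfl⟩
        exact 𝔨.add_mem (h𝔩𝔨 hl) (hpk hp')⟩) h𝔨 u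
      (fun i j hij => (hu i j).trans (if_neg hij)) (fun i => (hu i i).trans (if_pos rfl)) hXp
      ((hCu X).symm.trans (hγ a X hX)) bp bn hbp hbn
    rw [t1, hlam X hX] at hF'
    rw [t1, t2, hlam X hX] at hM'
    refine ⟨lam, hlam0, ?_, ?_⟩
    · refine mul_right_cancel₀ hΦX.ne ?_
      linear_combination -hF'
    · refine mul_right_cancel₀ hΦX.ne ?_
      linear_combination -hM'
  obtain ⟨l₁, p₁, f₁, m₁⟩ := main a
  obtain ⟨l₂, p₂, f₂, m₂⟩ := main b
  exact eq_or_eq_one_sub_of_ricci hβ0 p₁ p₂ f₁ f₂ m₁ m₂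

end Isotropy

end HomogeneousFibration

end

/-! ### The corollary: feeding the geometric data to the algebraic core -/

theorem corollary2p6
    -- the compact connected semisimple Lie group `G`
    {E : Type*} [NormedAddCommGroup E] [NormedSpace ℝ E] [FiniteDimensional ℝ E]
    {G : Type*} [TopologicalSpace G] [ChartedSpace E G] [Group G] [LieGroup 𝓘(ℝ, E) ∞ G]
    [T2Space G] [CompactSpace G] [ConnectedSpace G]
    [LieAlgebra.IsSemisimple ℝ (HomogeneousFibration.LieAlg E G)]
    -- connected closed non-trivial subgroups `L < K < G`, with their Lie group structures
    {K L : Subgroup G} (hL : L ≠ ⊥) (hLK : L < K) (hK : K < ⊤)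
    (hKclosed : IsClosed (K : Set G)) (hLclosed : IsClosed (L : Set G))
    (hKconn : IsConnected (K : Set G)) (hLconn : IsConnected (L : Set G))
    {EK : Type*} [NormedAddCommGroup EK] [NormedSpace ℝ EK] [FiniteDimensional ℝ EK]
    [ChartedSpace EK K] [LieGroup 𝓘(ℝ, EK) ∞ K]
    (hKemb : Manifold.IsSmoothEmbedding 𝓘(ℝ, EK) 𝓘(ℝ, E) ∞ (fun k : K => (k : G)))
    {EL : Type*} [NormedAddCommGroup EL] [NormedSpace ℝ EL] [FiniteDimensional ℝ EL]
    [ChartedSpace EL L] [LieGroup 𝓘(ℝ, EL) ∞ L]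
    (hLemb : Manifold.IsSmoothEmbedding 𝓘(ℝ, EL) 𝓘(ℝ, E) ∞ (fun l : L => (l : G)))
    -- the coset manifolds `M = G/L`, `N = G/K`, `F = K/L`: their smooth structure is the
    -- one for which the canonical projection from the group is a smooth submersion
    {EM : Type*} [NormedAddCommGroup EM] [NormedSpace ℝ EM] [FiniteDimensional ℝ EM]
    [ChartedSpace EM (G ⧸ L)] [IsManifold 𝓘(ℝ, EM) ∞ (G ⧸ L)]
    (hM : Manifold.IsSubmersion 𝓘(ℝ, E) 𝓘(ℝ, EM) ∞ (fun a : G => (a : G ⧸ L)))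
    {EN : Type*} [NormedAddCommGroup EN] [NormedSpace ℝ EN] [FiniteDimensional ℝ EN]
    [ChartedSpace EN (G ⧸ K)] [IsManifold 𝓘(ℝ, EN) ∞ (G ⧸ K)]
    (hN : Manifold.IsSubmersion 𝓘(ℝ, E) 𝓘(ℝ, EN) ∞ (fun a : G => (a : G ⧸ K)))
    {EF : Type*} [NormedAddCommGroup EF] [NormedSpace ℝ EF] [FiniteDimensional ℝ EF]
    [ChartedSpace EF (K ⧸ L.subgroupOf K)] [IsManifold 𝓘(ℝ, EF) ∞ (K ⧸ L.subgroupOf K)]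
    (hF : Manifold.IsSubmersion 𝓘(ℝ, EK) 𝓘(ℝ, EF) ∞ (fun k : K => (k : K ⧸ L.subgroupOf K)))
    -- `𝔨`, `𝔩` and the decomposition `𝔤 = 𝔩 ⊕ 𝔭 ⊕ 𝔫`, orthogonal for the Killing form
    {𝔨 𝔩 𝔭 𝔫 : Submodule ℝ (HomogeneousFibration.LieAlg E G)}
    (h𝔨 : 𝔨 = HomogeneousFibration.subgroupLieAlg E EK K)
    (h𝔩 : 𝔩 = HomogeneousFibration.subgroupLieAlg E EL L)
    (h𝔭 : 𝔭 = HomogeneousFibration.orthIn E 𝔩 𝔨)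
    (h𝔫 : 𝔫 = HomogeneousFibration.orthIn E 𝔨 ⊤)
    -- the base `N = G/K` is isotropy irreducible
    (hNirr : HomogeneousFibration.IsAdIrreducible E K 𝔫)
    -- the fibre `F = K/L` is a simply connected symmetric space
    (hFsc : SimplyConnectedSpace (K ⧸ L.subgroupOf K))
    (hFsymm : ∀ x ∈ 𝔭, ∀ y ∈ 𝔭, ⁅x, y⁆ ∈ 𝔩)
    -- the tangent spaces `𝔭₁, …, 𝔭ₛ` of the irreducible factors of `F`
    {s : ℕ} {p : Fin s → Submodule ℝ (HomogeneousFibration.LieAlg E G)}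
    (hpsum : ⨆ a, p a = 𝔭)
    (hporth : ∀ a b, a ≠ b → ∀ x ∈ p a, ∀ y ∈ p b, HomogeneousFibration.killing E G x y = 0)
    (hpirr : ∀ a, HomogeneousFibration.IsAdIrreducible E L (p a))
    -- `𝔭₁, …, 𝔭ₛ` are pairwise inequivalent; `𝔭` and `𝔫` contain no equivalent submodules
    (hpineq : ∀ a b, a ≠ b → ¬ HomogeneousFibration.AdEquivalent E L (p a) (p b))
    (hpn : ∀ V W : Submodule ℝ (HomogeneousFibration.LieAlg E G), V ≤ 𝔭 → W ≤ 𝔫 → V ≠ ⊥ →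
      HomogeneousFibration.IsAdSubmodule E L V → HomogeneousFibration.IsAdSubmodule E L W →
      ¬ HomogeneousFibration.AdEquivalent E L V W)
    -- `γₐ` is the eigenvalue of the Casimir operator of `𝔨` on `𝔭ₐ`
    {C : HomogeneousFibration.LieAlg E G →ₗ[ℝ] HomogeneousFibration.LieAlg E G}
    (hC : HomogeneousFibration.IsCasimir E 𝔨 C)
    {γ : Fin s → ℝ} (hγ : ∀ a, ∀ x ∈ p a, C x = γ a • x)
    -- an adapted metric `g_M` on `M` and its restriction `g_F` to the fibre, both Einstein
    {gM : HomogeneousFibration.RiemannianMetric EM (G ⧸ L)}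
    (hgM : HomogeneousFibration.IsAdapted hLK.le EN gM)
    {gF : HomogeneousFibration.RiemannianMetric EF (K ⧸ L.subgroupOf K)}
    (hgF : HomogeneousFibration.IsPullbackMetric
      (HomogeneousFibration.fiberInclusion K L) gF gM)
    (hMein : HomogeneousFibration.IsEinstein gM)
    (hFein : HomogeneousFibration.IsEinstein gF) :
    ∀ a b, γ a = γ b ∨ γ a = 1 - γ b := by
  have hKs : ContMDiff 𝓘(ℝ, EK) 𝓘(ℝ, E) ∞ (fun k : K => (k : G)) := hKemb.contMDiff
  obtain ⟨hginv, ⟨gN, hsub⟩, -⟩ := hgM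
  have hFinv := HomogeneousFibration.isInvariantMetric_pullback hginv hgF hKs hM hF
  obtain ⟨cM, hcM⟩ := HomogeneousFibration.isEinsteinForm_of_isEinstein
    (HomogeneousFibration.isSmoothAction_quotient hM) hginv hMein
    (HomogeneousFibration.exists_fund_coset_eq hM ((1 : G) : G ⧸ L))
  obtain ⟨cF, hcF⟩ := HomogeneousFibration.isEinsteinForm_of_isEinstein
    (HomogeneousFibration.isSmoothAction_quotient hF) hFinv hFein
    (HomogeneousFibration.exists_fund_coset_eq hF ((1 : K) : K ⧸ L.subgroupOf K))
  have hmemL : ∀ X, HomogeneousFibration.fund EM X ((1 : G) : G ⧸ L) = 0 ↔ X ∈ 𝔩 := fun X => by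
    rw [h𝔩]; exact HomogeneousFibration.fund_one_coset_eq_zero_iff hM hLemb X
  have hmemK : ∀ X, HomogeneousFibration.fund EN X ((1 : G) : G ⧸ K) = 0 ↔ X ∈ 𝔨 := fun X => by
    rw [h𝔨]; exact HomogeneousFibration.fund_one_coset_eq_zero_iff hN hKemb X
  have hAdk : HomogeneousFibration.IsAdSubmodule E K 𝔨 := by
    rw [h𝔨]; exact HomogeneousFibration.isAdSubmodule_subgroupLieAlg hKs
  intro a b
  refine HomogeneousFibration.casimir_eigenvalue_relation hLK.le ?_ ?_ ?_ h𝔭 h𝔫 hNirr hFsymm hpsum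
    hporth hpirr hpineq hpn hC hγ (HomogeneousFibration.fundForm_symm gM ((1 : G) : G ⧸ L))
    ?_ ?_ ?_ (fun l hl => HomogeneousFibration.fundForm_Ad hM hginv hl) ?_ hcM
    (HomogeneousFibration.homDeriv EK E K.subtype).toLinearMap
    (HomogeneousFibration.homDeriv_lie K.subtype hKs) ?_
    (HomogeneousFibration.fundForm_pullback hgF hKs hM hF) hcF a b
  · intro X hX
    -- The inclusion 𝔩 ⊆ 𝔨 is read off fundamental fields: one that vanishes at the base coset of
    -- G/L projects to one that vanishes at that of G/K.
    have h1 := HomogeneousFibration.mfderiv_quotientMap_fund hLK.le hM hsub.1.contMDiff X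
      ((1 : G) : G ⧸ L)
    rw [(hmemL X).2 hX, map_zero] at h1
    exact (hmemK X).1 h1.symm
  · rw [h𝔨]
    exact fun x hx y hy => HomogeneousFibration.lie_mem_subgroupLieAlg hKs hx hy
  · rw [h𝔩]
    exact fun x hx y hy => HomogeneousFibration.lie_mem_subgroupLieAlg hLemb.contMDiff hx hy
  · intro z hz x
    rw [HomogeneousFibration.fundForm_apply, (hmemL z).2 hz, map_zero, zero_apply]
  · exact fun x hx => gM.pos _ _ fun h0 => hx ((hmemL x).1 h0)
  · exact fun z hz x y => HomogeneousFibration.fundForm_ad hM hginv ((hmemL z).2 hz) x y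
  · intro hnk k hk x hx y hy
    exact HomogeneousFibration.fundForm_Ad_of_submersion hLK.le hM hginv hsub
      (fun X => (hmemK X).1) hAdk hk (hnk x hx) (hnk y hy)
      (hnk _ (hNirr.2.1 k hk x hx)) (hnk _ (hNirr.2.1 k hk y hy))
  · intro x
    rw [h𝔨]
    exact HomogeneousFibration.mem_subgroupLieAlg
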